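/- Let $r\ge 1$ and consider Problem B: minimize $J(x,u)=\int_{-1}^1F(x(t),u(t))\,dt+E(x(-1),x(1))$ over all pairs with $u\in L^\infty(-1,1)$ real valued and $x:[-1,1]\to\mathbb R^r$ absolutely continuous satisfying, almost everywhere, $\dot x_i=x_{i+1}$ ($1\le i<r$), $\dot x_r=f(x)+g(x)u$, and $x(-1)=x_0$. Here $F,E,f,g$ are globally Lipschitz and $g(z)\ne0$ for all $z$. Let $m\ge3$ and suppose that $f$, $g$, $F$ and $E(x_0,\cdot)$ are $C^m$. Suppose that Problem B has an optimal solution $(x^*,u^*)$ for which the $m$-th weak derivative $(x_r^*)^{(m)}$ has bounded variation on $[-1,1]$ (derivatives of lower order are taken continuous). For $N\ge1$ let $L_n$ be the Legendre polynomials, $t_0=-1<t_1<\dots<t_N=1$ the LGL nodes ($t_1,\dots,t_{N-1}$ are the roots of $\dot L_N$), $w_k=\frac{2}{N(N+1)}\frac1{L_N(t_k)^2}$ the LGL weights, and $D$ the $(N+1)\times(N+1)$ differentiation matrix with $D_{ik}=\frac{L_N(t_i)}{L_N(t_k)}\frac1{t_i-t_k}$ for $i\ne k$, $D_{00}=-\frac{N(N+1)}4$,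 $D_{NN}=\frac{N(N+1)}4$, and $D_{ik}=0$ otherwise. For an integer $m_1\ge 1$, Problem B$^N$ is to minimize, over $\bar x^{Nk}\in\mathbb R^r$, $\bar u^{Nk}\in\mathbb R$ ($0\le k\le N$), $$\bar J^N(\bar x^N,\bar u^N)=\sum_{k=0}^NF(\bar x^{Nk},\bar u^{Nk})w_k+E(\bar x^{N0},\bar x^{NN})$$ subject to, for all $0\le k\le N$, $(D(\bar x_i^N)^T)_k=\bar x_{i+1}^{Nk}$ ($1\le i<r$), $(D(\bar x_r^N)^T)_k=f(\bar x^{Nk})+g(\bar x^{Nk})\bar u^{Nk}$; $\bar x^{N0}=x_0$; $\underline b\le(\bar x^{Nk},\bar u^{Nk})\le\bar b$ componentwise for all $k$; $\underline b_j\le(D^j(\bar x_r^N)^T)_0\le\bar b_j$ for $1\le j\le m_1-1$; and $\sum_{n=0}^{N-r-m_1+1}|a_n^N(m_1)|\le d$, where $a_n^N(m_1)=(n+\tfrac12)\sum_{k=0}^NL_n(t_k)w_k\,(D^{m_1}(\bar x_r^N)^T)_k$. The bounds are assumed to be large enough in the following sense: the values of $(x^*(t),u^*(t))$ lie in the interior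 of the box $[\underline b,\bar b]$ (for $u^*$: almost everywhere, with a positive margin), $\underline b_j<(x_r^*)^{(j)}(t)<\bar b_j$ for $t\in[-1,1]$ and $1\le j\le m_1-1$, and $$d>\Big|\frac12\int_{-1}^1(x_r^*)^{(m_1)}(t)\,dt\Big|+\frac6{\sqrt\pi}\Big(\sup_{[-1,1]}\big|(x_r^*)^{(m_1+1)}\big|+V\big((x_r^*)^{(m_1+1)}\big)\Big)\sum_{k=1}^\infty\frac1{k^{3/2}},$$ where $V$ is the total variation on $[-1,1]$. For a discrete solution let $x^N(t)$ be the polynomial interpolation of $\bar x^N$ at the LGL nodes and $u^N(t)=\dfrac{\dot x^N_r(t)-f(x^N(t))}{g(x^N(t))}$. Let $[a]$ denote the integer part, $\gamma=\frac{2m}3-[\frac{2m}3]$, and set $$m_1=\begin{cases}[\frac{2m}3],&0\le\gamma<\frac23,\\ [\frac{2m}3]+1,&\gamma\ge\frac23,\end{cases}\qquad \delta=\begin{cases}1,&0<\gamma<\frac23,\\3(1-\gamma),&\gamma\ge\frac23,\\1+\varepsilon\ \text{ with an arbitrary }\varepsilon>0,&\gamma=0.\end{cases}$$ (i) $2\le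 m_1\le m-1$, and $m_1$ is a best choice in the sense that it maximizes, over all integers $1\le k\le m-1$, the exponent $\min\{2m-2k-1,\;k-1\}$ of the combined rate $N^{-(2m-2k-1)}+N^{-(k-1)}$. (ii) With this $m_1$ in Problem B$^N$, for every $\varepsilon>0$ there are constants $C$ and $N_0$ such that for every $N\ge N_0$ and every optimal solution $(\bar x^{*N},\bar u^{*N})$ of Problem B$^N$, with interpolation $(x^{*N},u^{*N})$, $$\big|J(x^*,u^*)-J(x^{*N},u^{*N})\big|\le\frac{C}{N^{[2m/3]-\delta}},\qquad \big|J(x^*,u^*)-\bar J^N(\bar x^{*N},\bar u^{*N})\big|\le\frac{C}{N^{[2m/3]-\delta}}.$$ -/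

import Mathlib

open MeasureTheory

namespace PSControl

noncomputable section

/-! ### The continuous-time problem -/

/-- The data of a Bolza problem for a single-input system of order `r` in feedback linearizable
normal form on `[-1, 1]`: running cost `F`, end-point cost `E`, the functions `f`, `g` of the last
state equation, and the initial state. -/
structure BolzaData (r : ℕ) where
  F : (Fin r → ℝ) × ℝ → ℝ
  E : (Fin r → ℝ) × (Fin r → ℝ) → ℝ
  f : (Fin r → ℝ) → ℝ
  g : (Fin r → ℝ) → ℝ
  initial : Fin r → ℝ

variable {r : ℕ}

/-- The right-hand side `(x₂, …, x_r, f(x) + g(x) u)` of the control system. -/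
def BolzaData.rhs (P : BolzaData r) (x : Fin r → ℝ) (u : ℝ) : Fin r → ℝ :=
  fun i => if h : (i : ℕ) + 1 < r then x ⟨i + 1, h⟩ else P.f x + P.g x * u

/-- The cost `J(x(·), u(·)) = ∫ F(x(t), u(t)) dt + E(x(-1), x(1))`. -/
def BolzaData.cost (P : BolzaData r) (x : ℝ → Fin r → ℝ) (u : ℝ → ℝ) : ℝ :=
  (∫ t in (-1 : ℝ)..1, P.F (x t, u t)) + P.E (x (-1), x 1)

/-- Admissible pairs: `u ∈ L^∞(-1, 1)`, and `x` is an absolutely continuous solution of the control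
system (almost everywhere) with the prescribed initial state. -/
structure BolzaData.IsAdmissible (P : BolzaData r) (x : ℝ → Fin r → ℝ) (u : ℝ → ℝ) : Prop where
  control : MemLp u ⊤ (volume.restrict (Set.Icc (-1 : ℝ) 1))
  absCont : ∀ i, AbsolutelyContinuousOnInterval (fun t => x t i) (-1) 1
  dynamics : ∀ᵐ t ∂(volume.restrict (Set.Icc (-1 : ℝ) 1)), ∀ i,
    HasDerivAt (fun s => x s i) (P.rhs (x t) (u t) i) t
  init : x (-1) = P.initial

/-- Optimal solutions of the continuous-time problem. -/
def BolzaData.IsOptimal (P : BolzaData r) (x : ℝ → Fin r → ℝ) (u : ℝ → ℝ) : Prop :=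
  P.IsAdmissible x u ∧ ∀ x' u', P.IsAdmissible x' u' → P.cost x u ≤ P.cost x' u'

/-! ### Weak derivatives -/

/-- `η` is a `j`-th weak derivative of `ξ` on `(-1, 1)`. -/
def IsWeakDeriv (j : ℕ) (ξ η : ℝ → ℝ) : Prop :=
  LocallyIntegrableOn ξ (Set.Ioo (-1) 1) ∧ LocallyIntegrableOn η (Set.Ioo (-1) 1) ∧
    ∀ φ : ℝ → ℝ, ContDiff ℝ (⊤ : ℕ∞) φ → HasCompactSupport φ → tsupport φ ⊆ Set.Ioo (-1) 1 →
      ∫ t in (-1 : ℝ)..1, ξ t * iteratedDeriv j φ t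
        = (-1) ^ j * ∫ t in (-1 : ℝ)..1, η t * φ t

/-- `y 0, …, y m` are the weak derivatives of `ξ` of orders `0, …, m`, the `m`-th one having bounded
variation on `[-1, 1]`. Those of order below `m` are represented by their (unique) continuous
representatives on `[-1, 1]`. -/
structure IsDerivFamily (m : ℕ) (ξ : ℝ → ℝ) (y : ℕ → ℝ → ℝ) : Prop where
  weak : ∀ j ≤ m, IsWeakDeriv j ξ (y j)
  cont : ∀ j < m, ContinuousOn (y j) (Set.Icc (-1) 1)
  bv : BoundedVariationOn (y m) (Set.Icc (-1) 1)

/-! ### Legendre polynomials and Legendre-Gauss-Lobatto discretization -/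

/-- The Legendre polynomial `L_n`, by the formula of Rodrigues. -/
def legendre (n : ℕ) : Polynomial ℝ :=
  Polynomial.C (1 / (2 ^ n * (n.factorial : ℝ))) *
    Polynomial.derivative^[n] ((Polynomial.X ^ 2 - 1) ^ n)

/-- The LGL nodes `t_0 < ⋯ < t_N`: the points `-1`, `1` and the roots of `L_N'`, listed in
increasing order. -/
def node (N : ℕ) (k : Fin (N + 1)) : ℝ :=
  ((insert (-1) (insert 1 (Polynomial.derivative (legendre N)).roots.toFinset) :
    Finset ℝ).sort (· ≤ ·)).getD k 0

/-- The LGL quadrature weights. -/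
def weight (N : ℕ) (k : Fin (N + 1)) : ℝ :=
  2 / ((N : ℝ) * (N + 1)) * (1 / ((legendre N).eval (node N k)) ^ 2)

/-- The LGL differentiation matrix `D`. -/
def diffMatrix (N : ℕ) : Matrix (Fin (N + 1)) (Fin (N + 1)) ℝ :=
  Matrix.of fun i k =>
    if i ≠ k then
      (legendre N).eval (node N i) / (legendre N).eval (node N k) * (1 / (node N i - node N k))
    else if k = 0 then -((N : ℝ) * (N + 1) / 4)
    else if k = Fin.last N then (N : ℝ) * (N + 1) / 4
    else 0

/-- The spectral coefficient `a_n^N(m₁)`: the `n`-th Legendre coefficient of the `m₁`-th derivative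
of the polynomial interpolating the nodal values `v`. -/
def spectralCoeff (N m₁ : ℕ) (v : Fin (N + 1) → ℝ) (n : ℕ) : ℝ :=
  ((n : ℝ) + 1 / 2) *
    ∑ k, (legendre n).eval (node N k) * weight N k * ((diffMatrix N ^ m₁).mulVec v) k

/-- The interpolating polynomial `x_i^N` of the nodal values `X · i`. -/
def interpPoly {N : ℕ} (X : Fin (N + 1) → Fin r → ℝ) (i : Fin r) : Polynomial ℝ :=
  Lagrange.interpolate Finset.univ (node N) (fun k => X k i)

/-- The interpolated state `x^N(t)`. -/
def interpState {N : ℕ} (X : Fin (N + 1) → Fin r → ℝ) (t : ℝ) : Fin r → ℝ :=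
  fun i => (interpPoly X i).eval t

/-- The index of the last state component. -/
def lastIdx (hr : 0 < r) : Fin r := ⟨r - 1, Nat.sub_lt hr Nat.one_pos⟩

/-- The (in general non-polynomial) interpolated control
`u^N(t) = ((x_r^N)'(t) - f(x^N(t))) / g(x^N(t))`. -/
def BolzaData.interpControl (P : BolzaData r) (hr : 0 < r) {N : ℕ}
    (X : Fin (N + 1) → Fin r → ℝ) (t : ℝ) : ℝ :=
  ((Polynomial.derivative (interpPoly X (lastIdx hr))).eval t - P.f (interpState X t)) /
    P.g (interpState X t)

/-! ### The discretized problem -/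

/-- The bounds defining the search region of the discretized problem: box bounds on states and
control, bounds on the initial derivatives of the last state (of each order), and the bound on the
sum of the spectral coefficients. -/
structure SearchBounds (r : ℕ) where
  stateLow : Fin r → ℝ
  stateUp : Fin r → ℝ
  controlLow : ℝ
  controlUp : ℝ
  derivLow : ℕ → ℝ
  derivUp : ℕ → ℝ
  spectral : ℝ

/-- The discrete cost `J̄^N`. -/
def BolzaData.discreteCost (P : BolzaData r) {N : ℕ} (X : Fin (N + 1) → Fin r → ℝ)
    (U : Fin (N + 1) → ℝ) : ℝ :=
  ∑ k, P.F (X k, U k) * weight N k + P.E (X 0, X (Fin.last N))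

/-- Feasibility for the discretized problem with `N + 1` nodes and regularization order `m₁`. Here
`X k` and `U k` are the state and control values at the node `t_k`. -/
structure BolzaData.IsDiscreteFeasible (P : BolzaData r) (hr : 0 < r) (b : SearchBounds r)
    (m₁ N : ℕ) (X : Fin (N + 1) → Fin r → ℝ) (U : Fin (N + 1) → ℝ) : Prop where
  dynamics : ∀ k i, ((diffMatrix N).mulVec (fun l => X l i)) k = P.rhs (X k) (U k) i
  init : X 0 = P.initial
  state : ∀ k i, b.stateLow i ≤ X k i ∧ X k i ≤ b.stateUp i
  control : ∀ k, b.controlLow ≤ U k ∧ U k ≤ b.controlUp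
  deriv : ∀ j, 1 ≤ j → j < m₁ →
    b.derivLow j ≤ ((diffMatrix N ^ j).mulVec (fun k => X k (lastIdx hr))) 0 ∧
      ((diffMatrix N ^ j).mulVec (fun k => X k (lastIdx hr))) 0 ≤ b.derivUp j
  spectral : ∑ n ∈ Finset.range (N + 2 - r - m₁),
    |spectralCoeff N m₁ (fun k => X k (lastIdx hr)) n| ≤ b.spectral

/-- Optimal solutions of the discretized problem. -/
def BolzaData.IsDiscreteOptimal (P : BolzaData r) (hr : 0 < r) (b : SearchBounds r)
    (m₁ N : ℕ) (X : Fin (N + 1) → Fin r → ℝ) (U : Fin (N + 1) → ℝ) : Prop :=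
  P.IsDiscreteFeasible hr b m₁ N X U ∧
    ∀ X' U', P.IsDiscreteFeasible hr b m₁ N X' U' → P.discreteCost X U ≤ P.discreteCost X' U'

/-- The bounds are large enough for the trajectory `(x, u)`, where `y j` is the `j`-th derivative of
the last state component: the trajectory and the derivatives of order `1, …, m₁ - 1` lie in the
interior of the region (with a positive margin for `u`, which is only defined almost everywhere),
and the spectral bound `d` satisfies `d > |a₀| + (6 / √π) (U + V) ζ(3/2)`, where `a₀` is the zeroth
Legendre coefficient of `y m₁`, and `U`, `V` are the supremum of the absolute value and the total
variation of `y (m₁ + 1)`. -/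
structure SearchBounds.LargeEnough (b : SearchBounds r) (m₁ : ℕ) (x : ℝ → Fin r → ℝ) (u : ℝ → ℝ)
    (y : ℕ → ℝ → ℝ) : Prop where
  state : ∀ t ∈ Set.Icc (-1 : ℝ) 1, ∀ i, b.stateLow i < x t i ∧ x t i < b.stateUp i
  control : ∃ η > 0, ∀ᵐ t ∂(volume.restrict (Set.Icc (-1 : ℝ) 1)),
    b.controlLow + η ≤ u t ∧ u t ≤ b.controlUp - η
  deriv : ∀ j, 1 ≤ j → j < m₁ → ∀ t ∈ Set.Icc (-1 : ℝ) 1,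
    b.derivLow j < y j t ∧ y j t < b.derivUp j
  spectral : |(1 / 2) * ∫ t in (-1 : ℝ)..1, y m₁ t| +
      6 / √Real.pi *
        (sSup ((fun t => |y (m₁ + 1) t|) '' Set.Icc (-1) 1) +
          (eVariationOn (y (m₁ + 1)) (Set.Icc (-1) 1)).toReal) *
        (∑' k : ℕ, 1 / ((k : ℝ) + 1) ^ (3 / 2 : ℝ)) < b.spectral

/-! ### The choice of the regularization order and the resulting rate -/

/-- `γ = 2m/3 - [2m/3]`. -/
def gam (m : ℕ) : ℝ := Int.fract (2 * (m : ℝ) / 3)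

/-- The choice of `m₁`. -/
def bestOrder (m : ℕ) : ℕ :=
  if gam m < 2 / 3 then ⌊2 * (m : ℝ) / 3⌋₊ else ⌊2 * (m : ℝ) / 3⌋₊ + 1

/-- The loss `δ` in the exponent; the parameter `ε` only matters if `γ = 0`. -/
def rateLoss (m : ℕ) (ε : ℝ) : ℝ :=
  if gam m = 0 then 1 + ε else if gam m < 2 / 3 then 1 else 3 * (1 - gam m)

/-- The exponent `min {2m - 2k - 1, k - 1}` of the combined rate
`1 / N^(2m - 2k - 1) + 1 / N^(k - 1)` for the regularization order `k`. -/
def combinedExponent (m k : ℕ) : ℤ := min (2 * m - 2 * k - 1) (k - 1)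

end

end PSControl

/-!
Write `q = m - m₁`. All estimates are made for the chain of integrators `x₁' = x₂, …, x_r' = v`:
since `g` has no zeros, the control is recovered from the state and from `v` by
`BolzaData.controlLaw`, and the running cost becomes a `C^m` function `BolzaData.reducedCost` of
`(x, v)`.

*Discrete solutions are polynomials.* The differentiation matrix is exact on polynomials of degree
at most `N` (`diffMatrix_mulVec`), so that a feasible point of the discretized problem consists of
the nodal values of a chain of polynomials (`BolzaData.IsDiscreteFeasible.exists_isNodal`). The LGL
quadrature is exact up to degree `2 N - 1` (`integral_eq_sum_weight`), so the numbers `a_n^N(m₁)`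
are the Legendre coefficients of the `m₁`-th derivative of the last state component. As `|L_n| ≤ 1`
on `[-1, 1]`, the spectral constraint bounds this derivative, and the other constraints bound those
of lower order, all uniformly in `N` (`exists_bound_of_isDiscreteFeasible`). Hence the running cost
along the interpolated pair has bounded derivatives of order `m₁ - 1`, and by Jackson's theorem the
positive quadrature has an error `O(N ^ -(m₁ - 1))` on it (`abs_integral_sub_quadrature_le`,
`exists_abs_cost_sub_discreteCost_le`).

*The optimal trajectory is approximated by feasible points.* Truncate the Legendre series of the
`m₁`-th derivative of `x_r*` and integrate back to polynomials with the same initial values. The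
series converges uniformly with error `O(N ^ -(q - 1/2))` because the `q`-th derivative of the
function expanded has bounded variation (`exists_abs_sub_sum_legCoeff_le`), and the sum of the
absolute values of its coefficients is controlled by the bound assumed for `d`
(`IsPrimitive.sum_abs_legCoeff_le`). An error `e` in the trajectory changes the cost by `O(e²)`
only: the reflection `2 x* - x` of a trajectory at the optimal one is a trajectory as well and does
not cost less than `x*`, so that the excess cost is bounded by a second difference
(`exists_cost_sub_le`). This gives `O(N ^ -(2 q - 1))` (`exists_isDiscreteFeasible_cost_sub_le`).

Both costs of a discrete optimal solution are then squeezed between the optimal cost and the cost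
of the approximation, up to quadrature errors (`exists_abs_cost_sub_le`), and it remains to compare
the exponents `2 m - 2 m₁ - 1` and `m₁ - 1` according to the residue of `m` modulo `3`.
-/

namespace PSControl

noncomputable section

/-! ### Legendre polynomials: algebraic identities -/

open Polynomial in
lemma iterate_derivative_X_mul' (p : ℝ[X]) (n : ℕ) :
    derivative^[n + 1] (X * p) =
      X * derivative^[n + 1] p + (n + 1 : ℝ[X]) * derivative^[n] p := by
  induction n with
  | zero => simp [derivative_mul, add_comm]
  | succ n ih =>
    rw [Function.iterate_succ_apply', ih]
    simp only [derivative_add, derivative_mul, derivative_X, derivative_natCast, derivative_one,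
      ← Function.iterate_succ_apply' (f := derivative), Nat.succ_eq_add_one]
    push_cast
    ring

open Polynomial in
/-- `L'_{n+1} = t L'_n + (n + 1) L_n`. -/
lemma derivative_legendre_succ (n : ℕ) :
    derivative (legendre (n + 1)) =
      X * derivative (legendre n) + (n + 1 : ℝ[X]) * legendre n := by
  have h1 : derivative ((X ^ 2 - 1 : ℝ[X]) ^ (n + 1)) =
      C (2 * (n + 1 : ℝ)) * (X * (X ^ 2 - 1 : ℝ[X]) ^ n) := by
    rw [derivative_pow_succ]
    simp [show (C 2 : ℝ[X]) = 2 from rfl]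
    ring
  have h2 : derivative^[n + 2] ((X ^ 2 - 1 : ℝ[X]) ^ (n + 1)) = C (2 * (n + 1 : ℝ)) *
      (X * derivative^[n + 1] ((X ^ 2 - 1 : ℝ[X]) ^ n)
        + (n + 1 : ℝ[X]) * derivative^[n] ((X ^ 2 - 1 : ℝ[X]) ^ n)) := by
    rw [Function.iterate_succ_apply, h1, iterate_derivative_C_mul, iterate_derivative_X_mul']
  have h3 : (C (1 / (2 ^ (n + 1) * ((n + 1).factorial : ℝ))) * C (2 * (n + 1 : ℝ)) : ℝ[X]) =
      C (1 / (2 ^ n * (n.factorial : ℝ))) := by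
    rw [← C_mul]
    congr 1
    rw [Nat.factorial_succ]
    have := n.factorial_pos
    push_cast
    field_simp
    ring
  unfold legendre
  rw [derivative_C_mul, derivative_C_mul, ← Function.iterate_succ_apply' (f := derivative),
    ← Function.iterate_succ_apply' (f := derivative), h2, ← mul_assoc, h3]
  ring

open Polynomial in
/-- `L'_{n+2} - L'_n = (2n + 3) L_{n+1}`. -/
lemma derivative_legendre_add_two_sub (n : ℕ) :
    derivative (legendre (n + 2)) - derivative (legendre n) =
      (2 * n + 3 : ℝ[X]) * legendre (n + 1) := by
  have h1 : derivative^[2] ((X ^ 2 - 1 : ℝ[X]) ^ (n + 2)) =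
      C (2 * (n + 2) * (2 * n + 3) : ℝ) * (X ^ 2 - 1 : ℝ[X]) ^ (n + 1) +
        C (4 * (n + 2) * (n + 1) : ℝ) * (X ^ 2 - 1 : ℝ[X]) ^ n := by
    simp only [Function.iterate_succ, Function.iterate_zero, Function.comp, id]
    rw [derivative_pow_succ]
    simp [derivative_pow_succ, show (C 2 : ℝ[X]) = 2 from rfl, show (C 3 : ℝ[X]) = 3 from rfl,
      show (C 4 : ℝ[X]) = 4 from rfl]
    ring
  have h2 : derivative^[n + 3] ((X ^ 2 - 1 : ℝ[X]) ^ (n + 2)) =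
      C (2 * (n + 2) * (2 * n + 3) : ℝ) * derivative^[n + 1] ((X ^ 2 - 1 : ℝ[X]) ^ (n + 1)) +
        C (4 * (n + 2) * (n + 1) : ℝ) * derivative^[n + 1] ((X ^ 2 - 1 : ℝ[X]) ^ n) := by
    rw [show n + 3 = (n + 1) + 2 by ring, Function.iterate_add_apply, h1, iterate_map_add,
      iterate_derivative_C_mul, iterate_derivative_C_mul]
  have h3 : (C (1 / (2 ^ (n + 2) * ((n + 2).factorial : ℝ))) *
      C (2 * (n + 2) * (2 * n + 3) : ℝ) : ℝ[X]) =
      (2 * n + 3 : ℝ[X]) * C (1 / (2 ^ (n + 1) * ((n + 1).factorial : ℝ))) := by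
    rw [show (2 * n + 3 : ℝ[X]) = C (2 * n + 3 : ℝ) by
      simp [show (C 2 : ℝ[X]) = 2 from rfl, show (C 3 : ℝ[X]) = 3 from rfl], ← C_mul, ← C_mul]
    congr 1
    rw [Nat.factorial_succ (n + 1)]
    have := (n + 1).factorial_pos
    push_cast
    field_simp
    ring
  have h4 : (C (1 / (2 ^ (n + 2) * ((n + 2).factorial : ℝ))) *
      C (4 * (n + 2) * (n + 1) : ℝ) : ℝ[X]) = C (1 / (2 ^ n * (n.factorial : ℝ))) := by
    rw [← C_mul]
    congr 1
    rw [Nat.factorial_succ (n + 1), Nat.factorial_succ n]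
    have := n.factorial_pos
    push_cast
    field_simp
    ring
  unfold legendre
  rw [derivative_C_mul, derivative_C_mul, ← Function.iterate_succ_apply' (f := derivative),
    ← Function.iterate_succ_apply' (f := derivative), h2, mul_add, ← mul_assoc, ← mul_assoc, h3, h4]
  ring

lemma legendre_zero : legendre 0 = 1 := by simp [legendre]

lemma legendre_one : legendre 1 = Polynomial.X := by
  refine Polynomial.funext fun t => ?_
  simp [legendre]
  ring

open Polynomial in
/-- `t L'_{n+1} - L'_n = (n + 1) L_{n+1}`. -/
lemma X_mul_derivative_legendre_succ (n : ℕ) :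
    X * derivative (legendre (n + 1)) - derivative (legendre n) =
      (n + 1 : ℝ[X]) * legendre (n + 1) := by
  have h1 := derivative_legendre_succ (n + 1)
  have h2 := derivative_legendre_add_two_sub n
  push_cast at h1
  linear_combination h2 - h1

open Polynomial in
/-- `(1 - t²) L'_{n+1} = (n + 1) (L_n - t L_{n+1})`. -/
lemma one_sub_sq_mul_derivative_legendre_succ (n : ℕ) :
    (1 - X ^ 2) * derivative (legendre (n + 1)) =
      (n + 1 : ℝ[X]) * (legendre n - X * legendre (n + 1)) := by
  linear_combination derivative_legendre_succ n - X * X_mul_derivative_legendre_succ n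

open Polynomial in
/-- Legendre's differential equation. -/
lemma derivative_one_sub_sq_mul_derivative_legendre (n : ℕ) :
    derivative ((1 - X ^ 2) * derivative (legendre n)) =
      -((n * (n + 1) : ℝ[X]) * legendre n) := by
  cases n with
  | zero => simp [legendre_zero]
  | succ n =>
    rw [one_sub_sq_mul_derivative_legendre_succ]
    simp only [derivative_mul, derivative_add, derivative_sub, derivative_X, derivative_natCast,
      derivative_one]
    push_cast
    linear_combination -(n + 1 : ℝ[X]) * X_mul_derivative_legendre_succ n

open Polynomial in
/-- `(2n + 3) (1 - t²) L'_{n+1} = (n + 1) (n + 2) (L_n - L_{n+2})`. -/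
lemma one_sub_sq_mul_derivative_legendre_eq_sub (n : ℕ) :
    (2 * n + 3 : ℝ[X]) * ((1 - X ^ 2) * derivative (legendre (n + 1))) =
      ((n + 1) * (n + 2) : ℝ[X]) * (legendre n - legendre (n + 2)) := by
  have h1 := one_sub_sq_mul_derivative_legendre_succ (n + 1)
  have h2 := derivative_legendre_succ (n + 1)
  have h3 := one_sub_sq_mul_derivative_legendre_succ n
  push_cast at h1 h2
  refine mul_left_cancel₀ (X_ne_zero (R := ℝ)) ?_
  linear_combination (n + 1 : ℝ[X]) * (h1 - (1 - X ^ 2) * h2) + X * (n + 2) * h3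

lemma eval_one_legendre (n : ℕ) : (legendre n).eval 1 = 1 := by
  induction n with
  | zero => simp [legendre_zero]
  | succ n ih =>
    have h := congrArg (Polynomial.eval 1) (one_sub_sq_mul_derivative_legendre_succ n)
    simp [ih] at h
    have : (n : ℝ) + 1 ≠ 0 := by positivity
    rcases h with h | h
    · exact absurd h this
    · linarith

lemma eval_neg_one_legendre (n : ℕ) : (legendre n).eval (-1) = (-1) ^ n := by
  induction n with
  | zero => simp [legendre_zero]
  | succ n ih =>
    have h := congrArg (Polynomial.eval (-1)) (one_sub_sq_mul_derivative_legendre_succ n)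
    simp [ih] at h
    have : (n : ℝ) + 1 ≠ 0 := by positivity
    rcases h with h | h
    · exact absurd h this
    · rw [pow_succ]; linarith

lemma eval_one_derivative_legendre (n : ℕ) :
    (Polynomial.derivative (legendre n)).eval 1 = n * (n + 1) / 2 := by
  have h := congrArg (Polynomial.eval 1) (derivative_one_sub_sq_mul_derivative_legendre n)
  simp [eval_one_legendre] at h
  linarith

lemma eval_neg_one_derivative_legendre (n : ℕ) :
    (Polynomial.derivative (legendre n)).eval (-1) = -(n * (n + 1) / 2 * (-1) ^ n) := by
  have h := congrArg (Polynomial.eval (-1)) (derivative_one_sub_sq_mul_derivative_legendre n)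
  simp [eval_neg_one_legendre] at h
  linarith

lemma natDegree_legendre_le (n : ℕ) : (legendre n).natDegree ≤ n := by
  unfold legendre
  refine (Polynomial.natDegree_C_mul_le _ _).trans ?_
  refine (Polynomial.natDegree_iterate_derivative _ _).trans ?_
  have : ((Polynomial.X ^ 2 - 1 : Polynomial ℝ) ^ n).natDegree ≤ n * 2 := by
    refine Polynomial.natDegree_pow_le_of_le n ?_
    compute_degree
  omega

/-! ### Orthogonality -/

lemma intervalIntegrable_poly (p : Polynomial ℝ) (a b : ℝ) :
    IntervalIntegrable (fun t => p.eval t) volume a b :=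
  p.continuous.intervalIntegrable a b

lemma integral_derivative_poly (p : Polynomial ℝ) (a b : ℝ) :
    ∫ t in a..b, (Polynomial.derivative p).eval t = p.eval b - p.eval a :=
  intervalIntegral.integral_eq_sub_of_hasDerivAt (fun t _ => p.hasDerivAt t)
    (intervalIntegrable_poly _ _ _)

lemma integral_legendre_parts (p : Polynomial ℝ) (n : ℕ) :
    (2 * n + 3) * ∫ t in (-1 : ℝ)..1, p.eval t * (legendre (n + 1)).eval t =
      ∫ t in (-1 : ℝ)..1, (Polynomial.derivative p).eval t *
        ((legendre n).eval t - (legendre (n + 2)).eval t) := by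
  have h := integral_derivative_poly (p * (legendre (n + 2) - legendre n)) (-1) 1
  simp only [Polynomial.eval_mul, Polynomial.eval_sub, eval_one_legendre, eval_neg_one_legendre,
    Polynomial.derivative_mul, Polynomial.derivative_sub,
    derivative_legendre_add_two_sub] at h
  have h0 : p.eval 1 * (1 - 1) - p.eval (-1) * ((-1) ^ (n + 2) - (-1 : ℝ) ^ n) = 0 := by
    rw [pow_add]; ring
  rw [h0] at h
  have hi := intervalIntegrable_poly (Polynomial.derivative p * (legendre n - legendre (n + 2)))
    (-1) 1
  have hj := intervalIntegrable_poly
    (p * ((2 * n + 3 : Polynomial ℝ) * legendre (n + 1))) (-1) 1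
  rw [← intervalIntegral.integral_const_mul, ← sub_eq_zero, ← h]
  simp only [Polynomial.eval_mul, Polynomial.eval_sub] at hi hj
  rw [← intervalIntegral.integral_sub (by convert hj using 2; simp; ring) hi]
  refine intervalIntegral.integral_congr fun t _ => ?_
  simp
  ring

/-- `L_n` is orthogonal to all polynomials of lower degree. -/
lemma integral_mul_legendre_eq_zero {p : Polynomial ℝ} {n : ℕ} (h : p.natDegree < n) :
    ∫ t in (-1 : ℝ)..1, p.eval t * (legendre n).eval t = 0 := by
  induction hd : p.natDegree generalizing p n with
  | zero =>
    obtain ⟨k, rfl⟩ : ∃ k, n = k + 1 := ⟨n - 1, by omega⟩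
    have h1 := integral_legendre_parts p k
    rw [Polynomial.derivative_of_natDegree_zero hd] at h1
    have : (2 * k + 3 : ℝ) ≠ 0 := by positivity
    simpa [this] using h1
  | succ d ih =>
    obtain ⟨k, rfl⟩ : ∃ k, n = k + 1 := ⟨n - 1, by omega⟩
    have h1 := integral_legendre_parts p k
    have hd' : (Polynomial.derivative p).natDegree = d := by
      rw [Polynomial.natDegree_derivative, hd]; rfl
    have e1 := ih (p := Polynomial.derivative p) (n := k) (by omega) hd'
    have e2 := ih (p := Polynomial.derivative p) (n := k + 2) (by omega) hd'
    have i1 := intervalIntegrable_poly (Polynomial.derivative p * legendre k) (-1) 1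
    have i2 := intervalIntegrable_poly (Polynomial.derivative p * legendre (k + 2)) (-1) 1
    simp only [Polynomial.eval_mul] at i1 i2
    simp only [mul_sub] at h1
    rw [intervalIntegral.integral_sub i1 i2, e1, e2, sub_zero] at h1
    have : (2 * k + 3 : ℝ) ≠ 0 := by positivity
    simpa [this] using h1

lemma integral_legendre_mul_self (n : ℕ) :
    ∫ t in (-1 : ℝ)..1, (legendre n).eval t * (legendre n).eval t = 2 / (2 * n + 1) := by
  cases n with
  | zero => simp [legendre_zero]; norm_num
  | succ n =>
    have h1 := integral_legendre_parts (legendre (n + 1)) n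
    have i1 := intervalIntegrable_poly (Polynomial.derivative (legendre (n + 1)) * legendre n) (-1) 1
    have i2 := intervalIntegrable_poly
      (Polynomial.derivative (legendre (n + 1)) * legendre (n + 2)) (-1) 1
    have i3 := intervalIntegrable_poly (legendre (n + 1) * Polynomial.derivative (legendre n)) (-1) 1
    have hdeg := natDegree_legendre_le (n + 1)
    have hdeg' := natDegree_legendre_le n
    have hd1 := Polynomial.natDegree_derivative_le (legendre (n + 1))
    have hd2 := Polynomial.natDegree_derivative_le (legendre n)
    have e2 := integral_mul_legendre_eq_zero (p := Polynomial.derivative (legendre (n + 1)))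
      (n := n + 2) (by omega)
    have e3 := integral_mul_legendre_eq_zero (p := Polynomial.derivative (legendre n))
      (n := n + 1) (by omega)
    have h := integral_derivative_poly (legendre (n + 1) * legendre n) (-1) 1
    simp only [Polynomial.derivative_mul, Polynomial.eval_add, Polynomial.eval_mul,
      eval_one_legendre, eval_neg_one_legendre] at h i1 i2 i3
    rw [intervalIntegral.integral_add i1 i3] at h
    simp only [mul_comm] at e3 h
    rw [e3] at h
    simp only [mul_sub] at h1
    rw [intervalIntegral.integral_sub i1 i2, e2, sub_zero] at h1
    simp only [mul_comm] at h1
    rw [add_zero] at h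
    rw [h] at h1
    have hs : ((-1 : ℝ) ^ n * (-1) ^ (n + 1)) = -1 := by
      rw [← pow_add]; exact Odd.neg_one_pow ⟨n, by ring⟩
    rw [hs] at h1
    have : (n * 2 + 3 : ℝ) ≠ 0 := by positivity
    push_cast
    rw [eq_div_iff (by positivity)]
    linarith

lemma legendre_ne_zero (n : ℕ) : legendre n ≠ 0 := by
  intro h
  have := eval_one_legendre n
  simp [h] at this

lemma natDegree_legendre (n : ℕ) : (legendre n).natDegree = n := by
  refine le_antisymm (natDegree_legendre_le n) ?_
  by_contra! h
  have h1 := integral_mul_legendre_eq_zero h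
  rw [integral_legendre_mul_self] at h1
  have : (0 : ℝ) < 2 / (2 * n + 1) := by positivity
  linarith

/-! ### Size of the Legendre polynomials on `[-1, 1]` -/

lemma monotoneOn_of_hasDerivAt {f f' : ℝ → ℝ} {a b : ℝ} (hf : ∀ t, HasDerivAt f (f' t) t)
    (h : ∀ t ∈ Set.Icc a b, 0 ≤ f' t) : MonotoneOn f (Set.Icc a b) :=
  monotoneOn_of_deriv_nonneg (convex_Icc a b) (fun t _ => (hf t).continuousAt.continuousWithinAt)
    (fun t _ => (hf t).differentiableAt.differentiableWithinAt)
    (fun t ht => by rw [(hf t).deriv]; exact h t (interior_subset ht))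

lemma antitoneOn_of_hasDerivAt {f f' : ℝ → ℝ} {a b : ℝ} (hf : ∀ t, HasDerivAt f (f' t) t)
    (h : ∀ t ∈ Set.Icc a b, f' t ≤ 0) : AntitoneOn f (Set.Icc a b) :=
  antitoneOn_of_deriv_nonpos (convex_Icc a b) (fun t _ => (hf t).continuousAt.continuousWithinAt)
    (fun t _ => (hf t).differentiableAt.differentiableWithinAt)
    (fun t ht => by rw [(hf t).deriv]; exact h t (interior_subset ht))

lemma eval_legendre_ode (n : ℕ) (t : ℝ) :
    (1 - t ^ 2) * (Polynomial.derivative (Polynomial.derivative (legendre n))).eval t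
      - 2 * t * (Polynomial.derivative (legendre n)).eval t
      = -(n * (n + 1) * (legendre n).eval t) := by
  have h := congrArg (Polynomial.eval t) (derivative_one_sub_sq_mul_derivative_legendre n)
  simp [Polynomial.derivative_mul] at h
  linarith

/-- The energy `n (n + 1) L_n² + (1 - t²) L_n'²` increases with `|t|`, so that its values on
`[-1, 1]` do not exceed those at the end points. -/
lemma abs_eval_legendre_le_one (n : ℕ) {t : ℝ} (ht : t ∈ Set.Icc (-1 : ℝ) 1) :
    |(legendre n).eval t| ≤ 1 := by
  rcases Nat.eq_zero_or_pos n with rfl | hn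
  · simp [legendre_zero]
  set φ : ℝ → ℝ := fun t => n * (n + 1) * (legendre n).eval t ^ 2 +
    (1 - t ^ 2) * (Polynomial.derivative (legendre n)).eval t ^ 2 with hφ
  have hder : ∀ s, HasDerivAt φ (2 * s * (Polynomial.derivative (legendre n)).eval s ^ 2) s := by
    intro s
    have h1 := (legendre n).hasDerivAt s
    have h2 := (Polynomial.derivative (legendre n)).hasDerivAt s
    have h3 := (((h1.pow 2).const_mul ((n : ℝ) * (n + 1)))).add
      ((((hasDerivAt_id s).pow 2).const_sub 1).mul (h2.pow 2))
    refine h3.congr_deriv ?_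
    have := eval_legendre_ode n s
    simp
    linear_combination (2 * (Polynomial.derivative (legendre n)).eval s) * this
  have hend : φ t ≤ n * (n + 1) := by
    rcases le_total 0 t with h0 | h0
    · have hm := monotoneOn_of_hasDerivAt (a := 0) (b := 1) hder
        (fun s hs => by have := hs.1; positivity)
      have := hm ⟨h0, ht.2⟩ ⟨zero_le_one, le_rfl⟩ ht.2
      simpa [hφ, eval_one_legendre] using this
    · have hm := antitoneOn_of_hasDerivAt (a := -1) (b := 0) hder (fun s hs => by
        have := hs.2
        have h2 := sq_nonneg ((Polynomial.derivative (legendre n)).eval s)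
        nlinarith)
      have := hm ⟨le_rfl, by norm_num⟩ ⟨ht.1, h0⟩ ht.1
      simpa [hφ, eval_neg_one_legendre, ← pow_mul, mul_comm n 2] using this
  have hpos : (0 : ℝ) < n * (n + 1) := by positivity
  have h1 : 0 ≤ (1 - t ^ 2) * (Polynomial.derivative (legendre n)).eval t ^ 2 := by
    have : 0 ≤ 1 - t ^ 2 := by nlinarith [ht.1, ht.2]
    positivity
  rw [← sq_le_one_iff_abs_le_one]
  have h2 : n * (n + 1) * (legendre n).eval t ^ 2 ≤ n * (n + 1) * 1 := by
    simp only [hφ] at hend; linarith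
  exact le_of_mul_le_mul_left h2 hpos

/-- This follows from the recursion `(n + 2) L_{n+2}(0) = -(n + 1) L_n(0)`. -/
lemma eval_zero_legendre_sq_le (n : ℕ) : (n + 1) * (legendre n).eval 0 ^ 2 ≤ 1 := by
  induction n using Nat.twoStepInduction with
  | zero => simp [legendre_zero]
  | one => simp [legendre_one]
  | more n ih _ =>
    have h1 := congrArg (Polynomial.eval 0) (X_mul_derivative_legendre_succ (n + 1))
    have h2 := congrArg (Polynomial.eval 0) (derivative_legendre_succ n)
    simp at h1 h2
    have h3 : (n + 2) * (legendre (n + 2)).eval 0 = -((n + 1) * (legendre n).eval 0) := by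
      linarith
    have h4 : ((n + 2) * (legendre (n + 2)).eval 0) ^ 2 = ((n + 1) * (legendre n).eval 0) ^ 2 := by
      rw [h3]; ring
    have h5 : ((n : ℝ) + 2) ^ 2 * ((n + 3) * (legendre (n + 2)).eval 0 ^ 2) ≤ ((n : ℝ) + 2) ^ 2 := by
      have : ((n : ℝ) + 2) ^ 2 * ((n + 3) * (legendre (n + 2)).eval 0 ^ 2) =
          (n + 3) * (n + 1) * ((n + 1) * (legendre n).eval 0 ^ 2) := by
        linear_combination (n + 3 : ℝ) * h4
      rw [this]
      have h6 : ((n : ℝ) + 3) * (n + 1) * ((n + 1) * (legendre n).eval 0 ^ 2) ≤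
        ((n : ℝ) + 3) * (n + 1) * 1 := by gcongr
      nlinarith
    have hp : (0 : ℝ) < ((n : ℝ) + 2) ^ 2 := by positivity
    push_cast
    rw [show (n : ℝ) + 2 + 1 = n + 3 by ring]
    nlinarith

/-- The energy `n (n + 1) (1 - t²) L_n² + ((1 - t²) L_n')²` decreases with `|t|`, so that its values
do not exceed the one at `0`, which is at most `2 n`. -/
lemma sq_one_sub_sq_mul_derivative_legendre_le (n : ℕ) {t : ℝ} (ht : t ∈ Set.Icc (-1 : ℝ) 1) :
    ((1 - t ^ 2) * (Polynomial.derivative (legendre n)).eval t) ^ 2 ≤ 2 * n := by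
  set φ : ℝ → ℝ := fun t => n * (n + 1) * ((1 - t ^ 2) * (legendre n).eval t ^ 2) +
    ((1 - t ^ 2) * (Polynomial.derivative (legendre n)).eval t) ^ 2 with hφ
  have hder : ∀ s, HasDerivAt φ (-(2 * s * (n * (n + 1) * (legendre n).eval s ^ 2))) s := by
    intro s
    have h1 := (legendre n).hasDerivAt s
    have h2 := (Polynomial.derivative (legendre n)).hasDerivAt s
    have h0 := ((hasDerivAt_id s).pow 2).const_sub 1
    have h3 := ((h0.mul (h1.pow 2)).const_mul ((n : ℝ) * (n + 1))).add ((h0.mul h2).pow 2)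
    refine h3.congr_deriv ?_
    have := eval_legendre_ode n s
    simp
    linear_combination (2 * (1 - s ^ 2) * (Polynomial.derivative (legendre n)).eval s) * this
  have hend : φ t ≤ φ 0 := by
    rcases le_total 0 t with h0 | h0
    · have hm := antitoneOn_of_hasDerivAt (a := 0) (b := 1) hder
        (fun s hs => by have := hs.1; rw [neg_nonpos]; positivity)
      exact hm ⟨le_rfl, zero_le_one⟩ ⟨h0, ht.2⟩ h0
    · have hm := monotoneOn_of_hasDerivAt (a := -1) (b := 0) hder (fun s hs => by
        have := hs.2
        have h2 : 0 ≤ (n : ℝ) * (n + 1) * (legendre n).eval s ^ 2 := by positivity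
        nlinarith)
      exact hm ⟨ht.1, h0⟩ ⟨by norm_num, le_rfl⟩ h0
  have hz : φ 0 ≤ 2 * n := by
    simp only [hφ]
    rcases n with _ | n
    · simp [legendre_zero]
    · have h2 := congrArg (Polynomial.eval 0) (derivative_legendre_succ n)
      simp at h2
      have a1 := eval_zero_legendre_sq_le (n + 1)
      have a2 := eval_zero_legendre_sq_le n
      rw [h2]
      push_cast at *
      have hn : (0 : ℝ) ≤ n := n.cast_nonneg
      nlinarith
  have h1 : 0 ≤ n * (n + 1) * ((1 - t ^ 2) * (legendre n).eval t ^ 2) := by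
    have : 0 ≤ 1 - t ^ 2 := by nlinarith [ht.1, ht.2]
    positivity
  have h3 : φ t = n * (n + 1) * ((1 - t ^ 2) * (legendre n).eval t ^ 2) +
    ((1 - t ^ 2) * (Polynomial.derivative (legendre n)).eval t) ^ 2 := rfl
  linarith

/-- The normalized primitive `(L_{n+2} - L_n) / (2n + 3)` of `L_{n+1}` is `O(n^{-3/2})`. -/
lemma abs_legendre_sub_le (n : ℕ) {t : ℝ} (ht : t ∈ Set.Icc (-1 : ℝ) 1) :
    |(legendre (n + 2)).eval t - (legendre n).eval t| / (2 * n + 3) ≤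
      √(2 * (n + 1)) / ((n + 1) * (n + 2)) := by
  have h := congrArg (Polynomial.eval t) (one_sub_sq_mul_derivative_legendre_eq_sub n)
  have h1 := sq_one_sub_sq_mul_derivative_legendre_le (n + 1) ht
  have h2 := Real.abs_le_sqrt h1
  simp at h
  push_cast at h2
  rw [div_le_div_iff₀ (by positivity) (by positivity)]
  have hp : (0 : ℝ) < (n + 1) * (n + 2) := by positivity
  have h3 : |(legendre (n + 2)).eval t - (legendre n).eval t| * ((n + 1) * (n + 2)) =
      (2 * n + 3) * |(1 - t ^ 2) * (Polynomial.derivative (legendre (n + 1))).eval t| := by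
    rw [← abs_of_pos hp, ← abs_mul, ← abs_of_pos (show (0 : ℝ) < 2 * n + 3 by positivity),
      ← abs_mul, h, ← abs_neg]
    congr 1
    ring
  rw [h3, mul_comm]
  gcongr

/-! ### The Legendre-Gauss-Lobatto nodes -/

/-- `L_n` has simple roots: a common root of `L_n` and `L_n'` would be one of `L_{n-1}` and `L_{n-1}'`,
and so on down to `L_0 = 1`. -/
lemma not_legendre_and_derivative_eq_zero (n : ℕ) (t : ℝ) (h0 : (legendre n).eval t = 0)
    (h1 : (Polynomial.derivative (legendre n)).eval t = 0) : False := by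
  induction n with
  | zero => simp [legendre_zero] at h0
  | succ n ih =>
    have e1 := congrArg (Polynomial.eval t) (X_mul_derivative_legendre_succ n)
    have e2 := congrArg (Polynomial.eval t) (one_sub_sq_mul_derivative_legendre_succ n)
    simp [h0, h1] at e1 e2
    exact ih (e2.resolve_left (by positivity)) e1

lemma one_le_eval_legendre (n : ℕ) :
    ∀ t : ℝ, 1 ≤ t → 1 ≤ (legendre n).eval t ∧ 0 ≤ (Polynomial.derivative (legendre n)).eval t := by
  induction n with
  | zero => simp [legendre_zero]
  | succ n ih =>
    have hd : ∀ t : ℝ, 1 ≤ t → 0 ≤ (Polynomial.derivative (legendre (n + 1))).eval t := by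
      intro t ht
      obtain ⟨h1, h2⟩ := ih t ht
      have e := congrArg (Polynomial.eval t) (derivative_legendre_succ n)
      simp at e
      rw [e]
      positivity
    intro t ht
    refine ⟨?_, hd t ht⟩
    have hm := monotoneOn_of_hasDerivAt (a := 1) (b := t) (fun s => (legendre (n + 1)).hasDerivAt s)
      (fun s hs => hd s hs.1)
    simpa [eval_one_legendre] using hm ⟨le_rfl, ht⟩ ⟨ht, le_rfl⟩ ht

lemma eval_neg_legendre (n : ℕ) (t : ℝ) :
    (legendre n).eval (-t) = (-1) ^ n * (legendre n).eval t ∧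
      (Polynomial.derivative (legendre n)).eval (-t) =
        -((-1) ^ n * (Polynomial.derivative (legendre n)).eval t) := by
  induction n with
  | zero => simp [legendre_zero]
  | succ n ih =>
    have e := congrArg (Polynomial.eval t) (derivative_legendre_succ n)
    have e' := congrArg (Polynomial.eval (-t)) (derivative_legendre_succ n)
    have f := congrArg (Polynomial.eval t) (X_mul_derivative_legendre_succ n)
    have f' := congrArg (Polynomial.eval (-t)) (X_mul_derivative_legendre_succ n)
    simp [ih] at e e' f f'
    have hp : (n : ℝ) + 1 ≠ 0 := by positivity
    have h2 : (Polynomial.derivative (legendre (n + 1))).eval (-t) =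
        -((-1) ^ (n + 1) * (Polynomial.derivative (legendre (n + 1))).eval t) := by
      rw [e, e', pow_succ]; ring
    refine ⟨mul_left_cancel₀ hp ?_, h2⟩
    rw [h2] at f'
    rw [pow_succ] at *
    linear_combination -f' - (-1) ^ n * f

lemma derivative_legendre_pos {n : ℕ} (hn : 1 ≤ n) {t : ℝ} (ht : 1 ≤ t) :
    0 < (Polynomial.derivative (legendre n)).eval t := by
  obtain ⟨n, rfl⟩ : ∃ k, n = k + 1 := ⟨n - 1, by omega⟩
  obtain ⟨h1, h2⟩ := one_le_eval_legendre n t ht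
  have e := congrArg (Polynomial.eval t) (derivative_legendre_succ n)
  simp at e
  rw [e]
  positivity

lemma mem_Ioo_of_derivative_legendre_eq_zero {n : ℕ} (hn : 1 ≤ n) {t : ℝ}
    (h : (Polynomial.derivative (legendre n)).eval t = 0) : t ∈ Set.Ioo (-1 : ℝ) 1 := by
  constructor
  · by_contra! hlt
    have h1 := derivative_legendre_pos hn (t := -t) (by linarith)
    have h2 := (eval_neg_legendre n t).2
    rw [h] at h2
    simp [h2] at h1
  · by_contra! hlt
    exact (derivative_legendre_pos hn hlt).ne' h

lemma derivative_legendre_ne_zero {n : ℕ} (hn : 1 ≤ n) :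
    Polynomial.derivative (legendre n) ≠ 0 := by
  intro h
  have := derivative_legendre_pos hn (le_refl (1 : ℝ))
  simp [h] at this

lemma natDegree_derivative_legendre (n : ℕ) :
    (Polynomial.derivative (legendre n)).natDegree = n - 1 := by
  rw [Polynomial.natDegree_derivative, natDegree_legendre]

lemma card_roots_le_iterate_derivative (p : Polynomial ℝ) (k : ℕ) :
    Multiset.card p.roots ≤ Multiset.card (Polynomial.derivative^[k] p).roots + k := by
  induction k with
  | zero => simp
  | succ k ih =>
    have := Polynomial.card_roots_le_derivative (Polynomial.derivative^[k] p)
    rw [Function.iterate_succ_apply']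
    omega

/-- By Rolle's theorem, counting roots with multiplicity in the formula of Rodrigues, all roots of
`L_n'` are real. -/
lemma card_roots_derivative_legendre {n : ℕ} (hn : 1 ≤ n) :
    Multiset.card (Polynomial.derivative (legendre n)).roots = n - 1 := by
  refine le_antisymm ?_ ?_
  · exact (Polynomial.card_roots' _).trans (natDegree_derivative_legendre n).le
  · have h1 := card_roots_le_iterate_derivative ((Polynomial.X ^ 2 - 1 : Polynomial ℝ) ^ n) (n + 1)
    have h2 : Multiset.card ((Polynomial.X ^ 2 - 1 : Polynomial ℝ) ^ n).roots = 2 * n := by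
      have : (Polynomial.X ^ 2 - 1 : Polynomial ℝ) =
          (Polynomial.X - Polynomial.C 1) * (Polynomial.X - Polynomial.C (-1)) := by
        simp; ring
      have hne : (Polynomial.X - Polynomial.C 1 : Polynomial ℝ) *
          (Polynomial.X - Polynomial.C (-1)) ≠ 0 :=
        mul_ne_zero (Polynomial.X_sub_C_ne_zero _) (Polynomial.X_sub_C_ne_zero _)
      rw [Polynomial.roots_pow, this, Polynomial.roots_mul hne, Polynomial.roots_X_sub_C,
        Polynomial.roots_X_sub_C]
      simp
      ring
    have h3 : (Polynomial.derivative (legendre n)).roots =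
        (Polynomial.derivative^[n + 1] ((Polynomial.X ^ 2 - 1 : Polynomial ℝ) ^ n)).roots := by
      unfold legendre
      rw [Polynomial.derivative_C_mul, Polynomial.roots_C_mul _ (by positivity),
        Function.iterate_succ_apply']
    rw [h3]
    omega

/-- By Legendre's differential equation, a multiple root of `L_n'` would be a root of `L_n`. -/
lemma nodup_roots_derivative_legendre {n : ℕ} (hn : 1 ≤ n) :
    (Polynomial.derivative (legendre n)).roots.Nodup := by
  rw [Multiset.nodup_iff_count_le_one]
  intro t
  rw [Polynomial.count_roots]
  by_contra! h
  rw [Polynomial.one_lt_rootMultiplicity_iff_isRoot (derivative_legendre_ne_zero hn)] at h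
  have h1 : (Polynomial.derivative (legendre n)).eval t = 0 := h.1
  have h2 : (Polynomial.derivative (Polynomial.derivative (legendre n))).eval t = 0 := h.2
  have ho := eval_legendre_ode n t
  rw [h1, h2] at ho
  have hp : (n : ℝ) * (n + 1) ≠ 0 := by positivity
  have h0 : (legendre n).eval t = 0 := by simpa [hp] using ho
  exact not_legendre_and_derivative_eq_zero n t h0 h1

/-- The set of the LGL nodes. -/
def nodeSet (N : ℕ) : Finset ℝ :=
  insert (-1) (insert 1 (Polynomial.derivative (legendre N)).roots.toFinset)

lemma mem_nodeSet {N : ℕ} (hN : 1 ≤ N) {t : ℝ} :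
    t ∈ nodeSet N ↔ t = -1 ∨ t = 1 ∨ (Polynomial.derivative (legendre N)).eval t = 0 := by
  simp [nodeSet, derivative_legendre_ne_zero hN, Polynomial.IsRoot]

lemma nodeSet_subset_Icc {N : ℕ} (hN : 1 ≤ N) {t : ℝ} (ht : t ∈ nodeSet N) :
    t ∈ Set.Icc (-1 : ℝ) 1 := by
  rcases (mem_nodeSet hN).1 ht with rfl | rfl | h
  · simp
  · simp
  · exact Set.Ioo_subset_Icc_self (mem_Ioo_of_derivative_legendre_eq_zero hN h)

lemma card_nodeSet {N : ℕ} (hN : 1 ≤ N) : (nodeSet N).card = N + 1 := by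
  have hr : (Polynomial.derivative (legendre N)).roots.toFinset.card = N - 1 := by
    rw [Multiset.toFinset_card_of_nodup (nodup_roots_derivative_legendre hN),
      card_roots_derivative_legendre hN]
  have hmem : ∀ t, t ∈ (Polynomial.derivative (legendre N)).roots.toFinset →
      t ∈ Set.Ioo (-1 : ℝ) 1 := by
    intro t ht
    rw [Multiset.mem_toFinset, Polynomial.mem_roots (derivative_legendre_ne_zero hN)] at ht
    exact mem_Ioo_of_derivative_legendre_eq_zero hN ht
  unfold nodeSet
  rw [Finset.card_insert_of_notMem, Finset.card_insert_of_notMem, hr]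
  · omega
  · intro h; exact lt_irrefl _ (hmem _ h).2
  · rw [Finset.mem_insert]
    rintro (h | h)
    · norm_num at h
    · exact lt_irrefl _ (hmem _ h).1

lemma node_eq {N : ℕ} (hN : 1 ≤ N) (k : Fin (N + 1)) :
    node N k = (nodeSet N).orderEmbOfFin (card_nodeSet hN) k := by
  rw [Finset.orderEmbOfFin_apply]
  unfold node
  rw [List.getD_eq_getElem]
  · rfl

lemma node_injective {N : ℕ} (hN : 1 ≤ N) : Function.Injective (node N) := by
  intro i j h
  rw [node_eq hN, node_eq hN] at h
  exact (Finset.orderEmbOfFin _ _).injective h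

lemma node_mem_nodeSet {N : ℕ} (hN : 1 ≤ N) (k : Fin (N + 1)) : node N k ∈ nodeSet N := by
  rw [node_eq hN]
  exact Finset.orderEmbOfFin_mem _ _ _

lemma node_mem_Icc {N : ℕ} (hN : 1 ≤ N) (k : Fin (N + 1)) : node N k ∈ Set.Icc (-1 : ℝ) 1 :=
  nodeSet_subset_Icc hN (node_mem_nodeSet hN k)

lemma node_zero {N : ℕ} (hN : 1 ≤ N) : node N 0 = -1 := by
  rw [node_eq hN]
  have := Finset.orderEmbOfFin_zero (card_nodeSet hN) (Nat.succ_pos N)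
  refine Eq.trans this ?_
  refine le_antisymm (Finset.min'_le _ _ ((mem_nodeSet hN).2 (Or.inl rfl))) ?_
  exact Finset.le_min' _ _ _ fun t ht => (nodeSet_subset_Icc hN ht).1

lemma node_last {N : ℕ} (hN : 1 ≤ N) : node N (Fin.last N) = 1 := by
  rw [node_eq hN]
  have := Finset.orderEmbOfFin_last (card_nodeSet hN) (Nat.succ_pos N)
  refine Eq.trans this ?_
  refine le_antisymm ?_ (Finset.le_max' _ _ ((mem_nodeSet hN).2 (Or.inr (Or.inl rfl))))
  exact Finset.max'_le _ _ _ fun t ht => (nodeSet_subset_Icc hN ht).2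

/-! ### Differentiation at the nodes -/

open Polynomial in
/-- The polynomial `(t² - 1) L_N'(t)`, whose roots are the nodes. -/
def nodePoly (N : ℕ) : ℝ[X] := (X ^ 2 - 1) * derivative (legendre N)

lemma derivative_nodePoly (N : ℕ) :
    Polynomial.derivative (nodePoly N) =
      ((N : Polynomial ℝ) * ((N : Polynomial ℝ) + 1)) * legendre N := by
  have h := derivative_one_sub_sq_mul_derivative_legendre N
  rw [← neg_inj, ← h, ← Polynomial.derivative_neg]
  congr 1
  unfold nodePoly
  ring

lemma eval_nodePoly_node {N : ℕ} (hN : 1 ≤ N) (k : Fin (N + 1)) :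
    (nodePoly N).eval (node N k) = 0 := by
  rcases (mem_nodeSet hN).1 (node_mem_nodeSet hN k) with h | h | h
  · simp [nodePoly, h]
  · simp [nodePoly, h]
  · simp [nodePoly, h]

lemma coeff_legendre_ne_zero (n : ℕ) : (legendre n).coeff n ≠ 0 := by
  have h : (legendre n).leadingCoeff ≠ 0 := Polynomial.leadingCoeff_ne_zero.2 (legendre_ne_zero n)
  rwa [Polynomial.leadingCoeff, natDegree_legendre] at h

lemma natDegree_nodePoly_le {N : ℕ} (hN : 1 ≤ N) : (nodePoly N).natDegree ≤ N + 1 := by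
  have h1 : (Polynomial.X ^ 2 - 1 : Polynomial ℝ).natDegree ≤ 2 := by compute_degree
  have h := Polynomial.natDegree_mul_le_of_le h1 (natDegree_derivative_legendre N).le
  unfold nodePoly
  omega

lemma coeff_nodePoly {N : ℕ} (hN : 1 ≤ N) :
    (nodePoly N).coeff (N + 1) = N * (legendre N).coeff N := by
  obtain ⟨n, rfl⟩ : ∃ k, N = k + 1 := ⟨N - 1, by omega⟩
  have h1 : (Polynomial.X ^ 2 - 1 : Polynomial ℝ).natDegree ≤ 2 := by compute_degree
  have h := Polynomial.coeff_mul_add_eq_of_natDegree_le h1 (natDegree_derivative_legendre (n + 1)).le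
  unfold nodePoly
  rw [show n + 1 + 1 = 2 + (n + 1 - 1) by omega, h]
  simp [Polynomial.coeff_derivative, Polynomial.coeff_one]
  ring

lemma nodePoly_eq {N : ℕ} (hN : 1 ≤ N) :
    nodePoly N = Polynomial.C (N * (legendre N).coeff N) *
      Lagrange.nodal Finset.univ (node N) := by
  have hdeg : (Lagrange.nodal Finset.univ (node N)).natDegree = N + 1 := by
    simp [Lagrange.natDegree_nodal]
  have hm : (Lagrange.nodal Finset.univ (node N)).coeff (N + 1) = 1 := by
    have := Lagrange.nodal_monic (s := Finset.univ) (v := node N)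
    rwa [Polynomial.Monic, Polynomial.leadingCoeff, hdeg] at this
  refine Polynomial.eq_of_degree_sub_lt_of_eval_index_eq Finset.univ
    ((node_injective hN).injOn) ?_ ?_
  · rw [Finset.card_univ, Fintype.card_fin, Polynomial.degree_lt_iff_coeff_zero]
    intro j hj
    rw [Polynomial.coeff_sub, Polynomial.coeff_C_mul]
    rcases hj.eq_or_lt with rfl | hlt
    · rw [coeff_nodePoly hN, hm, mul_one, sub_self]
    · rw [Polynomial.coeff_eq_zero_of_natDegree_lt ((natDegree_nodePoly_le hN).trans_lt hlt),
        Polynomial.coeff_eq_zero_of_natDegree_lt (hdeg.le.trans_lt hlt), mul_zero, sub_zero]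
  · intro k _
    rw [eval_nodePoly_node hN, Polynomial.eval_mul,
      Lagrange.eval_nodal_at_node (Finset.mem_univ k), mul_zero]

lemma eval_legendre_node_ne_zero {N : ℕ} (hN : 1 ≤ N) (k : Fin (N + 1)) :
    (legendre N).eval (node N k) ≠ 0 := by
  intro h
  rcases (mem_nodeSet hN).1 (node_mem_nodeSet hN k) with h' | h' | h'
  · rw [h', eval_neg_one_legendre] at h; simp at h
  · rw [h', eval_one_legendre] at h; simp at h
  · exact not_legendre_and_derivative_eq_zero _ _ h h'

/-- The Lagrange basis polynomials of the nodes. -/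
abbrev nodeBasis (N : ℕ) (k : Fin (N + 1)) : Polynomial ℝ :=
  Lagrange.basis Finset.univ (node N) k

lemma X_sub_C_mul_nodeBasis {N : ℕ} (hN : 1 ≤ N) (k : Fin (N + 1)) :
    Polynomial.C (N * (N + 1) * (legendre N).eval (node N k)) *
      ((Polynomial.X - Polynomial.C (node N k)) * nodeBasis N k) = nodePoly N := by
  have hb := Lagrange.basis_eq_prod_sub_inv_mul_nodal_div (v := node N) (Finset.mem_univ k)
  have hw := Lagrange.nodalWeight_eq_eval_derivative_nodal (v := node N) (Finset.mem_univ k)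
  have hn := Lagrange.nodal_eq_mul_nodal_erase (v := node N) (Finset.mem_univ k)
  have hd := Lagrange.nodal_erase_eq_nodal_div (v := node N) (Finset.mem_univ k)
  rw [← hd] at hb
  have hd' := congrArg (Polynomial.eval (node N k)) (derivative_nodePoly N)
  rw [nodePoly_eq hN, Polynomial.derivative_C_mul] at hd'
  simp only [Polynomial.eval_mul, Polynomial.eval_C, Polynomial.eval_add, Polynomial.eval_natCast,
    Polynomial.eval_one] at hd'
  have hne := eval_legendre_node_ne_zero hN k
  have hN' : (N : ℝ) * (N + 1) ≠ 0 := by positivity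
  have hne2 : Polynomial.eval (node N k)
      (Polynomial.derivative (Lagrange.nodal Finset.univ (node N))) ≠ 0 := by
    intro h0
    rw [h0, mul_zero] at hd'
    exact mul_ne_zero hN' hne hd'.symm
  rw [nodeBasis, hb, mul_left_comm (Polynomial.X - _), ← hn, hw, ← hd', ← mul_assoc,
    ← Polynomial.C_mul, mul_assoc, mul_inv_cancel₀ hne2, mul_one, nodePoly_eq hN]

/-- The differentiation matrix consists of the derivatives of the Lagrange basis polynomials at the
nodes. -/
lemma eval_derivative_nodeBasis {N : ℕ} (hN : 1 ≤ N) (i k : Fin (N + 1)) :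
    (Polynomial.derivative (nodeBasis N k)).eval (node N i) = diffMatrix N i k := by
  set c : ℝ := N * (N + 1) * (legendre N).eval (node N k) with hc
  have hne := eval_legendre_node_ne_zero hN k
  have hN' : (N : ℝ) * (N + 1) ≠ 0 := by positivity
  have hcne : c ≠ 0 := mul_ne_zero hN' hne
  have h0 := X_sub_C_mul_nodeBasis hN k
  rw [← hc] at h0
  have h1 : Polynomial.C c * (nodeBasis N k + (Polynomial.X - Polynomial.C (node N k)) *
      Polynomial.derivative (nodeBasis N k)) =
      ((N : Polynomial ℝ) * ((N : Polynomial ℝ) + 1)) * legendre N := by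
    rw [← derivative_nodePoly, ← h0, Polynomial.derivative_C_mul, Polynomial.derivative_mul]
    simp
  by_cases hik : i = k
  · subst hik
    have h2 := congrArg Polynomial.derivative h1
    have h3 := congrArg (Polynomial.eval (node N i)) h2
    simp [Polynomial.derivative_mul] at h3
    have h4 : (Polynomial.derivative (nodeBasis N i)).eval (node N i) * (2 * c) =
        N * (N + 1) * (Polynomial.derivative (legendre N)).eval (node N i) := by
      rw [← h3]; ring
    have h5 : (Polynomial.derivative (nodeBasis N i)).eval (node N i) =
        (Polynomial.derivative (legendre N)).eval (node N i) /
          (2 * (legendre N).eval (node N i)) := by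
      rw [eq_div_iff (by positivity)]
      refine mul_left_cancel₀ hN' ?_
      rw [← h4, hc]; ring
    rw [h5]
    simp only [diffMatrix, Matrix.of_apply, ne_eq, not_true_eq_false, if_false]
    split_ifs with hz hl
    · rw [hz, node_zero hN, eval_neg_one_derivative_legendre, eval_neg_one_legendre]
      have : ((-1 : ℝ)) ^ N ≠ 0 := by simp
      field_simp
      norm_num
    · rw [hl, node_last hN, eval_one_derivative_legendre, eval_one_legendre]
      ring
    · rcases (mem_nodeSet hN).1 (node_mem_nodeSet hN i) with h' | h' | h'
      · rw [← node_zero hN] at h'; exact absurd (node_injective hN h') hz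
      · rw [← node_last hN] at h'; exact absurd (node_injective hN h') hl
      · rw [h', zero_div]
  · have hb : (nodeBasis N k).eval (node N i) = 0 :=
      Lagrange.eval_basis_of_ne (fun h => hik h.symm) (Finset.mem_univ i)
    have h3 := congrArg (Polynomial.eval (node N i)) h1
    simp [hb] at h3
    have hsub : node N i - node N k ≠ 0 := sub_ne_zero.2 fun h => hik (node_injective hN h)
    simp only [diffMatrix, Matrix.of_apply, ne_eq, hik, not_false_eq_true, if_true]
    refine mul_left_cancel₀ (mul_ne_zero hcne hsub) ?_
    rw [mul_assoc, h3, hc]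
    field_simp

lemma eq_sum_nodeBasis {N : ℕ} (hN : 1 ≤ N) {p : Polynomial ℝ} (hp : p.natDegree ≤ N) :
    p = ∑ k, Polynomial.C (p.eval (node N k)) * nodeBasis N k := by
  have h := Lagrange.eq_interpolate (s := Finset.univ) (v := node N) (f := p)
    ((node_injective hN).injOn) (by
      rw [Finset.card_univ, Fintype.card_fin]
      exact Polynomial.degree_lt_iff_coeff_zero _ _ |>.2 fun j hj =>
        Polynomial.coeff_eq_zero_of_natDegree_lt (by omega))
  rw [Lagrange.interpolate_apply] at h
  exact h

/-- The differentiation matrix is exact on polynomials of degree at most `N`. -/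
lemma diffMatrix_mulVec {N : ℕ} (hN : 1 ≤ N) {p : Polynomial ℝ} (hp : p.natDegree ≤ N) :
    (diffMatrix N).mulVec (fun k => p.eval (node N k)) =
      fun k => (Polynomial.derivative p).eval (node N k) := by
  funext i
  conv_rhs => rw [eq_sum_nodeBasis hN hp]
  rw [Polynomial.derivative_sum, Polynomial.eval_finsetSum]
  simp only [Polynomial.derivative_C_mul, Polynomial.eval_C_mul, eval_derivative_nodeBasis hN]
  simp only [Matrix.mulVec, dotProduct]
  exact Finset.sum_congr rfl fun k _ => mul_comm _ _

lemma diffMatrix_pow_mulVec {N : ℕ} (hN : 1 ≤ N) {p : Polynomial ℝ} (hp : p.natDegree ≤ N)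
    (j : ℕ) :
    (diffMatrix N ^ j).mulVec (fun k => p.eval (node N k)) =
      fun k => (Polynomial.derivative^[j] p).eval (node N k) := by
  induction j with
  | zero => simp
  | succ j ih =>
    rw [pow_succ', ← Matrix.mulVec_mulVec, ih, diffMatrix_mulVec hN, Function.iterate_succ_apply']
    exact (Polynomial.natDegree_iterate_derivative p j).trans (by omega)

/-! ### Legendre-Gauss-Lobatto quadrature -/

lemma integral_mul_legendre_of_natDegree_le {p : Polynomial ℝ} {n : ℕ} (h : p.natDegree ≤ n) :
    ∫ t in (-1 : ℝ)..1, p.eval t * (legendre n).eval t =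
      p.coeff n / (legendre n).coeff n * (2 / (2 * n + 1)) := by
  set c := p.coeff n / (legendre n).coeff n with hc
  have hκ := coeff_legendre_ne_zero n
  have hz : ∫ t in (-1 : ℝ)..1, (p - Polynomial.C c * legendre n).eval t * (legendre n).eval t
      = 0 := by
    rcases Nat.eq_zero_or_pos n with rfl | hn
    · have : p - Polynomial.C c * legendre 0 = 0 := by
        rw [legendre_zero] at hc ⊢
        simp at hc
        rw [hc, mul_one, sub_eq_zero]
        exact Polynomial.eq_C_of_natDegree_le_zero h
      simp [this]
    · refine integral_mul_legendre_eq_zero ?_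
      have hle : (p - Polynomial.C c * legendre n).natDegree ≤ n :=
        (Polynomial.natDegree_sub_le_of_le h ((Polynomial.natDegree_C_mul_le _ _).trans
          (natDegree_legendre_le n))).trans (max_self n).le
      refine lt_of_le_of_ne hle fun heq => ?_
      have hco : (p - Polynomial.C c * legendre n).coeff n = 0 := by
        rw [Polynomial.coeff_sub, Polynomial.coeff_C_mul, hc, div_mul_cancel₀ _ hκ, sub_self]
      have : (p - Polynomial.C c * legendre n).leadingCoeff = 0 := by
        rw [Polynomial.leadingCoeff, heq, hco]
      rw [Polynomial.leadingCoeff_eq_zero] at this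
      rw [this, Polynomial.natDegree_zero] at heq
      omega
  have i1 := intervalIntegrable_poly (p * legendre n) (-1) 1
  have i2 := intervalIntegrable_poly (Polynomial.C c * (legendre n * legendre n)) (-1) 1
  simp only [Polynomial.eval_mul, Polynomial.eval_C] at i1 i2
  simp only [Polynomial.eval_sub, Polynomial.eval_mul, Polynomial.eval_C, sub_mul, mul_assoc] at hz
  rw [intervalIntegral.integral_sub i1 i2, intervalIntegral.integral_const_mul,
    integral_legendre_mul_self, sub_eq_zero] at hz
  exact hz

/-- Integration by parts against the node polynomial. -/
lemma integral_mul_nodePoly (q : Polynomial ℝ) (N : ℕ) :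
    ∫ t in (-1 : ℝ)..1, q.eval t * (nodePoly N).eval t =
      -∫ t in (-1 : ℝ)..1, (Polynomial.derivative (q * (Polynomial.X ^ 2 - 1))).eval t *
        (legendre N).eval t := by
  have h := integral_derivative_poly (q * (Polynomial.X ^ 2 - 1) * legendre N) (-1) 1
  rw [Polynomial.derivative_mul (f := q * (Polynomial.X ^ 2 - 1))] at h
  have i1 := intervalIntegrable_poly
    (Polynomial.derivative (q * (Polynomial.X ^ 2 - 1)) * legendre N) (-1) 1
  have i2 := intervalIntegrable_poly
    (q * (Polynomial.X ^ 2 - 1) * Polynomial.derivative (legendre N)) (-1) 1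
  simp only [Polynomial.eval_add] at h
  rw [intervalIntegral.integral_add i1 i2] at h
  have hb : (q * (Polynomial.X ^ 2 - 1) * legendre N).eval 1 -
      (q * (Polynomial.X ^ 2 - 1) * legendre N).eval (-1) = 0 := by simp
  rw [hb] at h
  have e : ∫ t in (-1 : ℝ)..1, q.eval t * (nodePoly N).eval t =
      ∫ t in (-1 : ℝ)..1, q.eval t * (t ^ 2 - 1) * (Polynomial.derivative (legendre N)).eval t := by
    refine intervalIntegral.integral_congr fun t _ => ?_
    simp [nodePoly, mul_assoc]
  rw [e, eq_neg_iff_add_eq_zero, add_comm, ← h]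
  simp only [Polynomial.eval_mul, Polynomial.eval_sub, Polynomial.eval_pow, Polynomial.eval_X,
    Polynomial.eval_one]

lemma integral_mul_nodePoly_eq_zero {q : Polynomial ℝ} {N : ℕ} (h : q.natDegree + 1 < N) :
    ∫ t in (-1 : ℝ)..1, q.eval t * (nodePoly N).eval t = 0 := by
  rw [integral_mul_nodePoly, integral_mul_legendre_eq_zero, neg_zero]
  have h1 : (Polynomial.X ^ 2 - 1 : Polynomial ℝ).natDegree ≤ 2 := by compute_degree
  have h2 := Polynomial.natDegree_mul_le_of_le (le_refl q.natDegree) h1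
  have h3 := Polynomial.natDegree_derivative_le (q * (Polynomial.X ^ 2 - 1))
  omega

lemma integral_X_pow_mul_nodePoly {N : ℕ} (hN : 1 ≤ N) :
    ∫ t in (-1 : ℝ)..1, (Polynomial.X ^ (N - 1) : Polynomial ℝ).eval t * (nodePoly N).eval t =
      -((N + 1) / (legendre N).coeff N * (2 / (2 * N + 1))) := by
  have h1 : (Polynomial.X ^ 2 - 1 : Polynomial ℝ).natDegree ≤ 2 := by compute_degree
  have h2 := Polynomial.natDegree_mul_le_of_le (Polynomial.natDegree_X_pow_le (R := ℝ) (N - 1)) h1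
  have h3 := Polynomial.natDegree_derivative_le
    (Polynomial.X ^ (N - 1) * (Polynomial.X ^ 2 - 1 : Polynomial ℝ))
  rw [integral_mul_nodePoly, integral_mul_legendre_of_natDegree_le (by omega)]
  congr 3
  have h4 := Polynomial.coeff_mul_add_eq_of_natDegree_le
    (Polynomial.natDegree_X_pow_le (R := ℝ) (N - 1)) h1
  rw [show N - 1 + 2 = N + 1 by omega] at h4
  rw [Polynomial.coeff_derivative, h4]
  simp [Polynomial.coeff_one]

lemma natDegree_nodeBasis {N : ℕ} (hN : 1 ≤ N) (k : Fin (N + 1)) :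
    (nodeBasis N k).natDegree = N := by
  rw [nodeBasis, Lagrange.natDegree_basis ((node_injective hN).injOn) (Finset.mem_univ k)]
  simp

lemma integral_sum_eval_mul_nodeBasis (N : ℕ) (p : Polynomial ℝ) :
    ∫ t in (-1 : ℝ)..1, (∑ k, Polynomial.C (p.eval (node N k)) * nodeBasis N k).eval t =
      ∑ k, (∫ t in (-1 : ℝ)..1, (nodeBasis N k).eval t) * p.eval (node N k) := by
  simp only [Polynomial.eval_finsetSum, Polynomial.eval_mul, Polynomial.eval_C]
  rw [intervalIntegral.integral_finsetSum
    (fun k _ => (intervalIntegrable_poly (nodeBasis N k) _ _).const_mul _)]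
  exact Finset.sum_congr rfl fun k _ => by rw [intervalIntegral.integral_const_mul, mul_comm]

/-- The interpolatory quadrature rule at the nodes is exact beyond degree `N`, because the node
polynomial is orthogonal to the polynomials of degree less than `N - 1`. -/
lemma integral_eq_sum_integral_nodeBasis {N : ℕ} (hN : 1 ≤ N) {p : Polynomial ℝ}
    (hp : p.natDegree ≤ 2 * N - 1) :
    ∫ t in (-1 : ℝ)..1, p.eval t =
      ∑ k, (∫ t in (-1 : ℝ)..1, (nodeBasis N k).eval t) * p.eval (node N k) := by
  set W := Lagrange.nodal Finset.univ (node N) with hW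
  have hm : W.Monic := Lagrange.nodal_monic
  have hdeg : W.natDegree = N + 1 := by simp [hW, Lagrange.natDegree_nodal]
  set r := p %ₘ W with hr
  set q := p /ₘ W with hq
  have hpq : p = r + W * q := (Polynomial.modByMonic_add_div p W).symm
  have hrdeg : r.natDegree ≤ N := by
    have h := Polynomial.natDegree_modByMonic_lt p hm (fun h1 => by
      rw [h1, Polynomial.natDegree_one] at hdeg; omega)
    rw [← hr, hdeg] at h
    omega
  have hqdeg : q.natDegree = p.natDegree - (N + 1) := by
    rw [hq, Polynomial.natDegree_divByMonic p hm, hdeg]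
  have hreval : ∀ k, r.eval (node N k) = p.eval (node N k) := by
    intro k
    rw [hpq, Polynomial.eval_add, Polynomial.eval_mul,
      Lagrange.eval_nodal_at_node (Finset.mem_univ k), zero_mul, add_zero]
  have hint : ∫ t in (-1 : ℝ)..1, (W * q).eval t = 0 := by
    rcases eq_or_ne N 1 with rfl | hN1
    · have : q = 0 := (Polynomial.divByMonic_eq_zero_iff hm).2 (by
        refine Polynomial.degree_lt_degree ?_
        omega)
      simp [this]
    · have h0 : (N : ℝ) * (legendre N).coeff N ≠ 0 :=
        mul_ne_zero (by positivity) (coeff_legendre_ne_zero N)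
      have h := integral_mul_nodePoly_eq_zero (q := q) (N := N) (by omega)
      simp only [nodePoly_eq hN, Polynomial.eval_mul, Polynomial.eval_C, mul_left_comm _ (_ * _)] at h
      rw [intervalIntegral.integral_const_mul] at h
      have h' := (mul_eq_zero.1 h).resolve_left h0
      rw [← h']
      refine intervalIntegral.integral_congr fun t _ => ?_
      simp [mul_comm, hW]
  conv_lhs => rw [hpq]
  simp only [Polynomial.eval_add]
  rw [intervalIntegral.integral_add (intervalIntegrable_poly _ _ _) (intervalIntegrable_poly _ _ _),
    hint, add_zero]
  conv_lhs => rw [eq_sum_nodeBasis hN hrdeg]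
  rw [integral_sum_eval_mul_nodeBasis]
  simp only [hreval]

/-- The quadrature weights are the integrals of the Lagrange basis polynomials `ℓ_k`. The rule with
these integrals as weights is applied to `ℓ_k L_N`, of degree `2 N`, after a multiple of
`t^{N-1} (t² - 1) L_N'` has been subtracted to cancel the leading coefficient. -/
lemma integral_nodeBasis {N : ℕ} (hN : 1 ≤ N) (k : Fin (N + 1)) :
    ∫ t in (-1 : ℝ)..1, (nodeBasis N k).eval t = weight N k := by
  set κ := (legendre N).coeff N with hκd
  have hκ : κ ≠ 0 := coeff_legendre_ne_zero N
  set l := (legendre N).eval (node N k) with hl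
  have hlne : l ≠ 0 := eval_legendre_node_ne_zero hN k
  set a := (nodeBasis N k).coeff N with ha
  have hNp : (0 : ℝ) < N := by exact_mod_cast hN
  have haval : a = κ / ((N + 1) * l) := by
    have h := congrArg (fun p => Polynomial.coeff p (N + 1)) (X_sub_C_mul_nodeBasis hN k)
    simp only [Polynomial.coeff_C_mul, coeff_nodePoly hN] at h
    have h2 := Polynomial.coeff_mul_add_eq_of_natDegree_le
      (Polynomial.natDegree_X_sub_C_le (node N k)) (natDegree_nodeBasis hN k).le
    rw [add_comm 1 N] at h2
    rw [h2, ← ha, ← hl] at h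
    simp at h
    rw [eq_div_iff (by positivity)]
    refine mul_left_cancel₀ hNp.ne' ?_
    rw [← h]
    ring
  set p := nodeBasis N k * legendre N -
    Polynomial.C (a / N) * (Polynomial.X ^ (N - 1) * nodePoly N) with hp
  have hd1 := Polynomial.natDegree_mul_le_of_le (natDegree_nodeBasis hN k).le
    (natDegree_legendre_le N)
  have hd2 := Polynomial.natDegree_mul_le_of_le (Polynomial.natDegree_X_pow_le (R := ℝ) (N - 1))
    (natDegree_nodePoly_le hN)
  have hpdeg : p.natDegree ≤ 2 * N - 1 := by
    have hle : p.natDegree ≤ 2 * N := (Polynomial.natDegree_sub_le_of_le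
      (hd1.trans_eq (two_mul N).symm)
      ((Polynomial.natDegree_C_mul_le _ _).trans
        (hd2.trans (show N - 1 + (N + 1) ≤ 2 * N by omega)))).trans (max_self _).le
    have hc : p.coeff (2 * N) = 0 := by
      have e1 := Polynomial.coeff_mul_add_eq_of_natDegree_le (natDegree_nodeBasis hN k).le
        (natDegree_legendre_le N)
      have e2 := Polynomial.coeff_mul_add_eq_of_natDegree_le
        (Polynomial.natDegree_X_pow_le (R := ℝ) (N - 1)) (natDegree_nodePoly_le hN)
      rw [show N + N = 2 * N by ring] at e1
      rw [show N - 1 + (N + 1) = 2 * N by omega] at e2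
      rw [hp, Polynomial.coeff_sub, Polynomial.coeff_C_mul, e1, e2, coeff_nodePoly hN]
      simp
      field_simp
      ring
    by_contra! hlt
    have heq : p.natDegree = 2 * N := by omega
    have : p.leadingCoeff = 0 := by rw [Polynomial.leadingCoeff, heq, hc]
    rw [Polynomial.leadingCoeff_eq_zero] at this
    rw [this, Polynomial.natDegree_zero] at heq
    omega
  have hq := integral_eq_sum_integral_nodeBasis hN hpdeg
  have hsum : ∑ j, (∫ t in (-1 : ℝ)..1, (nodeBasis N j).eval t) * p.eval (node N j) =
      (∫ t in (-1 : ℝ)..1, (nodeBasis N k).eval t) * l := by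
    rw [Finset.sum_eq_single k]
    · congr 1
      simp [hp, eval_nodePoly_node hN,
        Lagrange.eval_basis_self ((node_injective hN).injOn) (Finset.mem_univ k), hl]
    · intro j _ hj
      simp [hp, eval_nodePoly_node hN, Lagrange.eval_basis_of_ne hj.symm (Finset.mem_univ j)]
    · intro h; exact absurd (Finset.mem_univ k) h
  have i1 := intervalIntegrable_poly (nodeBasis N k * legendre N) (-1) 1
  have i2 := intervalIntegrable_poly
    (Polynomial.C (a / N) * (Polynomial.X ^ (N - 1) * nodePoly N)) (-1) 1
  rw [hsum, hp] at hq
  simp only [Polynomial.eval_sub] at hq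
  rw [intervalIntegral.integral_sub i1 i2] at hq
  simp only [Polynomial.eval_mul, Polynomial.eval_C] at hq
  rw [intervalIntegral.integral_const_mul, integral_X_pow_mul_nodePoly hN,
    integral_mul_legendre_of_natDegree_le (natDegree_nodeBasis hN k).le, ← ha, ← hκd, haval] at hq
  unfold weight
  rw [← hl]
  refine mul_right_cancel₀ hlne ?_
  rw [← hq]
  field_simp
  ring

/-- The LGL quadrature rule is exact on polynomials of degree at most `2 N - 1`. -/
lemma integral_eq_sum_weight {N : ℕ} (hN : 1 ≤ N) {p : Polynomial ℝ}
    (hp : p.natDegree ≤ 2 * N - 1) :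
    ∫ t in (-1 : ℝ)..1, p.eval t = ∑ k, weight N k * p.eval (node N k) := by
  rw [integral_eq_sum_integral_nodeBasis hN hp]
  simp only [integral_nodeBasis hN]

lemma weight_nonneg (N : ℕ) (k : Fin (N + 1)) : 0 ≤ weight N k := by
  unfold weight
  positivity

lemma sum_weight {N : ℕ} (hN : 1 ≤ N) : ∑ k, weight N k = 2 := by
  have h := integral_eq_sum_weight hN (p := 1) (by simp)
  simp at h
  rw [← h]
  norm_num

/-! ### Jackson's theorem -/

lemma integral_cos_int_mul (z : ℤ) :
    ∫ φ in (-Real.pi)..Real.pi, Real.cos (z * φ) = if z = 0 then 2 * Real.pi else 0 := by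
  split_ifs with h
  · simp [h]; ring
  · have hz : (z : ℝ) ≠ 0 := by exact_mod_cast h
    rw [intervalIntegral.integral_comp_mul_left _ hz, integral_cos]
    simp [Real.sin_int_mul_pi]

lemma integral_cos_int_mul_mul_cos (z : ℤ) :
    ∫ φ in (-Real.pi)..Real.pi, Real.cos (z * φ) * Real.cos φ =
      (if z + 1 = 0 then Real.pi else 0) + (if z - 1 = 0 then Real.pi else 0) := by
  have h1 := integral_cos_int_mul (z + 1)
  have h2 := integral_cos_int_mul (z - 1)
  have hc : ∀ w : ℤ, IntervalIntegrable (fun φ : ℝ => Real.cos (w * φ)) volume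
      (-Real.pi) Real.pi := fun w => Continuous.intervalIntegrable (by fun_prop) _ _
  have e : ∀ φ : ℝ, Real.cos (z * φ) * Real.cos φ =
      1 / 2 * (Real.cos (((z + 1 : ℤ) : ℝ) * φ) + Real.cos (((z - 1 : ℤ) : ℝ) * φ)) := by
    intro φ
    push_cast
    rw [add_mul, sub_mul, one_mul, Real.cos_add, Real.cos_sub]
    ring
  simp only [e]
  rw [intervalIntegral.integral_const_mul, intervalIntegral.integral_add (hc _) (hc _), h1, h2]
  split_ifs <;> ring

/-- The coefficients `sin (k π / n)` of the Fejér-Korovkin kernel. -/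
def korovkinCoeff (n k : ℕ) : ℝ := Real.sin (k * (Real.pi / n))

/-- The Fejér-Korovkin kernel `|∑ a_k e^{ikφ}|²`, not normalized. -/
def korovkinKernel (n : ℕ) (φ : ℝ) : ℝ :=
  ∑ j ∈ Finset.range n, ∑ k ∈ Finset.range n,
    korovkinCoeff n j * korovkinCoeff n k * Real.cos (((j : ℤ) - (k : ℤ) : ℤ) * φ)

/-- The mean value of the Fejér-Korovkin kernel. -/
def korovkinMass (n : ℕ) : ℝ := ∑ k ∈ Finset.range n, korovkinCoeff n k ^ 2

lemma korovkinKernel_nonneg (n : ℕ) (φ : ℝ) : 0 ≤ korovkinKernel n φ := by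
  have : korovkinKernel n φ =
      (∑ k ∈ Finset.range n, korovkinCoeff n k * Real.cos (k * φ)) ^ 2 +
        (∑ k ∈ Finset.range n, korovkinCoeff n k * Real.sin (k * φ)) ^ 2 := by
    unfold korovkinKernel
    rw [sq, sq, Finset.sum_mul_sum, Finset.sum_mul_sum, ← Finset.sum_add_distrib]
    refine Finset.sum_congr rfl fun j _ => ?_
    rw [← Finset.sum_add_distrib]
    refine Finset.sum_congr rfl fun k _ => ?_
    push_cast
    rw [sub_mul, Real.cos_sub]
    ring
  rw [this]
  positivity

lemma continuous_korovkinKernel (n : ℕ) : Continuous (korovkinKernel n) := by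
  unfold korovkinKernel
  fun_prop

lemma korovkinMass_pos {n : ℕ} (hn : 2 ≤ n) : 0 < korovkinMass n := by
  unfold korovkinMass
  have h1 : 0 < korovkinCoeff n 1 := by
    unfold korovkinCoeff
    have hn' : (1 : ℝ) < n := by exact_mod_cast hn
    refine Real.sin_pos_of_pos_of_lt_pi (by have := Real.pi_pos; positivity) ?_
    rw [Nat.cast_one, one_mul]
    exact div_lt_self Real.pi_pos hn'
  exact Finset.sum_pos' (fun k _ => sq_nonneg _) ⟨1, Finset.mem_range.2 (by omega), by positivity⟩

lemma integral_korovkinKernel (n : ℕ) :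
    ∫ φ in (-Real.pi)..Real.pi, korovkinKernel n φ = 2 * Real.pi * korovkinMass n := by
  unfold korovkinKernel korovkinMass
  rw [intervalIntegral.integral_finsetSum
    (fun j _ => Continuous.intervalIntegrable (by fun_prop) _ _), Finset.mul_sum]
  refine Finset.sum_congr rfl fun j hj => ?_
  rw [intervalIntegral.integral_finsetSum
    (fun j _ => Continuous.intervalIntegrable (by fun_prop) _ _)]
  simp only [intervalIntegral.integral_const_mul, integral_cos_int_mul, sub_eq_zero, Nat.cast_inj,
    mul_ite, mul_zero]
  rw [Finset.sum_ite_eq, if_pos hj]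
  ring

/-- The coefficients satisfy `a_{k-1} + a_{k+1} = 2 cos (π / n) a_k`, whence the first Fourier
coefficient of the kernel. -/
lemma integral_korovkinKernel_mul_cos {n : ℕ} (hn : 2 ≤ n) :
    ∫ φ in (-Real.pi)..Real.pi, korovkinKernel n φ * Real.cos φ =
      2 * Real.pi * korovkinMass n * Real.cos (Real.pi / n) := by
  have hn0 : (n : ℝ) ≠ 0 := by positivity
  have han : korovkinCoeff n n = 0 := by
    unfold korovkinCoeff
    rw [mul_div_cancel₀ _ hn0, Real.sin_pi]
  have ha0 : korovkinCoeff n 0 = 0 := by simp [korovkinCoeff]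
  unfold korovkinKernel korovkinMass
  simp only [Finset.sum_mul]
  rw [intervalIntegral.integral_finsetSum
    (fun j _ => Continuous.intervalIntegrable (by fun_prop) _ _), Finset.mul_sum, Finset.sum_mul]
  refine Finset.sum_congr rfl fun j hj => ?_
  rw [intervalIntegral.integral_finsetSum
    (fun j _ => Continuous.intervalIntegrable (by fun_prop) _ _)]
  simp only [mul_assoc, intervalIntegral.integral_const_mul, integral_cos_int_mul_mul_cos]
  have e1 : ∀ k : ℕ, ((j : ℤ) - k + 1 = 0) ↔ j + 1 = k := fun k => by omega
  simp only [e1, mul_add, Finset.sum_add_distrib, mul_ite, mul_zero]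
  rw [Finset.sum_ite_eq]
  have hj' := Finset.mem_range.1 hj
  have s1 : (if j + 1 ∈ Finset.range n then
      korovkinCoeff n j * (korovkinCoeff n (j + 1) * Real.pi) else 0) =
      korovkinCoeff n j * (korovkinCoeff n (j + 1) * Real.pi) := by
    split_ifs with h
    · rfl
    · have : j + 1 = n := by rw [Finset.mem_range] at h; omega
      rw [this, han]; ring
  rw [s1]
  rcases j with _ | i
  · rw [ha0]; simp
  · have e2 : ∀ k : ℕ, (((i + 1 : ℕ) : ℤ) - k - 1 = 0) ↔ i = k := fun k => by omega
    simp only [e2]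
    rw [Finset.sum_ite_eq, if_pos (Finset.mem_range.2 (by omega))]
    have hrec : korovkinCoeff n (i + 1 + 1) + korovkinCoeff n i =
        2 * Real.cos (Real.pi / n) * korovkinCoeff n (i + 1) := by
      unfold korovkinCoeff
      push_cast
      rw [show ((i : ℝ) + 1 + 1) * (Real.pi / n) = ((i : ℝ) + 1) * (Real.pi / n) + Real.pi / n by
        ring, show (i : ℝ) * (Real.pi / n) = ((i : ℝ) + 1) * (Real.pi / n) - Real.pi / n by ring,
        Real.sin_add, Real.sin_sub]
      ring
    linear_combination korovkinCoeff n (i + 1) * Real.pi * hrec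

/-- Convolution of an even function with the kernel gives a polynomial in `cos θ`. -/
lemma exists_poly_convolution {F : ℝ → ℝ} (hF : Continuous F) (heven : ∀ φ, F (-φ) = F φ)
    (hper : Function.Periodic F (2 * Real.pi)) {n : ℕ} (hn : 1 ≤ n) :
    ∃ p : Polynomial ℝ, p.natDegree < n ∧ ∀ θ, p.eval (Real.cos θ) =
      ∫ φ in (-Real.pi)..Real.pi, F (θ - φ) * korovkinKernel n φ := by
  refine ⟨∑ j ∈ Finset.range n, ∑ k ∈ Finset.range n, Polynomial.C
    (korovkinCoeff n j * korovkinCoeff n k *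
      ∫ φ in (-Real.pi)..Real.pi, F φ * Real.cos (((j : ℤ) - (k : ℤ) : ℤ) * φ)) *
        Polynomial.Chebyshev.T ℝ ((j : ℤ) - (k : ℤ)), ?_, ?_⟩
  · refine lt_of_le_of_lt (Polynomial.natDegree_sum_le_of_forall_le (n := n - 1) _ _ fun j hj =>
      Polynomial.natDegree_sum_le_of_forall_le _ _ fun k hk => ?_) (by omega)
    refine (Polynomial.natDegree_C_mul_le _ _).trans ?_
    rw [Polynomial.Chebyshev.natDegree_T]
    rw [Finset.mem_range] at hj hk
    omega
  · intro θ
    have hsin : ∀ z : ℤ, ∫ φ in (-Real.pi)..Real.pi, F φ * Real.sin (z * φ) = 0 := by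
      intro z
      have h := intervalIntegral.integral_comp_neg (a := -Real.pi) (b := Real.pi)
        (fun φ => F φ * Real.sin (z * φ))
      simp only [heven, mul_neg, Real.sin_neg, neg_neg, intervalIntegral.integral_neg] at h
      linarith
    have hsub : ∫ φ in (-Real.pi)..Real.pi, F (θ - φ) * korovkinKernel n φ =
        ∫ φ in (-Real.pi)..Real.pi, F φ * korovkinKernel n (θ - φ) := by
      have hG : Function.Periodic (fun φ => F φ * korovkinKernel n (θ - φ)) (2 * Real.pi) := by
        intro φ
        simp only [hper φ]
        congr 1
        unfold korovkinKernel
        refine Finset.sum_congr rfl fun j _ => Finset.sum_congr rfl fun k _ => ?_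
        congr 1
        rw [← Real.cos_sub_int_mul_two_pi (((j : ℤ) - (k : ℤ) : ℤ) * (θ - φ)) ((j : ℤ) - (k : ℤ))]
        congr 1
        ring
      have h := intervalIntegral.integral_comp_sub_left (a := -Real.pi) (b := Real.pi)
        (fun φ => F φ * korovkinKernel n (θ - φ)) θ
      simp only [sub_sub_cancel] at h
      rw [h]
      have h2 := hG.intervalIntegral_add_eq (θ - Real.pi) (-Real.pi)
      convert h2 using 2 <;> ring
    rw [hsub]
    unfold korovkinKernel
    simp only [Finset.mul_sum]
    rw [intervalIntegral.integral_finsetSum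
      (fun j _ => Continuous.intervalIntegrable (by fun_prop) _ _), Polynomial.eval_finsetSum]
    refine Finset.sum_congr rfl fun j hj => ?_
    rw [intervalIntegral.integral_finsetSum
      (fun j _ => Continuous.intervalIntegrable (by fun_prop) _ _), Polynomial.eval_finsetSum]
    refine Finset.sum_congr rfl fun k hk => ?_
    set z : ℤ := (j : ℤ) - (k : ℤ) with hz
    rw [Polynomial.eval_mul, Polynomial.eval_C, Polynomial.Chebyshev.T_real_cos]
    have e : ∀ φ : ℝ, F φ * (korovkinCoeff n j * korovkinCoeff n k * Real.cos (z * (θ - φ))) =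
        korovkinCoeff n j * korovkinCoeff n k * Real.cos (z * θ) * (F φ * Real.cos (z * φ)) +
        korovkinCoeff n j * korovkinCoeff n k * Real.sin (z * θ) * (F φ * Real.sin (z * φ)) := by
      intro φ
      rw [mul_sub, Real.cos_sub]
      ring
    simp only [e]
    rw [intervalIntegral.integral_add (Continuous.intervalIntegrable (by fun_prop) _ _)
      (Continuous.intervalIntegrable (by fun_prop) _ _), intervalIntegral.integral_const_mul,
      intervalIntegral.integral_const_mul, hsin]
    ring

/-- The increment is at most `2 |sin (φ / 2)|`, which is separated from its square
`(1 - cos φ) / 2` by the inequality of the arithmetic and geometric means with a parameter `l`. -/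
lemma abs_cos_sub_cos_sub_le (θ φ : ℝ) {l : ℝ} (hl : 0 < l) :
    |Real.cos θ - Real.cos (θ - φ)| ≤ 1 / l + l * (1 - Real.cos φ) / 2 := by
  rw [Real.cos_sub_cos]
  have h1 : |Real.sin ((θ + (θ - φ)) / 2)| ≤ 1 := Real.abs_sin_le_one _
  have h2 : Real.cos φ = 1 - 2 * Real.sin (φ / 2) ^ 2 := by
    have := Real.cos_two_mul (φ / 2)
    rw [show 2 * (φ / 2) = φ by ring] at this
    rw [this, Real.cos_sq']
    ring
  rw [show (θ - (θ - φ)) / 2 = φ / 2 by ring, h2, abs_mul, abs_mul]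
  have h3 : |(-2 : ℝ)| * |Real.sin ((θ + (θ - φ)) / 2)| * |Real.sin (φ / 2)| ≤
      2 * |Real.sin (φ / 2)| := by
    rw [abs_neg, abs_two]
    have := abs_nonneg (Real.sin (φ / 2))
    nlinarith
  refine h3.trans ?_
  rw [← sq_abs (Real.sin (φ / 2))]
  set s := |Real.sin (φ / 2)|
  have h4 : 1 / l + l * (1 - (1 - 2 * s ^ 2)) / 2 - 2 * s = (1 - l * s) ^ 2 / l := by
    field_simp
    ring
  have : 0 ≤ (1 - l * s) ^ 2 / l := by positivity
  linarith

/-- Jackson's theorem for Lipschitz functions. The function `f (cos θ)` is convolved with the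
Fejér-Korovkin kernel; the error is governed by the integral of the kernel against `1 - cos φ`,
which is `1 - cos (π / n)` times its mass. -/
theorem exists_poly_of_lipschitz {f : ℝ → ℝ} {K : ℝ}
    (hf : ∀ s ∈ Set.Icc (-1 : ℝ) 1, ∀ t ∈ Set.Icc (-1 : ℝ) 1, |f s - f t| ≤ K * |s - t|)
    {n : ℕ} (hn : 1 ≤ n) :
    ∃ p : Polynomial ℝ, p.natDegree < n ∧
      ∀ t ∈ Set.Icc (-1 : ℝ) 1, |f t - p.eval t| ≤ 4 / n * K := by
  have hK : 0 ≤ K := by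
    have h := hf 1 (by simp) (-1) (by simp)
    have := abs_nonneg (f 1 - f (-1))
    norm_num at h
    linarith
  -- The kernel vanishes identically for `n = 1`.
  rcases hn.eq_or_lt with rfl | hn2
  · refine ⟨Polynomial.C (f 0), by simp, fun t ht => ?_⟩
    have h := hf t ht 0 (by simp)
    have h2 : |t| ≤ 1 := abs_le.2 ht
    simp at h ⊢
    nlinarith
  have hcos : ∀ θ, Real.cos θ ∈ Set.Icc (-1 : ℝ) 1 := Real.cos_mem_Icc
  have hfc : ContinuousOn f (Set.Icc (-1) 1) := by
    refine LipschitzOnWith.continuousOn (K := K.toNNReal) ?_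
    refine LipschitzOnWith.of_dist_le_mul fun s hs t ht => ?_
    rw [Real.dist_eq, Real.dist_eq, Real.coe_toNNReal _ hK]
    exact hf s hs t ht
  have hF : Continuous (fun θ => f (Real.cos θ)) := hfc.comp_continuous Real.continuous_cos hcos
  obtain ⟨p, hpd, hp⟩ := exists_poly_convolution hF (fun φ => by simp)
    (fun φ => by simp) hn
  have hS := korovkinMass_pos hn2
  have hpi := Real.pi_pos
  set c := 2 * Real.pi * korovkinMass n with hc
  have hc0 : 0 < c := by positivity
  have hn0 : (0 : ℝ) < n := by positivity
  refine ⟨Polynomial.C c⁻¹ * p, (Polynomial.natDegree_C_mul_le _ _).trans_lt hpd, ?_⟩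
  intro t ht
  obtain ⟨θ, rfl⟩ : ∃ θ, Real.cos θ = t := ⟨Real.arccos t, Real.cos_arccos ht.1 ht.2⟩
  rw [Polynomial.eval_mul, Polynomial.eval_C, hp]
  have hJ := continuous_korovkinKernel n
  have i1 : IntervalIntegrable (fun φ => f (Real.cos θ) * korovkinKernel n φ) volume
      (-Real.pi) Real.pi := Continuous.intervalIntegrable (by fun_prop) _ _
  have hF' : Continuous (fun φ => f (Real.cos (θ - φ))) :=
    hF.comp (continuous_const.sub continuous_id)
  have i2 : IntervalIntegrable (fun φ => f (Real.cos (θ - φ)) * korovkinKernel n φ) volume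
      (-Real.pi) Real.pi := (hF'.mul hJ).intervalIntegrable _ _
  have e : f (Real.cos θ) - c⁻¹ * ∫ φ in (-Real.pi)..Real.pi,
        f (Real.cos (θ - φ)) * korovkinKernel n φ =
      c⁻¹ * ∫ φ in (-Real.pi)..Real.pi,
        (f (Real.cos θ) - f (Real.cos (θ - φ))) * korovkinKernel n φ := by
    simp only [sub_mul]
    rw [intervalIntegral.integral_sub i1 i2, intervalIntegral.integral_const_mul,
      integral_korovkinKernel, ← hc]
    field_simp
  rw [e, abs_mul, abs_of_pos (inv_pos.2 hc0)]
  have hb : |∫ φ in (-Real.pi)..Real.pi,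
        (f (Real.cos θ) - f (Real.cos (θ - φ))) * korovkinKernel n φ| ≤
      ∫ φ in (-Real.pi)..Real.pi, (K * (1 / n + n / 2)) * korovkinKernel n φ -
        (K * (n / 2)) * (korovkinKernel n φ * Real.cos φ) := by
    rw [← Real.norm_eq_abs]
    refine intervalIntegral.norm_integral_le_of_norm_le (by linarith)
      (Filter.Eventually.of_forall fun φ _ => ?_)
      (Continuous.intervalIntegrable (by fun_prop) _ _)
    rw [norm_mul, Real.norm_eq_abs, Real.norm_eq_abs, abs_of_nonneg (korovkinKernel_nonneg n φ)]
    have h1 := hf _ (hcos θ) _ (hcos (θ - φ))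
    have h2 := abs_cos_sub_cos_sub_le θ φ hn0
    have h3 : |f (Real.cos θ) - f (Real.cos (θ - φ))| ≤
        K * (1 / n + n * (1 - Real.cos φ) / 2) := h1.trans (by gcongr)
    have h4 := mul_le_mul_of_nonneg_right h3 (korovkinKernel_nonneg n φ)
    refine h4.trans (le_of_eq ?_)
    ring
  rw [intervalIntegral.integral_sub (Continuous.intervalIntegrable (by fun_prop) _ _)
    (Continuous.intervalIntegrable (by fun_prop) _ _), intervalIntegral.integral_const_mul,
    intervalIntegral.integral_const_mul, integral_korovkinKernel,
    integral_korovkinKernel_mul_cos hn2, ← hc] at hb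
  have hcos1 := Real.one_sub_sq_div_two_le_cos (x := Real.pi / n)
  calc c⁻¹ * _ ≤ c⁻¹ * (K * (1 / n + n / 2) * c - K * (n / 2) * (c * Real.cos (Real.pi / n))) := by
        gcongr
    _ = K * (1 / n + n / 2 * (1 - Real.cos (Real.pi / n))) := by field_simp; ring
    _ ≤ K * (1 / n + n / 2 * ((Real.pi / n) ^ 2 / 2)) := by gcongr; linarith
    _ = K * (1 + Real.pi ^ 2 / 4) / n := by field_simp; ring
    _ ≤ 4 / n * K := by
        rw [div_mul_eq_mul_div]
        have hp4 := Real.pi_lt_d2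
        have : 1 + Real.pi ^ 2 / 4 ≤ 4 := by nlinarith
        rw [mul_comm K]
        gcongr

lemma exists_poly_primitive (p : Polynomial ℝ) (c : ℝ) :
    ∃ P : Polynomial ℝ, Polynomial.derivative P = p ∧ P.eval (-1) = c ∧
      P.natDegree ≤ p.natDegree + 1 := by
  have key : ∃ Q : Polynomial ℝ, Polynomial.derivative Q = p := by
    refine ⟨∑ i ∈ p.support, Polynomial.C (p.coeff i / (i + 1)) * Polynomial.X ^ (i + 1), ?_⟩
    rw [Polynomial.derivative_sum]
    conv_rhs => rw [p.as_sum_support_C_mul_X_pow]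
    refine Finset.sum_congr rfl fun i _ => ?_
    rw [Polynomial.derivative_C_mul_X_pow]
    congr 2
    push_cast
    field_simp
  obtain ⟨Q, hQ⟩ := key
  have hd : Polynomial.derivative (Q + Polynomial.C (c - Q.eval (-1))) = p := by simp [hQ]
  refine ⟨_, hd, by simp, ?_⟩
  have := Polynomial.natDegree_derivative (Q + Polynomial.C (c - Q.eval (-1)))
  rw [hd] at this
  omega

/-- Jackson's theorem for functions with a bounded `k`-th derivative: if `q` approximates `f'` with
error `e` and `Q' = q`, then `f - Q` has Lipschitz constant `e`. -/
theorem exists_poly_of_contDiff {k : ℕ} {f : ℝ → ℝ} (hf : ContDiff ℝ k f) {M : ℝ}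
    (hM : ∀ t ∈ Set.Icc (-1 : ℝ) 1, |iteratedDeriv k f t| ≤ M) {n : ℕ} (hn : 1 ≤ n) :
    ∃ p : Polynomial ℝ, p.natDegree < n + k ∧
      ∀ t ∈ Set.Icc (-1 : ℝ) 1, |f t - p.eval t| ≤ (4 / n) ^ k * M := by
  induction k generalizing f with
  | zero => exact ⟨0, by simp; omega, fun t ht => by simpa using hM t ht⟩
  | succ k ih =>
    have hf' : ContDiff ℝ k (deriv f) := (contDiff_succ_iff_deriv.1 (by exact_mod_cast hf)).2.2
    have hdiff : Differentiable ℝ f := hf.differentiable (by simp)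
    obtain ⟨q, hqd, hq⟩ := ih hf' (fun t ht => by
      rw [← iteratedDeriv_succ']; exact hM t ht)
    obtain ⟨Q, hQ, -, hQd⟩ := exists_poly_primitive q 0
    obtain ⟨r, hrd, hr⟩ := exists_poly_of_lipschitz (f := fun t => f t - Q.eval t)
      (K := (4 / n) ^ k * M) (fun s hs t ht => by
        have h := Convex.norm_image_sub_le_of_norm_hasDerivWithin_le
          (f := fun t => f t - Q.eval t) (f' := fun t => deriv f t - q.eval t)
          (s := Set.Icc (-1 : ℝ) 1) (C := (4 / n) ^ k * M)
          (fun t ht => ((hdiff t).hasDerivAt.sub (hQ ▸ Q.hasDerivAt t)).hasDerivWithinAt)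
          (fun t ht => hq t ht) (convex_Icc _ _) ht hs
        simpa [Real.norm_eq_abs] using h) hn
    refine ⟨Q + r, ?_, fun t ht => ?_⟩
    · refine lt_of_le_of_lt (Polynomial.natDegree_add_le _ _) (max_lt ?_ ?_) <;> omega
    · have h := hr t ht
      rw [pow_succ', mul_assoc, Polynomial.eval_add, ← sub_sub]
      exact h

/-- The quadrature error for functions with a bounded `k`-th derivative. The rule is exact on the
approximating polynomial, and its weights are nonnegative with sum `2`. -/
theorem abs_integral_sub_quadrature_le {k N : ℕ} (hN : 1 ≤ N) (hk : k ≤ N) {f : ℝ → ℝ}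
    (hf : ContDiff ℝ k f) {M : ℝ}
    (hM : ∀ t ∈ Set.Icc (-1 : ℝ) 1, |iteratedDeriv k f t| ≤ M) :
    |(∫ t in (-1 : ℝ)..1, f t) - ∑ j, f (node N j) * weight N j| ≤ 4 * ((4 / N) ^ k * M) := by
  obtain ⟨p, hpd, hp⟩ := exists_poly_of_contDiff hf hM hN
  have hq := integral_eq_sum_weight hN (p := p) (by omega)
  set B := (4 / (N : ℝ)) ^ k * M
  have h1 : |(∫ t in (-1 : ℝ)..1, f t) - ∫ t in (-1 : ℝ)..1, p.eval t| ≤ 2 * B := by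
    rw [← intervalIntegral.integral_sub (hf.continuous.intervalIntegrable _ _)
      (intervalIntegrable_poly _ _ _)]
    have := intervalIntegral.norm_integral_le_of_norm_le_const (a := -1) (b := 1) (C := B)
      (f := fun t => f t - p.eval t) (fun t ht => by
        rw [Set.uIoc_of_le (by norm_num)] at ht
        exact hp t (Set.Ioc_subset_Icc_self ht))
    rw [Real.norm_eq_abs] at this
    norm_num at this
    linarith
  have h2 : |(∑ j, weight N j * p.eval (node N j)) - ∑ j, f (node N j) * weight N j| ≤ 2 * B := by
    rw [← Finset.sum_sub_distrib]
    refine (Finset.abs_sum_le_sum_abs _ _).trans ?_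
    rw [← sum_weight hN, Finset.sum_mul]
    refine Finset.sum_le_sum fun j _ => ?_
    rw [mul_comm (f _), ← mul_sub, abs_mul, abs_of_nonneg (weight_nonneg N j), abs_sub_comm]
    exact mul_le_mul_of_nonneg_left (hp _ (node_mem_Icc hN j)) (weight_nonneg N j)
  rw [← hq] at h2
  have := abs_sub_le (∫ t in (-1 : ℝ)..1, f t) (∫ t in (-1 : ℝ)..1, p.eval t)
    (∑ j, f (node N j) * weight N j)
  linarith

/-! ### Integration against functions of bounded variation -/

lemma intervalIntegrable_of_boundedVariationOn {w : ℝ → ℝ} {a b : ℝ} (hab : a ≤ b)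
    (hw : BoundedVariationOn w (Set.Icc a b)) : IntervalIntegrable w volume a b := by
  obtain ⟨p, q, hp, hq, rfl⟩ := hw.locallyBoundedVariationOn.exists_monotoneOn_sub_monotoneOn
  rw [← Set.uIcc_of_le hab] at hp hq
  exact hp.intervalIntegrable.sub hq.intervalIntegrable

/-- Integration by parts over a short interval, up to an error controlled by the variation on it. -/
lemma abs_integral_mul_derivative_sub_le {w : ℝ → ℝ} {a b : ℝ} (hab : a ≤ b)
    (hw : BoundedVariationOn w (Set.Icc a b)) (G : Polynomial ℝ) {g B : ℝ}
    (hg : |G.eval b| ≤ g)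
    (hB : ∀ t ∈ Set.Icc a b, |(Polynomial.derivative G).eval t| ≤ B) :
    |(∫ t in a..b, w t * (Polynomial.derivative G).eval t) -
      (w b * G.eval b - w a * G.eval a)| ≤
      (g + (b - a) * B) * (eVariationOn w (Set.Icc a b)).toReal := by
  set v := (eVariationOn w (Set.Icc a b)).toReal with hv
  have hv0 : 0 ≤ v := ENNReal.toReal_nonneg
  have hosc : ∀ t ∈ Set.Icc a b, |w t - w a| ≤ v := fun t ht => by
    rw [← Real.dist_eq]; exact hw.dist_le ht ⟨le_rfl, hab⟩
  have hwi := intervalIntegrable_of_boundedVariationOn hab hw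
  have hGc : Continuous fun t => (Polynomial.derivative G).eval t :=
    (Polynomial.derivative G).continuous
  have i1 : IntervalIntegrable (fun t => w t * (Polynomial.derivative G).eval t) volume a b :=
    hwi.mul_continuousOn hGc.continuousOn
  have i2 : IntervalIntegrable (fun t => w a * (Polynomial.derivative G).eval t) volume a b :=
    (hGc.intervalIntegrable _ _).const_mul _
  have h1 : (∫ t in a..b, w t * (Polynomial.derivative G).eval t) - w a * (G.eval b - G.eval a) =
      ∫ t in a..b, (w t - w a) * (Polynomial.derivative G).eval t := by
    simp only [sub_mul]
    rw [intervalIntegral.integral_sub i1 i2, intervalIntegral.integral_const_mul,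
      integral_derivative_poly]
  have h2 : |∫ t in a..b, (w t - w a) * (Polynomial.derivative G).eval t| ≤ v * B * |b - a| := by
    rw [← Real.norm_eq_abs]
    refine intervalIntegral.norm_integral_le_of_norm_le_const fun t ht => ?_
    rw [Set.uIoc_of_le hab] at ht
    have ht' := Set.Ioc_subset_Icc_self ht
    rw [norm_mul]
    exact mul_le_mul (hosc t ht') (hB t ht') (abs_nonneg _) hv0
  have h3 : |(w b - w a) * G.eval b| ≤ v * g := by
    rw [abs_mul]
    exact mul_le_mul (hosc b ⟨hab, le_rfl⟩) hg (abs_nonneg _) hv0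
  rw [abs_of_nonneg (sub_nonneg.2 hab), ← h1] at h2
  have h4 : (∫ t in a..b, w t * (Polynomial.derivative G).eval t) -
      (w b * G.eval b - w a * G.eval a) =
      ((∫ t in a..b, w t * (Polynomial.derivative G).eval t) - w a * (G.eval b - G.eval a)) -
        (w b - w a) * G.eval b := by ring
  rw [h4]
  refine (abs_sub _ _).trans ?_
  linarith

/-- The bound that integration by parts in a Stieltjes integral would give. It is obtained from
`abs_integral_mul_derivative_sub_le` on the intervals of a uniform partition as its mesh tends to
zero. -/
lemma abs_integral_mul_derivative_le {w : ℝ → ℝ}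
    (hw : BoundedVariationOn w (Set.Icc (-1) 1)) (G : Polynomial ℝ) (h1 : G.eval 1 = 0)
    (h0 : G.eval (-1) = 0) {g : ℝ} (hg : ∀ t ∈ Set.Icc (-1 : ℝ) 1, |G.eval t| ≤ g) :
    |∫ t in (-1 : ℝ)..1, w t * (Polynomial.derivative G).eval t| ≤
      g * (eVariationOn w (Set.Icc (-1) 1)).toReal := by
  obtain ⟨B, hB⟩ := isCompact_Icc.exists_bound_of_continuousOn (s := Set.Icc (-1 : ℝ) 1)
    (f := fun t => (Polynomial.derivative G).eval t) (Polynomial.continuous _).continuousOn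
  set V := (eVariationOn w (Set.Icc (-1) 1)).toReal with hV
  have key : ∀ n : ℕ, |∫ t in (-1 : ℝ)..1, w t * (Polynomial.derivative G).eval t| ≤
      (g + 2 * (1 / ((n : ℝ) + 1)) * B) * V := by
    intro n
    set s : ℕ → ℝ := fun i => -1 + 2 * i / ((n : ℝ) + 1) with hs
    have hs0 : s 0 = -1 := by simp [hs]
    have hsn : s (n + 1) = 1 := by
      simp only [hs]; push_cast; field_simp; norm_num
    have hmono : Monotone s := by
      intro i j hij
      simp only [hs]
      have : (i : ℝ) ≤ j := by exact_mod_cast hij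
      gcongr
    have hstep : ∀ i, s (i + 1) - s i = 2 * (1 / ((n : ℝ) + 1)) := by
      intro i; simp only [hs]; push_cast; ring
    have hsub : ∀ i < n + 1, Set.Icc (s i) (s (i + 1)) ⊆ Set.Icc (-1) 1 := by
      intro i hi
      refine Set.Icc_subset_Icc ?_ ?_
      · rw [← hs0]; exact hmono (Nat.zero_le _)
      · rw [← hsn]; exact hmono hi
    have hbv : ∀ i < n + 1, BoundedVariationOn w (Set.Icc (s i) (s (i + 1))) :=
      fun i hi => hw.mono (hsub i hi)
    have hint : ∀ i < n + 1, IntervalIntegrable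
        (fun t => w t * (Polynomial.derivative G).eval t) volume (s i) (s (i + 1)) := fun i hi =>
      (intervalIntegrable_of_boundedVariationOn (hmono (Nat.le_succ i))
        (hbv i hi)).mul_continuousOn (Polynomial.continuous _).continuousOn
    have hsum := intervalIntegral.sum_integral_adjacent_intervals hint
    rw [hs0, hsn] at hsum
    have htel : ∑ i ∈ Finset.range (n + 1),
        (w (s (i + 1)) * G.eval (s (i + 1)) - w (s i) * G.eval (s i)) = 0 := by
      rw [Finset.sum_range_sub (fun i => w (s i) * G.eval (s i)), hs0, hsn, h1, h0]
      ring
    have hVsum : ∑ i ∈ Finset.range (n + 1),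
        (eVariationOn w (Set.Icc (s i) (s (i + 1)))).toReal = V := by
      rw [← ENNReal.toReal_sum fun i hi => hbv i (Finset.mem_range.1 hi),
        eVariationOn.sum' w hmono, hs0, hsn]
    rw [← hsum, ← sub_zero (∑ i ∈ _, _), ← htel, ← Finset.sum_sub_distrib, ← hVsum,
      Finset.mul_sum]
    refine (Finset.abs_sum_le_sum_abs _ _).trans (Finset.sum_le_sum fun i hi => ?_)
    have hi' := Finset.mem_range.1 hi
    have hle := hmono (Nat.le_succ i)
    have := abs_integral_mul_derivative_sub_le hle (hbv i hi') G
      (hg _ (hsub i hi' ⟨hle, le_rfl⟩)) (fun t ht => hB t (hsub i hi' ht))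
    rwa [← hstep i]
  have hlim : Filter.Tendsto (fun n : ℕ => (g + 2 * (1 / ((n : ℝ) + 1)) * B) * V) Filter.atTop
      (nhds ((g + 2 * 0 * B) * V)) :=
    (((tendsto_one_div_add_atTop_nhds_zero_nat.const_mul 2).mul_const B).const_add g).mul_const V
  have := ge_of_tendsto' hlim key
  simpa using this

lemma abs_integral_mul_legendre_le_of_bv {w : ℝ → ℝ}
    (hw : BoundedVariationOn w (Set.Icc (-1) 1)) (n : ℕ) :
    |∫ t in (-1 : ℝ)..1, w t * (legendre (n + 1)).eval t| ≤
      √(2 * (n + 1)) / ((n + 1) * (n + 2)) * (eVariationOn w (Set.Icc (-1) 1)).toReal := by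
  set G : Polynomial ℝ := Polynomial.C (1 / (2 * n + 3 : ℝ)) * (legendre (n + 2) - legendre n)
    with hG
  have hd : Polynomial.derivative G = legendre (n + 1) := by
    rw [hG, Polynomial.derivative_C_mul, Polynomial.derivative_sub,
      derivative_legendre_add_two_sub, show (2 * n + 3 : Polynomial ℝ) =
        Polynomial.C (2 * n + 3 : ℝ) by
          simp [show (Polynomial.C 2 : Polynomial ℝ) = 2 from rfl,
            show (Polynomial.C 3 : Polynomial ℝ) = 3 from rfl],
      ← mul_assoc, ← Polynomial.C_mul, one_div, inv_mul_cancel₀ (by positivity), Polynomial.C_1,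
      one_mul]
  rw [← hd]
  refine abs_integral_mul_derivative_le hw G ?_ ?_ fun t ht => ?_
  · simp [hG, eval_one_legendre]
  · simp [hG, eval_neg_one_legendre, pow_add]
  · have h := abs_legendre_sub_le n ht
    have : |G.eval t| = |(legendre (n + 2)).eval t - (legendre n).eval t| / (2 * n + 3) := by
      simp only [hG, Polynomial.eval_mul, Polynomial.eval_C, Polynomial.eval_sub]
      rw [abs_mul, abs_of_pos (show (0 : ℝ) < 1 / (2 * n + 3) by positivity)]
      ring
    rw [this]
    exact h

/-! ### Legendre coefficients -/

/-- `h` is absolutely continuous on `[-1, 1]` with derivative `w` (almost everywhere). -/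
def IsPrimitive (h w : ℝ → ℝ) : Prop :=
  IntervalIntegrable w volume (-1) 1 ∧ ∀ t ∈ Set.Icc (-1 : ℝ) 1, h t = h (-1) + ∫ s in (-1)..t, w s

lemma IsPrimitive.continuousOn {h w : ℝ → ℝ} (hw : IsPrimitive h w) :
    ContinuousOn h (Set.Icc (-1) 1) := by
  have h1 := hw.1.absolutelyContinuousOnInterval_intervalIntegral (c := -1) (by simp)
  have h2 := h1.continuousOn
  rw [Set.uIcc_of_le (by norm_num)] at h2
  exact (continuousOn_const.add h2).congr hw.2

lemma ContinuousOn.intervalIntegrable_Icc {h : ℝ → ℝ} (hc : ContinuousOn h (Set.Icc (-1) 1)) :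
    IntervalIntegrable h volume (-1) 1 :=
  ContinuousOn.intervalIntegrable (by rwa [Set.uIcc_of_le (by norm_num)])

lemma absolutelyContinuousOnInterval_poly (p : Polynomial ℝ) (a b : ℝ) :
    AbsolutelyContinuousOnInterval (fun t => p.eval t) a b :=
  ContDiffOn.absolutelyContinuousOnInterval (p.contDiff_aeval (𝕜 := ℝ) 1).contDiffOn

lemma IsPrimitive.integral_mul_derivative {h w : ℝ → ℝ} (hw : IsPrimitive h w)
    (p : Polynomial ℝ) :
    ∫ t in (-1 : ℝ)..1, h t * (Polynomial.derivative p).eval t =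
      h 1 * p.eval 1 - h (-1) * p.eval (-1) - ∫ t in (-1 : ℝ)..1, w t * p.eval t := by
  have hu : Set.uIcc (-1 : ℝ) 1 = Set.Icc (-1) 1 := Set.uIcc_of_le (by norm_num)
  set k : ℝ → ℝ := fun t => ∫ s in (-1)..t, w s with hk
  have hac := hw.1.absolutelyContinuousOnInterval_intervalIntegral (c := -1) (by simp)
  have h1 := hac.integral_mul_deriv_eq_deriv_mul (absolutelyContinuousOnInterval_poly p (-1) 1)
  have h2 : ∫ t in (-1 : ℝ)..1, deriv k t * p.eval t = ∫ t in (-1 : ℝ)..1, w t * p.eval t := by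
    refine intervalIntegral.integral_congr_ae ?_
    filter_upwards [hw.1.ae_hasDerivAt_integral] with t ht hmem
    rw [(ht (Set.uIoc_subset_uIcc hmem) (-1) (by simp)).deriv]
  rw [h2] at h1
  simp only [Polynomial.deriv] at h1
  have hkc : ContinuousOn k (Set.Icc (-1) 1) := hu ▸ hac.continuousOn
  have i1 : IntervalIntegrable (fun t => h (-1) * (Polynomial.derivative p).eval t) volume (-1) 1 :=
    (intervalIntegrable_poly _ _ _).const_mul _
  have i2 : IntervalIntegrable (fun t => k t * (Polynomial.derivative p).eval t) volume (-1) 1 :=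
    ContinuousOn.intervalIntegrable_Icc (hkc.mul (Polynomial.continuous _).continuousOn)
  have h3 : ∫ t in (-1 : ℝ)..1, h t * (Polynomial.derivative p).eval t =
      ∫ t in (-1 : ℝ)..1, (h (-1) * (Polynomial.derivative p).eval t +
        k t * (Polynomial.derivative p).eval t) := by
    refine intervalIntegral.integral_congr fun t ht => ?_
    rw [hu] at ht
    rw [hw.2 t ht]
    ring
  rw [h3, intervalIntegral.integral_add i1 i2, h1, intervalIntegral.integral_const_mul,
    integral_derivative_poly, hw.2 1 (by simp)]
  simp
  ring

lemma IsPrimitive.integral_mul_legendre_succ {h w : ℝ → ℝ} (hw : IsPrimitive h w) (n : ℕ) :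
    (2 * n + 3) * ∫ t in (-1 : ℝ)..1, h t * (legendre (n + 1)).eval t =
      (∫ t in (-1 : ℝ)..1, w t * (legendre n).eval t) -
        ∫ t in (-1 : ℝ)..1, w t * (legendre (n + 2)).eval t := by
  have h1 := hw.integral_mul_derivative (legendre (n + 2) - legendre n)
  rw [Polynomial.derivative_sub, derivative_legendre_add_two_sub] at h1
  have i : ∀ k, IntervalIntegrable (fun t => w t * (legendre k).eval t) volume (-1) 1 := fun k =>
    hw.1.mul_continuousOn (Polynomial.continuous _).continuousOn
  have e : ∫ t in (-1 : ℝ)..1, w t * (legendre (n + 2) - legendre n).eval t =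
      (∫ t in (-1 : ℝ)..1, w t * (legendre (n + 2)).eval t) -
        ∫ t in (-1 : ℝ)..1, w t * (legendre n).eval t := by
    rw [← intervalIntegral.integral_sub (i _) (i _)]
    refine intervalIntegral.integral_congr fun t _ => ?_
    simp [mul_sub]
  rw [e] at h1
  rw [← intervalIntegral.integral_const_mul]
  simp [eval_one_legendre, eval_neg_one_legendre, pow_add] at h1
  rw [← h1]
  refine intervalIntegral.integral_congr fun t _ => ?_
  ring

/-- The `n`-th Legendre coefficient of `h`. -/
def legCoeff (h : ℝ → ℝ) (n : ℕ) : ℝ :=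
  ((n : ℝ) + 1 / 2) * ∫ t in (-1 : ℝ)..1, h t * (legendre n).eval t

lemma legCoeff_zero (h : ℝ → ℝ) : legCoeff h 0 = 1 / 2 * ∫ t in (-1 : ℝ)..1, h t := by
  simp [legCoeff, legendre_zero]

lemma IsPrimitive.legCoeff_succ {h w : ℝ → ℝ} (hw : IsPrimitive h w) (n : ℕ) :
    legCoeff h (n + 1) = ((∫ t in (-1 : ℝ)..1, w t * (legendre n).eval t) -
        ∫ t in (-1 : ℝ)..1, w t * (legendre (n + 2)).eval t) / 2 := by
  rw [← hw.integral_mul_legendre_succ]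
  unfold legCoeff
  push_cast
  ring

/-- The Legendre coefficients of a function whose derivative has bounded variation. For `n = 0` one of
the two integrals in `IsPrimitive.legCoeff_succ` involves `L_0`, which is not covered by
`abs_integral_mul_legendre_le_of_bv` and is estimated by `U`. -/
lemma IsPrimitive.abs_legCoeff_succ_le {h w : ℝ → ℝ} (hw : IsPrimitive h w)
    (hbv : BoundedVariationOn w (Set.Icc (-1) 1)) {U : ℝ}
    (hU : ∀ t ∈ Set.Icc (-1 : ℝ) 1, |w t| ≤ U) (n : ℕ) :
    |legCoeff h (n + 1)| ≤ 3 * (U + (eVariationOn w (Set.Icc (-1) 1)).toReal) *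
      (1 / ((n : ℝ) + 1) ^ (3 / 2 : ℝ)) := by
  set V := (eVariationOn w (Set.Icc (-1) 1)).toReal with hV
  have hV0 : 0 ≤ V := ENNReal.toReal_nonneg
  have hU0 : 0 ≤ U := (abs_nonneg _).trans (hU 0 (by simp))
  rw [hw.legCoeff_succ, abs_div, abs_two]
  have hs := abs_sub (∫ t in (-1 : ℝ)..1, w t * (legendre n).eval t)
    (∫ t in (-1 : ℝ)..1, w t * (legendre (n + 2)).eval t)
  have h2 := abs_integral_mul_legendre_le_of_bv hbv (n + 1)
  rw [← hV] at h2
  push_cast at h2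
  rcases n with _ | n
  · have h1 : |∫ t in (-1 : ℝ)..1, w t * (legendre 0).eval t| ≤ U * |1 - (-1)| := by
      rw [← Real.norm_eq_abs]
      refine intervalIntegral.norm_integral_le_of_norm_le_const fun t ht => ?_
      rw [Set.uIoc_of_le (by norm_num)] at ht
      simpa [legendre_zero] using hU t (Set.Ioc_subset_Icc_self ht)
    norm_num at h1 h2 hs ⊢
    linarith
  · have h1 := abs_integral_mul_legendre_le_of_bv hbv n
    rw [← hV] at h1
    push_cast at h2 hs ⊢
    set x : ℝ := (n : ℝ) + 1 with hx
    have hx1 : 1 ≤ x := by simp [hx]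
    have hpow : (x + 1) ^ (3 / 2 : ℝ) = (x + 1) * √(x + 1) := by
      rw [show (3 / 2 : ℝ) = 1 + 1 / 2 by norm_num, Real.rpow_add (by positivity), Real.rpow_one,
        Real.sqrt_eq_rpow]
    have hsq : 0 < √(x + 1) := Real.sqrt_pos.2 (by positivity)
    have e1 : √(2 * x) ≤ √2 * √(x + 1) := by
      rw [← Real.sqrt_mul (by norm_num)]
      exact Real.sqrt_le_sqrt (by linarith)
    have a1 : √(2 * x) / (x * (x + 1)) ≤ 2 * (1 / ((x + 1) * √(x + 1))) := by
      rw [mul_one_div, div_le_div_iff₀ (by positivity) (by positivity)]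
      have : √(2 * x) * √(x + 1) ≤ 2 * x := by
        rw [← Real.sqrt_mul (by positivity)]
        refine Real.sqrt_le_iff.2 ⟨by positivity, ?_⟩
        nlinarith
      calc √(2 * x) * ((x + 1) * √(x + 1)) = (√(2 * x) * √(x + 1)) * (x + 1) := by ring
        _ ≤ (2 * x) * (x + 1) := by gcongr
        _ = _ := by ring
    have a2 : √(2 * (x + 1 + 1)) / ((x + 1 + 1) * (x + 1 + 2)) ≤
        2 * (1 / ((x + 1) * √(x + 1))) := by
      rw [mul_one_div, div_le_div_iff₀ (by positivity) (by positivity)]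
      have : √(2 * (x + 1 + 1)) * √(x + 1) ≤ 2 * (x + 1 + 1) := by
        rw [← Real.sqrt_mul (by positivity)]
        refine Real.sqrt_le_iff.2 ⟨by positivity, ?_⟩
        nlinarith
      calc √(2 * (x + 1 + 1)) * ((x + 1) * √(x + 1))
          = (√(2 * (x + 1 + 1)) * √(x + 1)) * (x + 1) := by ring
        _ ≤ (2 * (x + 1 + 1)) * (x + 1 + 2) := by gcongr <;> norm_num
        _ = _ := by ring
    rw [hpow]
    rw [show (n : ℝ) + 2 = x + 1 by rw [hx]; ring] at h1
    have b1 := mul_le_mul_of_nonneg_right a1 hV0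
    have b2 := mul_le_mul_of_nonneg_right a2 hV0
    have hpos : 0 ≤ 1 / ((x + 1) * √(x + 1)) := by positivity
    have c1 : 0 ≤ U * (1 / ((x + 1) * √(x + 1))) := by positivity
    have c2 : 0 ≤ V * (1 / ((x + 1) * √(x + 1))) := by positivity
    have : |∫ t in (-1 : ℝ)..1, w t * (legendre (n + 1)).eval t| ≤
      2 * (1 / ((x + 1) * √(x + 1))) * V := h1.trans b1
    have : |∫ t in (-1 : ℝ)..1, w t * (legendre (n + 1 + 2)).eval t| ≤
      2 * (1 / ((x + 1) * √(x + 1))) * V := h2.trans b2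
    nlinarith

lemma summable_one_div_succ_rpow : Summable fun k : ℕ => 1 / ((k : ℝ) + 1) ^ (3 / 2 : ℝ) := by
  have h := (summable_nat_add_iff 1).2 (Real.summable_one_div_nat_rpow.2
    (show (1 : ℝ) < 3 / 2 by norm_num))
  simpa using h

/-- The sum of the absolute values of the Legendre coefficients of a function whose derivative has
bounded variation. -/
lemma IsPrimitive.sum_abs_legCoeff_le {h w : ℝ → ℝ} (hw : IsPrimitive h w)
    (hbv : BoundedVariationOn w (Set.Icc (-1) 1)) (M : ℕ) :
    ∑ n ∈ Finset.range M, |legCoeff h n| ≤ |(1 / 2) * ∫ t in (-1 : ℝ)..1, h t| +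
      6 / √Real.pi * (sSup ((fun t => |w t|) '' Set.Icc (-1) 1) +
          (eVariationOn w (Set.Icc (-1) 1)).toReal) *
        (∑' k : ℕ, 1 / ((k : ℝ) + 1) ^ (3 / 2 : ℝ)) := by
  set V := (eVariationOn w (Set.Icc (-1) 1)).toReal with hV
  set U := sSup ((fun t => |w t|) '' Set.Icc (-1) 1) with hU
  have hV0 : 0 ≤ V := ENNReal.toReal_nonneg
  have hbdd : BddAbove ((fun t => |w t|) '' Set.Icc (-1) 1) := by
    refine ⟨|w 0| + V, ?_⟩
    rintro _ ⟨t, ht, rfl⟩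
    have h1 := hbv.dist_le ht (show (0 : ℝ) ∈ Set.Icc (-1 : ℝ) 1 by simp)
    rw [Real.dist_eq] at h1
    have h2 := abs_sub_abs_le_abs_sub (w t) (w 0)
    simp only
    linarith
  have hUle : ∀ t ∈ Set.Icc (-1 : ℝ) 1, |w t| ≤ U := fun t ht =>
    le_csSup hbdd ⟨t, ht, rfl⟩
  have hU0 : 0 ≤ U := (abs_nonneg _).trans (hUle 0 (by simp))
  have hpi : (3 : ℝ) ≤ 6 / √Real.pi := by
    rw [le_div_iff₀ (Real.sqrt_pos.2 Real.pi_pos)]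
    have : √Real.pi ≤ 2 := by
      rw [Real.sqrt_le_iff]
      exact ⟨by norm_num, by have := Real.pi_lt_d2; linarith⟩
    linarith
  rcases M with _ | M
  · rw [Finset.range_zero, Finset.sum_empty]
    have : 0 ≤ ∑' k : ℕ, 1 / ((k : ℝ) + 1) ^ (3 / 2 : ℝ) := tsum_nonneg fun k => by positivity
    positivity
  rw [Finset.sum_range_succ', add_comm, legCoeff_zero]
  refine add_le_add le_rfl ?_
  calc ∑ k ∈ Finset.range M, |legCoeff h (k + 1)|
      ≤ ∑ k ∈ Finset.range M, 3 * (U + V) * (1 / ((k : ℝ) + 1) ^ (3 / 2 : ℝ)) :=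
        Finset.sum_le_sum fun k _ => hw.abs_legCoeff_succ_le hbv hUle k
    _ = 3 * (U + V) * ∑ k ∈ Finset.range M, (1 / ((k : ℝ) + 1) ^ (3 / 2 : ℝ)) := by
        rw [Finset.mul_sum]
    _ ≤ 6 / √Real.pi * (U + V) * (∑' k : ℕ, 1 / ((k : ℝ) + 1) ^ (3 / 2 : ℝ)) := by
        have := summable_one_div_succ_rpow.sum_le_tsum (Finset.range M)
          (fun k _ => by positivity)
        gcongr

/-! ### Legendre series -/

lemma integral_legendre_mul_of_ne {j k : ℕ} (h : j ≠ k) :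
    ∫ t in (-1 : ℝ)..1, (legendre j).eval t * (legendre k).eval t = 0 := by
  rcases lt_or_gt_of_ne h with h | h
  · exact integral_mul_legendre_eq_zero (by rwa [natDegree_legendre])
  · simp only [mul_comm ((legendre j).eval _)]
    exact integral_mul_legendre_eq_zero (by rwa [natDegree_legendre])

lemma legCoeff_sum (c : ℕ → ℝ) (M n : ℕ) :
    legCoeff (fun t => ∑ k ∈ Finset.range M, c k * (legendre k).eval t) n =
      if n < M then c n else 0 := by
  unfold legCoeff
  simp only [Finset.sum_mul, mul_assoc]
  rw [intervalIntegral.integral_finsetSum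
    (fun k _ => Continuous.intervalIntegrable (by fun_prop) _ _)]
  simp only [intervalIntegral.integral_const_mul]
  have h : ∀ k, c k * ∫ t in (-1 : ℝ)..1, (legendre k).eval t * (legendre n).eval t =
      if n = k then c n * (2 / (2 * n + 1)) else 0 := by
    intro k
    split_ifs with h
    · rw [h, integral_legendre_mul_self]
    · rw [integral_legendre_mul_of_ne (fun h' => h h'.symm), mul_zero]
  simp only [h, Finset.sum_ite_eq, Finset.mem_range]
  split_ifs
  · field_simp
  · rw [mul_zero]

lemma exists_eq_sum_legendre (n : ℕ) : ∀ p : Polynomial ℝ, p.natDegree ≤ n →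
    ∃ c : ℕ → ℝ, p = ∑ k ∈ Finset.range (n + 1), Polynomial.C (c k) * legendre k := by
  induction n with
  | zero =>
    intro p hp
    refine ⟨fun _ => p.coeff 0, ?_⟩
    simpa [legendre_zero] using Polynomial.eq_C_of_natDegree_le_zero hp
  | succ n ih =>
    intro p hp
    set a := p.coeff (n + 1) / (legendre (n + 1)).coeff (n + 1) with ha
    have hκ := coeff_legendre_ne_zero (n + 1)
    have hdeg : (p - Polynomial.C a * legendre (n + 1)).natDegree ≤ n := by
      rw [Polynomial.natDegree_le_iff_coeff_eq_zero]
      intro j hj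
      rw [Polynomial.coeff_sub, Polynomial.coeff_C_mul]
      rcases (Nat.succ_le_of_lt hj).eq_or_lt with h | h
      · rw [← h, ha, div_mul_cancel₀ _ hκ, sub_self]
      · rw [Polynomial.coeff_eq_zero_of_natDegree_lt (hp.trans_lt h),
          Polynomial.coeff_eq_zero_of_natDegree_lt ((natDegree_legendre_le _).trans_lt h)]
        simp
    obtain ⟨c, hc⟩ := ih _ hdeg
    refine ⟨fun k => if k = n + 1 then a else c k, ?_⟩
    rw [Finset.sum_range_succ]
    beta_reduce
    rw [if_pos rfl, ← sub_eq_iff_eq_add, hc]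
    refine Finset.sum_congr rfl fun k hk => ?_
    rw [if_neg (by have := Finset.mem_range.1 hk; omega)]

/-- A polynomial is the sum of its Legendre series. -/
lemma eval_eq_sum_legCoeff {n : ℕ} {p : Polynomial ℝ} (hp : p.natDegree ≤ n) (t : ℝ) :
    p.eval t = ∑ k ∈ Finset.range (n + 1),
      legCoeff (fun s => p.eval s) k * (legendre k).eval t := by
  obtain ⟨c, hc⟩ := exists_eq_sum_legendre n p hp
  have he : (fun s => p.eval s) =
      fun s => ∑ k ∈ Finset.range (n + 1), c k * (legendre k).eval s := by
    funext s
    conv_lhs => rw [hc]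
    simp [Polynomial.eval_finsetSum]
  rw [he]
  simp only [legCoeff_sum]
  rw [show p.eval t = ∑ k ∈ Finset.range (n + 1), c k * (legendre k).eval t from congrFun he t]
  exact Finset.sum_congr rfl fun k hk => by rw [if_pos (Finset.mem_range.1 hk)]

/-- The Legendre polynomials are complete, by the Weierstrass approximation theorem. -/
lemma eq_zero_of_forall_integral_mul_legendre {D : ℝ → ℝ} (hD : ContinuousOn D (Set.Icc (-1) 1))
    (h : ∀ n, ∫ t in (-1 : ℝ)..1, D t * (legendre n).eval t = 0) :
    ∀ t ∈ Set.Icc (-1 : ℝ) 1, D t = 0 := by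
  have hpoly : ∀ p : Polynomial ℝ, ∫ t in (-1 : ℝ)..1, D t * p.eval t = 0 := by
    intro p
    have hp : ∀ t, D t * p.eval t = ∑ k ∈ Finset.range (p.natDegree + 1),
        D t * (legCoeff (fun s => p.eval s) k * (legendre k).eval t) := fun t => by
      rw [← Finset.mul_sum, ← eval_eq_sum_legCoeff le_rfl]
    rw [intervalIntegral.integral_congr fun t _ => hp t, intervalIntegral.integral_finsetSum]
    · refine Finset.sum_eq_zero fun k _ => ?_
      have : ∀ t : ℝ, D t * (legCoeff (fun s => p.eval s) k * (legendre k).eval t) =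
          legCoeff (fun s => p.eval s) k * (D t * (legendre k).eval t) := fun t => by ring
      simp only [this, intervalIntegral.integral_const_mul, h, mul_zero]
    · intro k _
      exact ContinuousOn.intervalIntegrable_Icc
        (hD.mul (continuous_const.mul (Polynomial.continuous _)).continuousOn)
  obtain ⟨B, hB⟩ := isCompact_Icc.exists_bound_of_continuousOn hD
  have hB0 : 0 ≤ B := (norm_nonneg _).trans (hB 0 (by simp))
  have hsq : ∫ t in (-1 : ℝ)..1, D t * D t = 0 := by
    have hle : ∀ ε > 0, |∫ t in (-1 : ℝ)..1, D t * D t| ≤ ε := by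
      intro ε hε
      obtain ⟨p, hp⟩ := exists_polynomial_near_of_continuousOn (-1) 1 D hD (ε / (2 * (B + 1)))
        (by positivity)
      have i1 : IntervalIntegrable (fun t => D t * D t) volume (-1) 1 :=
        ContinuousOn.intervalIntegrable_Icc (hD.mul hD)
      have i2 : IntervalIntegrable (fun t => D t * p.eval t) volume (-1) 1 :=
        ContinuousOn.intervalIntegrable_Icc (hD.mul p.continuous.continuousOn)
      rw [← sub_zero (∫ t in (-1 : ℝ)..1, D t * D t), ← hpoly p,
        ← intervalIntegral.integral_sub i1 i2, ← Real.norm_eq_abs]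
      have h1 := intervalIntegral.norm_integral_le_of_norm_le_const (a := -1) (b := 1)
        (C := B * (ε / (2 * (B + 1)))) (f := fun t => D t * D t - D t * p.eval t) (fun t ht => by
          rw [Set.uIoc_of_le (by norm_num)] at ht
          have ht' := Set.Ioc_subset_Icc_self ht
          rw [← mul_sub, norm_mul]
          refine mul_le_mul (hB t ht') ?_ (norm_nonneg _) hB0
          rw [Real.norm_eq_abs, abs_sub_comm]
          exact (hp t ht').le)
      refine h1.trans ?_
      rw [show |(1 : ℝ) - -1| = 2 by norm_num]
      have : B * (ε / (2 * (B + 1))) * 2 = ε * (B / (B + 1)) := by field_simp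
      rw [this]
      have hB1 : B / (B + 1) ≤ 1 := by rw [div_le_one (by positivity)]; linarith
      nlinarith
    exact abs_eq_zero.1 (le_antisymm (le_of_forall_pos_le_add fun ε hε => by
      rw [zero_add]; exact hle ε hε) (abs_nonneg _))
  have hae := (intervalIntegral.integral_eq_zero_iff_of_le_of_nonneg_ae (by norm_num)
    (Filter.Eventually.of_forall fun t => mul_self_nonneg (D t))
    (ContinuousOn.intervalIntegrable_Icc (hD.mul hD))).1 hsq
  rw [Measure.restrict_congr_set Ioc_ae_eq_Icc] at hae
  have := Measure.eqOn_Icc_of_ae_eq volume (by norm_num) hae (hD.mul hD) continuousOn_const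
  intro t ht
  exact mul_self_eq_zero.1 (this ht)

/-- A continuous function with summable Legendre coefficients is the sum of its Legendre series. -/
lemma abs_sub_sum_legCoeff_le {h : ℝ → ℝ} (hc : ContinuousOn h (Set.Icc (-1) 1))
    (hs : Summable fun n => |legCoeff h n|) (M : ℕ) {t : ℝ} (ht : t ∈ Set.Icc (-1 : ℝ) 1) :
    |h t - ∑ n ∈ Finset.range M, legCoeff h n * (legendre n).eval t| ≤
      ∑' n, |legCoeff h (n + M)| := by
  set c := legCoeff h with hcdef
  set T : ℝ → ℝ := fun t => ∑' n, c n * (legendre n).eval t with hT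
  have hterm : ∀ n, ∀ t ∈ Set.Icc (-1 : ℝ) 1, ‖c n * (legendre n).eval t‖ ≤ |c n| := by
    intro n t ht
    rw [norm_mul, Real.norm_eq_abs, Real.norm_eq_abs]
    exact mul_le_of_le_one_right (abs_nonneg _) (abs_eval_legendre_le_one n ht)
  have hTc : ContinuousOn T (Set.Icc (-1) 1) :=
    continuousOn_tsum (fun n => (continuous_const.mul (Polynomial.continuous _)).continuousOn) hs
      hterm
  have htail : ∀ M, ∀ t ∈ Set.Icc (-1 : ℝ) 1,
      |T t - ∑ n ∈ Finset.range M, c n * (legendre n).eval t| ≤ ∑' n, |c (n + M)| := by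
    intro M t ht
    have hsum : Summable fun n => c n * (legendre n).eval t :=
      Summable.of_norm_bounded hs fun n => hterm n t ht
    have h1 := hsum.sum_add_tsum_nat_add M
    have h2 : T t - ∑ n ∈ Finset.range M, c n * (legendre n).eval t =
        ∑' n, c (n + M) * (legendre (n + M)).eval t := by
      simp only [hT]; rw [← h1]; ring
    rw [h2, ← Real.norm_eq_abs]
    exact tsum_of_norm_bounded ((summable_nat_add_iff M).2 hs).hasSum fun n => hterm _ t ht
  have hzero : ∀ t ∈ Set.Icc (-1 : ℝ) 1, T t - h t = 0 := by
    refine eq_zero_of_forall_integral_mul_legendre (hTc.sub hc) fun k => ?_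
    have hle : ∀ M, |∫ t in (-1 : ℝ)..1, (T t - h t) * (legendre k).eval t| ≤
        2 * ∑' n, |c (n + (M + k + 1))| := by
      intro M
      set N := M + k + 1 with hN
      set S : ℝ → ℝ := fun t => ∑ n ∈ Finset.range N, c n * (legendre n).eval t with hS
      have hSc : Continuous S := by fun_prop
      have hLc : Continuous fun t => (legendre k).eval t := Polynomial.continuous _
      have hcoef : legCoeff S k = legCoeff h k := by
        rw [hS, legCoeff_sum, if_pos (by omega)]
      have hne : (k : ℝ) + 1 / 2 ≠ 0 := by positivity
      have hint := mul_left_cancel₀ hne hcoef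
      have i1 : IntervalIntegrable (fun t => T t * (legendre k).eval t) volume (-1) 1 :=
        ContinuousOn.intervalIntegrable_Icc (hTc.mul hLc.continuousOn)
      have i2 : IntervalIntegrable (fun t => h t * (legendre k).eval t) volume (-1) 1 :=
        ContinuousOn.intervalIntegrable_Icc (hc.mul hLc.continuousOn)
      have i3 : IntervalIntegrable (fun t => S t * (legendre k).eval t) volume (-1) 1 :=
        ContinuousOn.intervalIntegrable_Icc (hSc.mul hLc).continuousOn
      have e : ∫ t in (-1 : ℝ)..1, (T t - h t) * (legendre k).eval t =
          ∫ t in (-1 : ℝ)..1, (T t - S t) * (legendre k).eval t := by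
        simp only [sub_mul]
        rw [intervalIntegral.integral_sub i1 i2, intervalIntegral.integral_sub i1 i3, hint]
      rw [e, ← Real.norm_eq_abs]
      have h1 := intervalIntegral.norm_integral_le_of_norm_le_const (a := -1) (b := 1)
        (C := ∑' n, |c (n + N)|) (f := fun t => (T t - S t) * (legendre k).eval t)
        (fun t ht => by
          rw [Set.uIoc_of_le (by norm_num)] at ht
          have ht' := Set.Ioc_subset_Icc_self ht
          rw [norm_mul]
          refine (mul_le_of_le_one_right (norm_nonneg _) (abs_eval_legendre_le_one k ht')).trans ?_
          exact htail N t ht')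
      refine h1.trans (le_of_eq ?_)
      norm_num [mul_comm]
    have hlim : Filter.Tendsto (fun M => 2 * ∑' n, |c (n + (M + k + 1))|) Filter.atTop
        (nhds (2 * 0)) := by
      refine Filter.Tendsto.const_mul 2 ?_
      have h1 := tendsto_sum_nat_add fun n => |c n|
      exact h1.comp (Filter.tendsto_add_atTop_nat (k + 1))
    have := ge_of_tendsto' hlim hle
    rw [mul_zero] at this
    exact abs_eq_zero.1 (le_antisymm this (abs_nonneg _))
  have := htail M t ht
  rwa [sub_eq_zero.1 (hzero t ht)] at this

/-- A telescoping majorant of `x ^ (-3/2)`. -/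
lemma one_div_sqrt_sub_ge {x : ℝ} (hx : 1 ≤ x) :
    x ^ (-(3 / 2) : ℝ) ≤ 4 * (1 / √x - 1 / √(x + 1)) := by
  have hx0 : 0 < x := by linarith
  have hp : x ^ (-(3 / 2) : ℝ) = 1 / (x * √x) := by
    rw [Real.rpow_neg hx0.le, show (3 / 2 : ℝ) = 1 + 1 / 2 by norm_num, Real.rpow_add hx0,
      Real.rpow_one, Real.sqrt_eq_rpow, ← one_div]
  set a := √x with ha
  set b := √(x + 1) with hb
  have ha0 : 0 < a := Real.sqrt_pos.2 hx0
  have hb0 : 0 < b := Real.sqrt_pos.2 (by linarith)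
  have ha2 : a ^ 2 = x := Real.sq_sqrt hx0.le
  have hb2 : b ^ 2 = x + 1 := Real.sq_sqrt (by linarith)
  have hba : b ≤ 3 / 2 * a := by nlinarith
  have hab : a ≤ b := Real.sqrt_le_sqrt (by linarith)
  have h1 : 1 / a - 1 / b = 1 / (a * b * (a + b)) := by
    have : (b - a) * (b + a) = 1 := by linarith [show (b - a) * (b + a) = b ^ 2 - a ^ 2 by ring]
    field_simp
    linarith
  rw [hp, h1, mul_one_div, ← ha2]
  rw [div_le_div_iff₀ (by positivity) (by positivity)]
  have h2 : b * (a + b) ≤ 4 * a ^ 2 := by nlinarith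
  calc 1 * (a * b * (a + b)) = a * (b * (a + b)) := by ring
    _ ≤ a * (4 * a ^ 2) := by gcongr
    _ = _ := by ring

lemma tsum_rpow_le {M : ℕ} (hM : 1 ≤ M) :
    ∑' n : ℕ, ((n + M : ℕ) : ℝ) ^ (-(3 / 2) : ℝ) ≤ 4 * (M : ℝ) ^ (-(1 / 2) : ℝ) := by
  refine Real.tsum_le_of_sum_range_le (fun n => by positivity) fun k => ?_
  have h1 : ∑ n ∈ Finset.range k, ((n + M : ℕ) : ℝ) ^ (-(3 / 2) : ℝ) ≤
      ∑ n ∈ Finset.range k, (4 * (1 / √((n + M : ℕ) : ℝ)) - 4 * (1 / √((n + 1 + M : ℕ) : ℝ))) := by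
    refine Finset.sum_le_sum fun n _ => ?_
    have := one_div_sqrt_sub_ge (x := ((n + M : ℕ) : ℝ)) (by exact_mod_cast (by omega))
    have e : ((n + 1 + M : ℕ) : ℝ) = ((n + M : ℕ) : ℝ) + 1 := by push_cast; ring
    rwa [← mul_sub, e]
  refine h1.trans ?_
  rw [Finset.sum_range_sub' (fun n => 4 * (1 / √((n + M : ℕ) : ℝ)))]
  rw [Real.rpow_neg (by positivity), ← Real.sqrt_eq_rpow, zero_add, one_div]
  have : 0 ≤ 4 * (1 / √((k + M : ℕ) : ℝ)) := by positivity
  linarith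

/-- Each integration gains a factor `1 / n` in the decay of the Legendre coefficients. -/
lemma exists_abs_integral_mul_legendre_le {m : ℕ} {y : ℕ → ℝ → ℝ}
    (hy : ∀ j < m, IsPrimitive (y j) (y (j + 1))) (hbv : BoundedVariationOn (y m) (Set.Icc (-1) 1))
    (q : ℕ) (hq : q ≤ m) :
    ∃ C : ℝ, 0 ≤ C ∧ ∀ n : ℕ, q + 1 ≤ n →
      |∫ t in (-1 : ℝ)..1, y (m - q) t * (legendre n).eval t| ≤
        C * (n : ℝ) ^ (-(q + 3 / 2) : ℝ) := by
  induction q with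
  | zero =>
    refine ⟨2 * (eVariationOn (y m) (Set.Icc (-1) 1)).toReal, by positivity, fun n hn => ?_⟩
    obtain ⟨k, rfl⟩ : ∃ k, n = k + 1 := ⟨n - 1, by omega⟩
    have h := abs_integral_mul_legendre_le_of_bv hbv k
    refine h.trans ?_
    rw [mul_right_comm]
    gcongr
    set x : ℝ := (k : ℝ) + 1 with hx
    have hx0 : 0 < x := by positivity
    have e : ((k + 1 : ℕ) : ℝ) ^ (-((0 : ℕ) + 3 / 2) : ℝ) = 1 / (x * √x) := by
      push_cast
      rw [← hx, zero_add, Real.rpow_neg hx0.le, show (3 / 2 : ℝ) = 1 + 1 / 2 by norm_num,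
        Real.rpow_add hx0, Real.rpow_one, Real.sqrt_eq_rpow, ← one_div]
    rw [e, show (k : ℝ) + 2 = x + 1 by rw [hx]; ring, mul_one_div,
      div_le_div_iff₀ (by positivity) (by positivity)]
    have h2 : √(2 * x) * √x ≤ 2 * x := by
      rw [← Real.sqrt_mul (by positivity), Real.sqrt_le_iff]
      exact ⟨by positivity, by nlinarith⟩
    calc √(2 * x) * (x * √x) = (√(2 * x) * √x) * x := by ring
      _ ≤ (2 * x) * (x + 1) := by gcongr; linarith
      _ = _ := by ring
  | succ q ih =>
    obtain ⟨C, hC, hb⟩ := ih (by omega)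
    set s : ℝ := q + 3 / 2 with hs
    have hs0 : 0 < s := by positivity
    refine ⟨2 ^ (s + 1) * C, by positivity, fun n hn => ?_⟩
    obtain ⟨k, rfl⟩ : ∃ k, n = k + 1 := ⟨n - 1, by omega⟩
    have hprim := hy (m - (q + 1)) (by omega)
    rw [show m - (q + 1) + 1 = m - q by omega] at hprim
    have h1 := hprim.integral_mul_legendre_succ k
    have b1 := hb k (by omega)
    have b2 := hb (k + 2) (by omega)
    have hk : (1 : ℝ) ≤ k := by exact_mod_cast (by omega : 1 ≤ k)
    have hk0 : (0 : ℝ) < k := by linarith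
    have b3 : ((k + 2 : ℕ) : ℝ) ^ (-s) ≤ (k : ℝ) ^ (-s) :=
      Real.rpow_le_rpow_of_nonpos hk0 (by push_cast; linarith) (by linarith)
    have b4 : (k : ℝ) ^ (-s) ≤ 2 ^ s * ((k + 1 : ℕ) : ℝ) ^ (-s) := by
      have : ((k + 1 : ℕ) : ℝ) / 2 ≤ k := by push_cast; linarith
      have h2 := Real.rpow_le_rpow_of_nonpos (by positivity) this (z := -s) (by linarith)
      refine h2.trans (le_of_eq ?_)
      rw [Real.div_rpow (by positivity) (by norm_num), Real.rpow_neg (by norm_num : (0 : ℝ) ≤ 2)]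
      field_simp
    have b5 : (2 * (k : ℝ) + 3) *
        |∫ t in (-1 : ℝ)..1, y (m - (q + 1)) t * (legendre (k + 1)).eval t| ≤
        2 * C * (2 ^ s * ((k + 1 : ℕ) : ℝ) ^ (-s)) := by
      rw [← abs_of_pos (show (0 : ℝ) < 2 * k + 3 by positivity), ← abs_mul, h1]
      refine (abs_sub _ _).trans ?_
      have c1 : C * ((k + 2 : ℕ) : ℝ) ^ (-s) ≤ C * (2 ^ s * ((k + 1 : ℕ) : ℝ) ^ (-s)) :=
        mul_le_mul_of_nonneg_left (b3.trans b4) hC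
      have c2 := mul_le_mul_of_nonneg_left b4 hC
      linarith
    have e1 : (-(((q + 1 : ℕ) : ℝ) + 3 / 2)) = -s - 1 := by rw [hs]; push_cast; ring
    have hk1 : (0 : ℝ) < ((k + 1 : ℕ) : ℝ) := by positivity
    rw [e1, Real.rpow_sub_one hk1.ne', Real.rpow_add_one (by norm_num : (2 : ℝ) ≠ 0),
      ← mul_div_assoc, le_div_iff₀ hk1]
    refine le_trans ?_ (b5.trans (le_of_eq (by ring)))
    rw [mul_comm]
    gcongr
    push_cast
    linarith

/-- Uniform convergence of the Legendre series of a function whose `q`-th derivative `y m` has bounded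
variation: its coefficients are `O(n ^ -(q + 1/2))`, and summing the tail costs one power.
-/
lemma exists_abs_sub_sum_legCoeff_le {m : ℕ} {y : ℕ → ℝ → ℝ}
    (hy : ∀ j < m, IsPrimitive (y j) (y (j + 1))) (hbv : BoundedVariationOn (y m) (Set.Icc (-1) 1))
    {q : ℕ} (hq1 : 1 ≤ q) (hq : q ≤ m) :
    ∃ C : ℝ, 0 ≤ C ∧ ∀ M : ℕ, q + 1 ≤ M → ∀ t ∈ Set.Icc (-1 : ℝ) 1,
      |y (m - q) t - ∑ n ∈ Finset.range M, legCoeff (y (m - q)) n * (legendre n).eval t| ≤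
        C * (M : ℝ) ^ (-(q - 1 / 2) : ℝ) := by
  obtain ⟨C, hC, hb⟩ := exists_abs_integral_mul_legendre_le hy hbv q hq
  have hcont : ContinuousOn (y (m - q)) (Set.Icc (-1) 1) := (hy (m - q) (by omega)).continuousOn
  have hcoef : ∀ n : ℕ, q + 1 ≤ n →
      |legCoeff (y (m - q)) n| ≤ 2 * C * (n : ℝ) ^ (-(q + 1 / 2) : ℝ) := by
    intro n hn
    have hn1 : (1 : ℝ) ≤ n := by exact_mod_cast (by omega : 1 ≤ n)
    have hn0 : (0 : ℝ) < n := by linarith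
    unfold legCoeff
    rw [abs_mul, abs_of_pos (by positivity)]
    have e : (n : ℝ) ^ (-(q + 1 / 2) : ℝ) = (n : ℝ) ^ (-(q + 3 / 2) : ℝ) * n := by
      rw [← Real.rpow_add_one hn0.ne']; congr 1; ring
    rw [e]
    calc ((n : ℝ) + 1 / 2) * _ ≤ (2 * n) * (C * (n : ℝ) ^ (-(q + 3 / 2) : ℝ)) := by
          gcongr
          · linarith
          · exact hb n hn
      _ = _ := by ring
  have hq1' : (1 : ℝ) ≤ q := by exact_mod_cast hq1
  have htail : ∀ M : ℕ, q + 1 ≤ M → ∀ n : ℕ, |legCoeff (y (m - q)) (n + M)| ≤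
      2 * C * (M : ℝ) ^ (-(q - 1) : ℝ) * ((n + M : ℕ) : ℝ) ^ (-(3 / 2) : ℝ) := by
    intro M hM n
    have hM0 : (0 : ℝ) < M := by exact_mod_cast (by omega : 0 < M)
    refine (hcoef (n + M) (by omega)).trans ?_
    rw [mul_assoc (2 * C)]
    gcongr
    have hnM : (M : ℝ) ≤ ((n + M : ℕ) : ℝ) := by push_cast; linarith [(n.cast_nonneg : (0 : ℝ) ≤ n)]
    rw [show (-(q + 1 / 2) : ℝ) = -(q - 1) + -(3 / 2) by ring,
      Real.rpow_add (hM0.trans_le hnM)]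
    exact mul_le_mul_of_nonneg_right
      (Real.rpow_le_rpow_of_nonpos hM0 hnM (by linarith)) (by positivity)
  have hsummable : ∀ M : ℕ, Summable fun n : ℕ => ((n + M : ℕ) : ℝ) ^ (-(3 / 2) : ℝ) := fun M =>
    (summable_nat_add_iff (f := fun n : ℕ => (n : ℝ) ^ (-(3 / 2) : ℝ)) M).2
      (Real.summable_nat_rpow.2 (by norm_num))
  have hs : Summable fun n => |legCoeff (y (m - q)) n| := by
    rw [← summable_nat_add_iff (q + 1)]
    exact Summable.of_nonneg_of_le (fun n => abs_nonneg _) (htail (q + 1) le_rfl)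
      ((hsummable _).mul_left _)
  refine ⟨8 * C, by positivity, fun M hM t ht => ?_⟩
  have hM0 : (0 : ℝ) < M := by exact_mod_cast (by omega : 0 < M)
  refine (abs_sub_sum_legCoeff_le hcont hs M ht).trans ?_
  calc ∑' n, |legCoeff (y (m - q)) (n + M)|
      ≤ ∑' n : ℕ, 2 * C * (M : ℝ) ^ (-(q - 1) : ℝ) * ((n + M : ℕ) : ℝ) ^ (-(3 / 2) : ℝ) :=
        ((summable_nat_add_iff M).2 hs).tsum_le_tsum (htail M hM) ((hsummable M).mul_left _)
    _ = 2 * C * (M : ℝ) ^ (-(q - 1) : ℝ) * ∑' n : ℕ, ((n + M : ℕ) : ℝ) ^ (-(3 / 2) : ℝ) :=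
        tsum_mul_left
    _ ≤ 2 * C * (M : ℝ) ^ (-(q - 1) : ℝ) * (4 * (M : ℝ) ^ (-(1 / 2) : ℝ)) := by
        gcongr
        exact tsum_rpow_le (by omega)
    _ = 8 * C * (M : ℝ) ^ (-(q - 1 / 2) : ℝ) := by
        rw [show (-(q - 1 / 2) : ℝ) = -(q - 1) + -(1 / 2) by ring, Real.rpow_add hM0]
        ring

/-! ### Weak derivatives and absolute continuity -/

lemma intervalIntegral_eq_integral_of_tsupport {ψ k : ℝ → ℝ}
    (hs : tsupport ψ ⊆ Set.Ioo (-1) 1) :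
    ∫ t in (-1 : ℝ)..1, k t * ψ t = ∫ t, k t * ψ t := by
  refine intervalIntegral.integral_eq_integral_of_support_subset ?_
  intro t ht
  have h1 : ψ t ≠ 0 := fun h => ht (by simp [h])
  exact Set.Ioo_subset_Ioc_self (hs (subset_tsupport ψ h1))

lemma eq_zero_of_forall_integral_mul_test {K : ℝ → ℝ} (hK : ContinuousOn K (Set.Icc (-1) 1))
    (h : ∀ ψ : ℝ → ℝ, ContDiff ℝ (⊤ : ℕ∞) ψ → HasCompactSupport ψ → tsupport ψ ⊆ Set.Ioo (-1) 1 →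
      ∫ t in (-1 : ℝ)..1, K t * ψ t = 0) : ∀ t ∈ Set.Icc (-1 : ℝ) 1, K t = 0 := by
  have hloc : LocallyIntegrableOn K (Set.Ioo (-1) 1) :=
    (hK.mono Set.Ioo_subset_Icc_self).locallyIntegrableOn measurableSet_Ioo
  have hae := isOpen_Ioo.ae_eq_zero_of_integral_contDiff_smul_eq_zero hloc fun ψ h1 h2 h3 => by
    have := h ψ h1 h2 h3
    rw [intervalIntegral_eq_integral_of_tsupport h3] at this
    rw [← this]
    exact integral_congr_ae (Filter.Eventually.of_forall fun t => mul_comm _ _)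
  have hae2 : K =ᵐ[volume.restrict (Set.Icc (-1 : ℝ) 1)] fun _ => 0 := by
    rw [← Measure.restrict_congr_set Ioo_ae_eq_Icc]
    exact (ae_restrict_iff' measurableSet_Ioo).2 hae
  exact Measure.eqOn_Icc_of_ae_eq volume (by norm_num) hae2 hK continuousOn_const

/-- Test functions of mean zero are derivatives of test functions. -/
lemma exists_test_primitive {χ : ℝ → ℝ} (h1 : ContDiff ℝ (⊤ : ℕ∞) χ) (h2 : HasCompactSupport χ)
    (h3 : tsupport χ ⊆ Set.Ioo (-1) 1) (h0 : ∫ t in (-1 : ℝ)..1, χ t = 0) :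
    ∃ φ : ℝ → ℝ, ContDiff ℝ (⊤ : ℕ∞) φ ∧ HasCompactSupport φ ∧ tsupport φ ⊆ Set.Ioo (-1) 1 ∧
      deriv φ = χ := by
  obtain ⟨a, ha1, ha⟩ : ∃ a : ℝ, a < 1 ∧ ∀ t, χ t ≠ 0 → t ∈ Set.Ioo (-a) a := by
    have hc : IsCompact (tsupport χ) := h2
    rcases (tsupport χ).eq_empty_or_nonempty with he | hne
    · refine ⟨0, by norm_num, fun t ht => ?_⟩
      have := subset_tsupport χ ht
      rw [he] at this
      exact absurd this (Set.notMem_empty t)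
    · obtain ⟨s, hs, hmax⟩ := hc.exists_isMaxOn hne continuous_abs.continuousOn
      have hs1 : |s| < 1 := abs_lt.2 (h3 hs)
      refine ⟨(1 + |s|) / 2, by linarith, fun t ht => ?_⟩
      have h4 : |t| ≤ |s| := hmax (subset_tsupport χ ht)
      exact abs_lt.1 (by linarith)
  have hz : ∀ t, t ∉ Set.Ioo (-a) a → χ t = 0 := fun t ht => by
    by_contra h
    exact ht (ha t h)
  have hχc : Continuous χ := h1.continuous
  have hi : ∀ s t, IntervalIntegrable χ volume s t := fun s t => hχc.intervalIntegrable s t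
  set φ : ℝ → ℝ := fun t => ∫ s in (-1)..t, χ s with hφ
  have hder : ∀ t, HasDerivAt φ (χ t) t := fun t =>
    intervalIntegral.integral_hasDerivAt_right (hi _ _)
      (hχc.stronglyMeasurableAtFilter _ _) hχc.continuousAt
  have hderiv : deriv φ = χ := funext fun t => (hder t).deriv
  have hleft : ∀ t ≤ -a, φ t = 0 := by
    intro t ht
    refine intervalIntegral.integral_zero_ae (Filter.Eventually.of_forall fun s hs => hz s ?_)
    intro hs'
    rw [Set.uIoc, Set.mem_Ioc] at hs
    have : max (-1) t ≤ -a := max_le (by linarith) ht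
    linarith [hs'.1, hs.2]
  have hright : ∀ t, a ≤ t → φ t = 0 := by
    intro t ht
    have e := intervalIntegral.integral_add_adjacent_intervals (hi (-1) 1) (hi 1 t)
    rw [h0, zero_add] at e
    rw [hφ]
    simp only
    rw [← e]
    refine intervalIntegral.integral_zero_ae (Filter.Eventually.of_forall fun s hs => hz s ?_)
    intro hs'
    rw [Set.uIoc, Set.mem_Ioc] at hs
    have : a ≤ min 1 t := le_min ha1.le ht
    linarith [hs'.2, hs.1]
  have hsupp : tsupport φ ⊆ Set.Icc (-a) a := by
    refine closure_minimal (fun t ht => ?_) isClosed_Icc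
    refine ⟨?_, ?_⟩
    · by_contra! h
      exact ht (hleft t h.le)
    · by_contra! h
      exact ht (hright t h.le)
  refine ⟨φ, ?_, ?_, ?_, hderiv⟩
  · rw [contDiff_infty_iff_deriv, hderiv]
    exact ⟨fun t => (hder t).differentiableAt, h1⟩
  · exact isCompact_Icc.of_isClosed_subset (isClosed_tsupport φ) hsupp
  · exact hsupp.trans fun t ht => ⟨by linarith [ht.1], by linarith [ht.2]⟩

lemma exists_test_integral_eq_one : ∃ ψ : ℝ → ℝ, ContDiff ℝ (⊤ : ℕ∞) ψ ∧ HasCompactSupport ψ ∧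
    tsupport ψ ⊆ Set.Ioo (-1) 1 ∧ ∫ t in (-1 : ℝ)..1, ψ t = 1 := by
  let b : ContDiffBump (0 : ℝ) := ⟨1 / 4, 1 / 2, by norm_num, by norm_num⟩
  have hs : tsupport (b.normed volume) ⊆ Set.Ioo (-1) 1 := by
    rw [b.tsupport_normed_eq, Real.closedBall_eq_Icc]
    intro t ht
    have h1 : b.rOut = 1 / 2 := rfl
    rw [h1] at ht
    exact ⟨by linarith [ht.1], by linarith [ht.2]⟩
  refine ⟨b.normed volume, b.contDiff_normed, b.hasCompactSupport_normed, hs, ?_⟩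
  have h := intervalIntegral_eq_integral_of_tsupport (k := fun _ => 1) hs
  simp only [one_mul] at h
  rw [h, b.integral_normed]

/-- The lemma of du Bois-Reymond. -/
lemma eq_const_of_forall_integral_mul_deriv {K : ℝ → ℝ} (hK : ContinuousOn K (Set.Icc (-1) 1))
    (h : ∀ φ : ℝ → ℝ, ContDiff ℝ (⊤ : ℕ∞) φ → HasCompactSupport φ → tsupport φ ⊆ Set.Ioo (-1) 1 →
      ∫ t in (-1 : ℝ)..1, K t * deriv φ t = 0) :
    ∃ c, ∀ t ∈ Set.Icc (-1 : ℝ) 1, K t = c := by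
  obtain ⟨ψ₀, a1, a2, a3, a4⟩ := exists_test_integral_eq_one
  set c := ∫ t in (-1 : ℝ)..1, K t * ψ₀ t with hc
  have hint : ∀ ψ : ℝ → ℝ, Continuous ψ →
      IntervalIntegrable (fun t => K t * ψ t) volume (-1) 1 := fun ψ hψ =>
    ContinuousOn.intervalIntegrable_Icc (hK.mul hψ.continuousOn)
  refine ⟨c, fun t ht => sub_eq_zero.1 ?_⟩
  refine eq_zero_of_forall_integral_mul_test (K := fun t => K t - c) (hK.sub continuousOn_const)
    (fun ψ b1 b2 b3 => ?_) t ht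
  set d := ∫ t in (-1 : ℝ)..1, ψ t with hd
  have hts : tsupport (fun t => ψ t - d * ψ₀ t) ⊆ tsupport ψ ∪ tsupport ψ₀ := by
    refine (tsupport_sub ψ (fun t => d * ψ₀ t)).trans (Set.union_subset_union_right _ ?_)
    exact closure_mono (Function.support_mul_subset_right _ _)
  obtain ⟨φ, c1, c2, c3, c4⟩ := exists_test_primitive (χ := fun t => ψ t - d * ψ₀ t)
    (b1.sub (contDiff_const.mul a1)) (b2.sub a2.mul_left)
    (hts.trans (Set.union_subset b3 a3)) (by
      rw [intervalIntegral.integral_sub (b1.continuous.intervalIntegrable _ _)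
        ((a1.continuous.intervalIntegrable _ _).const_mul _),
        intervalIntegral.integral_const_mul, a4, hd]
      ring)
  have h1 := h φ c1 c2 c3
  rw [c4] at h1
  have e1 : ∫ t in (-1 : ℝ)..1, K t * (ψ t - d * ψ₀ t) =
      (∫ t in (-1 : ℝ)..1, K t * ψ t) - d * c := by
    rw [hc, ← intervalIntegral.integral_const_mul,
      ← intervalIntegral.integral_sub (hint _ b1.continuous) ((hint _ a1.continuous).const_mul _)]
    exact intervalIntegral.integral_congr fun t _ => by ring
  have e2 : ∫ t in (-1 : ℝ)..1, (K t - c) * ψ t = (∫ t in (-1 : ℝ)..1, K t * ψ t) - c * d := by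
    rw [hd, ← intervalIntegral.integral_const_mul,
      ← intervalIntegral.integral_sub (hint _ b1.continuous)
        ((b1.continuous.intervalIntegrable _ _).const_mul _)]
    exact intervalIntegral.integral_congr fun t _ => by ring
  rw [e2, mul_comm, ← e1, h1]

lemma isPrimitive_of_weak {k v : ℝ → ℝ} (hk : ContinuousOn k (Set.Icc (-1) 1))
    (hv : IntervalIntegrable v volume (-1) 1)
    (h : ∀ φ : ℝ → ℝ, ContDiff ℝ (⊤ : ℕ∞) φ → HasCompactSupport φ → tsupport φ ⊆ Set.Ioo (-1) 1 →
      ∫ t in (-1 : ℝ)..1, k t * deriv φ t = -∫ t in (-1 : ℝ)..1, v t * φ t) :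
    IsPrimitive k v := by
  have hu : Set.uIcc (-1 : ℝ) 1 = Set.Icc (-1) 1 := Set.uIcc_of_le (by norm_num)
  set w : ℝ → ℝ := fun t => ∫ s in (-1)..t, v s with hw
  have hac := hv.absolutelyContinuousOnInterval_intervalIntegral (c := -1) (by simp)
  have hwc : ContinuousOn w (Set.Icc (-1) 1) := hu ▸ hac.continuousOn
  obtain ⟨c, hc⟩ := eq_const_of_forall_integral_mul_deriv (K := fun t => k t - w t)
    (hk.sub hwc) fun φ h1 h2 h3 => by
      have hφc : Continuous (deriv φ) := h1.continuous_deriv (by simp)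
      have hφac : AbsolutelyContinuousOnInterval φ (-1) 1 :=
        ContDiffOn.absolutelyContinuousOnInterval (h1.of_le (by simp)).contDiffOn
      have e1 := hac.integral_mul_deriv_eq_deriv_mul hφac
      have e2 : ∫ t in (-1 : ℝ)..1, deriv w t * φ t = ∫ t in (-1 : ℝ)..1, v t * φ t := by
        refine intervalIntegral.integral_congr_ae ?_
        filter_upwards [hv.ae_hasDerivAt_integral] with t ht hmem
        rw [(ht (Set.uIoc_subset_uIcc hmem) (-1) (by simp)).deriv]
      have b1 : φ 1 = 0 := by
        by_contra hne; exact lt_irrefl _ (h3 (subset_tsupport φ hne)).2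
      have b2 : φ (-1) = 0 := by
        by_contra hne; exact lt_irrefl _ (h3 (subset_tsupport φ hne)).1
      rw [e2, b1, b2] at e1
      have i1 : IntervalIntegrable (fun t => k t * deriv φ t) volume (-1) 1 :=
        ContinuousOn.intervalIntegrable_Icc (hk.mul hφc.continuousOn)
      have i2 : IntervalIntegrable (fun t => w t * deriv φ t) volume (-1) 1 :=
        ContinuousOn.intervalIntegrable_Icc (hwc.mul hφc.continuousOn)
      have e3 : ∫ t in (-1 : ℝ)..1, w t * deriv φ t = _ := e1
      simp only [sub_mul]
      rw [intervalIntegral.integral_sub i1 i2, h φ h1 h2 h3, e3]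
      ring
  refine ⟨hv, fun t ht => ?_⟩
  have h1 := hc t ht
  have h2 := hc (-1) (by simp)
  simp only [hw, intervalIntegral.integral_same] at h1 h2
  linarith

lemma test_deriv {φ : ℝ → ℝ} (h1 : ContDiff ℝ (⊤ : ℕ∞) φ) (h2 : HasCompactSupport φ)
    (h3 : tsupport φ ⊆ Set.Ioo (-1) 1) : ContDiff ℝ (⊤ : ℕ∞) (deriv φ) ∧
      HasCompactSupport (deriv φ) ∧ tsupport (deriv φ) ⊆ Set.Ioo (-1) 1 :=
  ⟨(contDiff_infty_iff_deriv.1 h1).2, h2.deriv,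
    (closure_minimal (support_deriv_subset) (isClosed_tsupport φ)).trans h3⟩

/-- The members of a family of weak derivatives are primitives of each other. -/
lemma IsDerivFamily.isPrimitive {m : ℕ} {ξ : ℝ → ℝ} {y : ℕ → ℝ → ℝ} (hy : IsDerivFamily m ξ y)
    {j : ℕ} (hj : j < m) : IsPrimitive (y j) (y (j + 1)) := by
  have hint : IntervalIntegrable (y (j + 1)) volume (-1) 1 := by
    rcases (Nat.succ_le_of_lt hj).eq_or_lt with h | h
    · have := hy.bv
      rw [← h] at this
      exact intervalIntegrable_of_boundedVariationOn (by norm_num) this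
    · exact ContinuousOn.intervalIntegrable_Icc (hy.cont _ h)
  refine isPrimitive_of_weak (hy.cont j hj) hint fun φ h1 h2 h3 => ?_
  obtain ⟨d1, d2, d3⟩ := test_deriv h1 h2 h3
  have e1 := (hy.weak j hj.le).2.2 _ d1 d2 d3
  have e2 := (hy.weak (j + 1) hj).2.2 φ h1 h2 h3
  rw [iteratedDeriv_succ', e1, pow_succ, mul_neg_one, neg_mul, ← mul_neg] at e2
  exact mul_left_cancel₀ (by simp) e2

lemma IsDerivFamily.eq_zeroth {m : ℕ} (hm : 0 < m) {ξ : ℝ → ℝ} {y : ℕ → ℝ → ℝ}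
    (hy : IsDerivFamily m ξ y) (hξ : ContinuousOn ξ (Set.Icc (-1) 1)) :
    ∀ t ∈ Set.Icc (-1 : ℝ) 1, ξ t = y 0 t := by
  have hc := hy.cont 0 hm
  intro t ht
  refine sub_eq_zero.1 (eq_zero_of_forall_integral_mul_test (K := fun t => ξ t - y 0 t)
    (hξ.sub hc) (fun φ h1 h2 h3 => ?_) t ht)
  have e := (hy.weak 0 hm.le).2.2 φ h1 h2 h3
  simp only [iteratedDeriv_zero, pow_zero, one_mul] at e
  have i1 : IntervalIntegrable (fun t => ξ t * φ t) volume (-1) 1 :=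
    ContinuousOn.intervalIntegrable_Icc (hξ.mul h1.continuous.continuousOn)
  have i2 : IntervalIntegrable (fun t => y 0 t * φ t) volume (-1) 1 :=
    ContinuousOn.intervalIntegrable_Icc (hc.mul h1.continuous.continuousOn)
  simp only [sub_mul]
  rw [intervalIntegral.integral_sub i1 i2, e, sub_self]

lemma IsPrimitive.congr {h k w : ℝ → ℝ} (hw : IsPrimitive h w)
    (he : ∀ t ∈ Set.Icc (-1 : ℝ) 1, k t = h t) : IsPrimitive k w :=
  ⟨hw.1, fun t ht => by rw [he t ht, he (-1) (by simp), hw.2 t ht]⟩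

lemma isPrimitive_poly (p : Polynomial ℝ) :
    IsPrimitive (fun t => p.eval t) fun t => (Polynomial.derivative p).eval t :=
  ⟨intervalIntegrable_poly _ _ _, fun t _ => by rw [integral_derivative_poly]; ring⟩

lemma IsPrimitive.sub {h k v w : ℝ → ℝ} (h1 : IsPrimitive h v) (h2 : IsPrimitive k w) :
    IsPrimitive (fun t => h t - k t) fun t => v t - w t := by
  refine ⟨h1.1.sub h2.1, fun t ht => ?_⟩
  have hs : Set.uIcc (-1) t ⊆ Set.uIcc (-1 : ℝ) 1 := by
    rw [Set.uIcc_of_le ht.1, Set.uIcc_of_le (by norm_num)]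
    exact Set.Icc_subset_Icc_right ht.2
  rw [intervalIntegral.integral_sub (h1.1.mono_set hs) (h2.1.mono_set hs)]
  beta_reduce
  rw [h1.2 t ht, h2.2 t ht]
  ring

lemma IsPrimitive.const_mul {h v : ℝ → ℝ} (h1 : IsPrimitive h v) (a : ℝ) :
    IsPrimitive (fun t => a * h t) fun t => a * v t := by
  refine ⟨h1.1.const_mul a, fun t ht => ?_⟩
  rw [intervalIntegral.integral_const_mul]
  beta_reduce
  rw [h1.2 t ht]
  ring

/-- A primitive with value `a` at `-1` of a function bounded by `B` is bounded by `a + 2 B`. -/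
lemma IsPrimitive.abs_le {h v : ℝ → ℝ} (h1 : IsPrimitive h v) {B : ℝ}
    (hB : ∀ t ∈ Set.Icc (-1 : ℝ) 1, |v t| ≤ B) {t : ℝ} (ht : t ∈ Set.Icc (-1 : ℝ) 1) :
    |h t| ≤ |h (-1)| + 2 * B := by
  have hB0 : 0 ≤ B := (abs_nonneg _).trans (hB 0 (by simp))
  rw [h1.2 t ht]
  refine (abs_add_le _ _).trans ?_
  gcongr
  have := intervalIntegral.norm_integral_le_of_norm_le_const (a := -1) (b := t) (C := B) (f := v)
    (fun s hs => by
      rw [Set.uIoc_of_le ht.1] at hs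
      exact hB s ⟨hs.1.le, hs.2.trans ht.2⟩)
  rw [Real.norm_eq_abs, abs_of_nonneg (by linarith [ht.1] : 0 ≤ t - -1)] at this
  nlinarith [ht.2]

lemma IsPrimitive.hasDerivAt {h v : ℝ → ℝ} (h1 : IsPrimitive h v)
    (hv : ContinuousOn v (Set.Icc (-1) 1)) {t : ℝ} (ht : t ∈ Set.Ioo (-1 : ℝ) 1) :
    HasDerivAt h (v t) t := by
  have hn : Set.Icc (-1 : ℝ) 1 ∈ nhds t := Icc_mem_nhds ht.1 ht.2
  have hs : Set.uIcc (-1) t ⊆ Set.uIcc (-1 : ℝ) 1 := by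
    rw [Set.uIcc_of_le ht.1.le, Set.uIcc_of_le (by norm_num)]
    exact Set.Icc_subset_Icc_right ht.2.le
  have hd : HasDerivAt (fun x => ∫ s in (-1)..x, v s) (v t) t :=
    intervalIntegral.integral_hasDerivAt_right (h1.1.mono_set hs)
      ((hv.mono Set.Ioo_subset_Icc_self).stronglyMeasurableAtFilter isOpen_Ioo t ht)
      (hv.continuousAt hn)
  refine (hd.const_add (h (-1))).congr_of_eventuallyEq ?_
  filter_upwards [hn] with s hs
  exact h1.2 s hs

lemma absolutelyContinuousOnInterval_congr {f g : ℝ → ℝ} {a b : ℝ}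
    (hf : AbsolutelyContinuousOnInterval f a b) (h : ∀ t ∈ Set.uIcc a b, g t = f t) :
    AbsolutelyContinuousOnInterval g a b := by
  refine Filter.Tendsto.congr' ?_ hf
  refine Filter.eventually_inf_principal.2 (Filter.Eventually.of_forall fun E hE => ?_)
  refine Finset.sum_congr rfl fun i hi => ?_
  rw [h _ (hE.1 i hi).1, h _ (hE.1 i hi).2]

lemma IsPrimitive.absolutelyContinuousOnInterval {h v : ℝ → ℝ} (h1 : IsPrimitive h v) :
    AbsolutelyContinuousOnInterval h (-1) 1 := by
  have hc : AbsolutelyContinuousOnInterval (fun _ : ℝ => h (-1)) (-1) 1 := by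
    have := absolutelyContinuousOnInterval_poly (Polynomial.C (h (-1))) (-1) 1
    simpa using this
  refine absolutelyContinuousOnInterval_congr (hc.add
    (h1.1.absolutelyContinuousOnInterval_intervalIntegral (c := -1) (by simp))) fun t ht => ?_
  rw [Set.uIcc_of_le (by norm_num)] at ht
  exact h1.2 t ht

lemma isPrimitive_of_absolutelyContinuousOnInterval {h v : ℝ → ℝ}
    (hac : AbsolutelyContinuousOnInterval h (-1) 1) (hv : IntervalIntegrable v volume (-1) 1)
    (hd : ∀ᵐ t ∂(volume.restrict (Set.Icc (-1 : ℝ) 1)), HasDerivAt h (v t) t) :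
    IsPrimitive h v := by
  refine ⟨hv, fun t ht => ?_⟩
  have hs : Set.uIcc (-1) t ⊆ Set.uIcc (-1 : ℝ) 1 := by
    rw [Set.uIcc_of_le ht.1, Set.uIcc_of_le (by norm_num)]
    exact Set.Icc_subset_Icc_right ht.2
  have h1 := (hac.mono hs).integral_deriv_eq_sub
  have h2 : ∫ s in (-1)..t, deriv h s = ∫ s in (-1)..t, v s := by
    refine intervalIntegral.integral_congr_ae ?_
    filter_upwards [(ae_restrict_iff' measurableSet_Icc).1 hd] with s hs' hmem
    rw [Set.uIoc_of_le ht.1] at hmem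
    exact (hs' ⟨hmem.1.le, hmem.2.trans ht.2⟩).deriv
  rw [← h2, h1]
  ring

/-! ### Smooth functions on bounded sets -/

section Smooth

variable {V W : Type*} [NormedAddCommGroup V] [NormedSpace ℝ V] [ProperSpace V]
  [NormedAddCommGroup W] [NormedSpace ℝ W]

lemma exists_lipschitz_bound {G : V → W} (hG : ContDiff ℝ 1 G) (R : ℝ) :
    ∃ K : ℝ, 0 ≤ K ∧ ∀ a b : V, ‖a‖ ≤ R → ‖b‖ ≤ R → ‖G b - G a‖ ≤ K * ‖b - a‖ := by
  obtain ⟨K, hK⟩ := (isCompact_closedBall (0 : V) R).exists_bound_of_continuousOn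
    (hG.continuous_fderiv (by simp)).continuousOn
  refine ⟨max K 0, le_max_right _ _, fun a b ha hb => ?_⟩
  refine Convex.norm_image_sub_le_of_norm_fderiv_le (𝕜 := ℝ)
    (fun x _ => hG.differentiable (by simp) x) (fun x hx => (hK x hx).trans (le_max_left _ _))
    (convex_closedBall (0 : V) R) ?_ ?_
  · simpa using ha
  · simpa using hb

/-- Second differences of a twice continuously differentiable function are quadratically small,
uniformly on bounded sets. -/
lemma exists_second_difference_bound {G : V → ℝ} (hG : ContDiff ℝ 2 G) (R : ℝ) :
    ∃ K : ℝ, 0 ≤ K ∧ ∀ a d : V, ‖a‖ ≤ R → ‖d‖ ≤ 1 →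
      G (a + d) + G (a - d) - 2 * G a ≤ K * ‖d‖ ^ 2 := by
  have hG1 : ContDiff ℝ 1 (fderiv ℝ G) := hG.fderiv_right (by norm_num)
  obtain ⟨K, hK0, hK⟩ := exists_lipschitz_bound hG1 (R + 1)
  refine ⟨2 * K, by positivity, fun a d ha hd => ?_⟩
  have hdiff : Differentiable ℝ G := hG.differentiable (by simp)
  have hder : ∀ s : ℝ, HasDerivAt (fun s : ℝ => G (a + s • d) + G (a - s • d))
      (fderiv ℝ G (a + s • d) d - fderiv ℝ G (a - s • d) d) s := by
    intro s
    have h1 : HasDerivAt (fun s : ℝ => a + s • d) d s := by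
      simpa using ((hasDerivAt_id s).smul_const d).const_add a
    have h2 : HasDerivAt (fun s : ℝ => a - s • d) (-d) s := by
      simpa using ((hasDerivAt_id s).smul_const d).const_sub a
    have h3 := (hdiff (a + s • d)).hasFDerivAt.comp_hasDerivAt s h1
    have h4 := (hdiff (a - s • d)).hasFDerivAt.comp_hasDerivAt s h2
    refine (h3.add h4).congr_deriv ?_
    rw [map_neg]
    exact (sub_eq_add_neg _ _).symm
  have hbound : ∀ s ∈ Set.Icc (0 : ℝ) 1,
      ‖fderiv ℝ G (a + s • d) d - fderiv ℝ G (a - s • d) d‖ ≤ 2 * K * ‖d‖ ^ 2 := by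
    intro s hs
    have hsd : ‖s • d‖ ≤ ‖d‖ := by
      rw [norm_smul, Real.norm_eq_abs, abs_of_nonneg hs.1]
      exact mul_le_of_le_one_left (norm_nonneg _) hs.2
    have h1 := hK (a - s • d) (a + s • d) ((norm_sub_le _ _).trans (by linarith))
      ((norm_add_le _ _).trans (by linarith))
    have h2 : ‖(a + s • d) - (a - s • d)‖ ≤ 2 * ‖d‖ := by
      rw [show (a + s • d) - (a - s • d) = s • d + s • d by abel]
      exact (norm_add_le _ _).trans (by linarith)
    rw [← sub_apply]
    refine (ContinuousLinearMap.le_opNorm _ _).trans ?_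
    calc _ ≤ (K * (2 * ‖d‖)) * ‖d‖ := by
          gcongr
          exact h1.trans (by gcongr)
      _ = _ := by ring
  have h := Convex.norm_image_sub_le_of_norm_hasDerivWithin_le
    (fun s _ => (hder s).hasDerivWithinAt) hbound (convex_Icc (0 : ℝ) 1)
    (x := 0) (y := 1) (by simp) (by simp)
  simp only [one_smul, zero_smul, add_zero, sub_zero, norm_one, mul_one] at h
  have := (Real.le_norm_self _).trans h
  linarith

/-- Uniform bounds for the derivatives of a composition, on bounded sets. -/
lemma exists_iteratedDeriv_comp_bound {G : V → ℝ} {n : ℕ} (hG : ContDiff ℝ n G) (B : ℝ) :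
    ∃ K : ℝ, 0 ≤ K ∧ ∀ (c : ℝ → V), ContDiff ℝ n c → ∀ t : ℝ,
      (∀ j ≤ n, ‖iteratedDeriv j c t‖ ≤ B) → |iteratedDeriv n (G ∘ c) t| ≤ K := by
  have hA : ∀ j : ℕ, ∃ A : ℝ, j ≤ n → ∀ z ∈ Metric.closedBall (0 : V) B,
      ‖iteratedFDeriv ℝ j G z‖ ≤ A := by
    intro j
    by_cases hj : j ≤ n
    · obtain ⟨A, hA⟩ := (isCompact_closedBall (0 : V) B).exists_bound_of_continuousOn
        (hG.continuous_iteratedFDeriv (by exact_mod_cast hj)).continuousOn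
      exact ⟨A, fun _ => hA⟩
    · exact ⟨0, fun h => absurd h hj⟩
  choose A hA using hA
  set S := ∑ j ∈ Finset.range (n + 1), |A j| with hS
  have hS0 : 0 ≤ S := Finset.sum_nonneg fun j _ => abs_nonneg _
  refine ⟨n.factorial * S * (max B 1) ^ n, by positivity, fun c hc t hcB => ?_⟩
  rw [← Real.norm_eq_abs, ← norm_iteratedFDeriv_eq_norm_iteratedDeriv]
  refine norm_iteratedFDeriv_comp_le hG hc le_rfl t (fun j hj => ?_) (fun j hj1 hj => ?_)
  · have hmem : c t ∈ Metric.closedBall (0 : V) B := by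
      have := hcB 0 (Nat.zero_le _)
      simpa using this
    refine (hA j hj _ hmem).trans ((le_abs_self _).trans ?_)
    exact Finset.single_le_sum (f := fun j => |A j|) (fun i _ => abs_nonneg _)
      (Finset.mem_range.2 (by omega))
  · rw [norm_iteratedFDeriv_eq_norm_iteratedDeriv]
    refine (hcB j hj).trans ((le_max_left B 1).trans ?_)
    exact le_self_pow₀ (le_max_right B 1) (by omega)

end Smooth

/-! ### Trajectories of the control system -/

variable {r : ℕ}

/-- The control that produces the derivative `v` of the last state component at the state `z`. -/
def BolzaData.controlLaw (P : BolzaData r) (w : (Fin r → ℝ) × ℝ) : ℝ :=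
  (w.2 - P.f w.1) / P.g w.1

/-- The running cost as a function of the state and of the derivative of its last component. -/
def BolzaData.reducedCost (P : BolzaData r) (w : (Fin r → ℝ) × ℝ) : ℝ :=
  P.F (w.1, P.controlLaw w)

/-- A chain of integrators: each component of `z` is the derivative of the one before, and the
continuous function `v` is the derivative of the last one. -/
structure BolzaData.IsTrajectory (P : BolzaData r) (hr : 0 < r) (z : ℝ → Fin r → ℝ)
    (v : ℝ → ℝ) : Prop where
  chain : ∀ (i : ℕ) (h : i + 1 < r),
    IsPrimitive (fun t => z t ⟨i, Nat.lt_of_succ_lt h⟩) (fun t => z t ⟨i + 1, h⟩)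
  last : IsPrimitive (fun t => z t (lastIdx hr)) v
  cont : ContinuousOn v (Set.Icc (-1) 1)
  init : z (-1) = P.initial

lemma contDiff_controlLaw {P : BolzaData r} {n : ℕ} (hg : ∀ z, P.g z ≠ 0)
    (hf : ContDiff ℝ n P.f) (hgm : ContDiff ℝ n P.g) : ContDiff ℝ n P.controlLaw := by
  unfold BolzaData.controlLaw
  exact (contDiff_snd.sub (hf.comp contDiff_fst)).div (hgm.comp contDiff_fst) fun w => hg w.1

lemma contDiff_reducedCost {P : BolzaData r} {n : ℕ} (hg : ∀ z, P.g z ≠ 0)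
    (hF : ContDiff ℝ n P.F) (hf : ContDiff ℝ n P.f) (hgm : ContDiff ℝ n P.g) :
    ContDiff ℝ n P.reducedCost := by
  unfold BolzaData.reducedCost
  exact hF.comp (contDiff_fst.prodMk (contDiff_controlLaw hg hf hgm))

lemma eq_lastIdx (hr : 0 < r) {i : Fin r} (h : ¬ (i : ℕ) + 1 < r) : i = lastIdx hr := by
  ext
  have := i.2
  simp only [lastIdx]
  omega

namespace BolzaData.IsTrajectory

variable {P : BolzaData r} {hr : 0 < r} {z : ℝ → Fin r → ℝ} {v : ℝ → ℝ}

lemma exists_isPrimitive (h : P.IsTrajectory hr z v) (i : Fin r) :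
    ∃ w, IsPrimitive (fun t => z t i) w ∧ (ContinuousOn w (Set.Icc (-1) 1)) ∧
      ∀ t, w t = if h : (i : ℕ) + 1 < r then z t ⟨i + 1, h⟩ else v t := by
  have hc : ∀ j : Fin r, ContinuousOn (fun t => z t j) (Set.Icc (-1) 1) := by
    intro j
    by_cases hj : (j : ℕ) + 1 < r
    · exact (h.chain j hj).continuousOn
    · rw [eq_lastIdx hr hj]; exact h.last.continuousOn
  by_cases hi : (i : ℕ) + 1 < r
  · exact ⟨_, h.chain i hi, hc _, fun t => by rw [dif_pos hi]⟩
  · refine ⟨v, ?_, h.cont, fun t => by rw [dif_neg hi]⟩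
    rw [eq_lastIdx hr hi]
    exact h.last

lemma continuousOn (h : P.IsTrajectory hr z v) : ContinuousOn z (Set.Icc (-1) 1) :=
  continuousOn_pi.2 fun i => by
    obtain ⟨w, hw, -⟩ := h.exists_isPrimitive i
    exact hw.continuousOn

lemma continuousOn_prod (h : P.IsTrajectory hr z v) :
    ContinuousOn (fun t => (z t, v t)) (Set.Icc (-1) 1) := h.continuousOn.prodMk h.cont

/-- Any chain of integrators is an admissible trajectory, since `g` has no zeros. -/
lemma isAdmissible (h : P.IsTrajectory hr z v) (hg : ∀ z, P.g z ≠ 0)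
    (hc : Continuous P.controlLaw) : P.IsAdmissible z fun t => P.controlLaw (z t, v t) where
  control := by
    have hcont : ContinuousOn (fun t => P.controlLaw (z t, v t)) (Set.Icc (-1) 1) :=
      hc.comp_continuousOn h.continuousOn_prod
    obtain ⟨B, hB⟩ := isCompact_Icc.exists_bound_of_continuousOn hcont
    exact memLp_top_of_bound (hcont.aestronglyMeasurable measurableSet_Icc) B
      ((ae_restrict_iff' measurableSet_Icc).2 (Filter.Eventually.of_forall hB))
  absCont i := by
    obtain ⟨w, hw, -⟩ := h.exists_isPrimitive i
    exact hw.absolutelyContinuousOnInterval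
  dynamics := by
    rw [← Measure.restrict_congr_set Ioo_ae_eq_Icc]
    refine (ae_restrict_iff' measurableSet_Ioo).2 (Filter.Eventually.of_forall fun t ht i => ?_)
    obtain ⟨w, hw, hwc, hwe⟩ := h.exists_isPrimitive i
    have e : P.rhs (z t) (P.controlLaw (z t, v t)) i = w t := by
      rw [hwe]
      unfold BolzaData.rhs BolzaData.controlLaw
      split_ifs
      · rfl
      · rw [mul_div_cancel₀ _ (hg _)]; ring
    rw [e]
    exact hw.hasDerivAt hwc ht
  init := h.init

lemma cost_eq (h : P.IsTrajectory hr z v) :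
    P.cost z (fun t => P.controlLaw (z t, v t)) =
      (∫ t in (-1 : ℝ)..1, P.reducedCost (z t, v t)) + P.E (P.initial, z 1) := by
  unfold BolzaData.cost
  rw [h.init]
  rfl

/-- The reflection of a trajectory at another one. -/
lemma reflect (h : P.IsTrajectory hr z v) {z' : ℝ → Fin r → ℝ} {v' : ℝ → ℝ}
    (h' : P.IsTrajectory hr z' v') :
    P.IsTrajectory hr (fun t i => 2 * z t i - z' t i) (fun t => 2 * v t - v' t) where
  chain i hi := ((h.chain i hi).const_mul 2).sub (h'.chain i hi)
  last := (h.last.const_mul 2).sub h'.last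
  cont := (continuousOn_const.mul h.cont).sub h'.cont
  init := by
    funext i
    rw [h.init, h'.init]
    ring

end BolzaData.IsTrajectory

/-- An admissible state whose last component is continuously differentiable is a chain of
integrators. -/
lemma BolzaData.IsAdmissible.isTrajectory {P : BolzaData r} {hr : 0 < r} {x : ℝ → Fin r → ℝ}
    {u : ℝ → ℝ} (h : P.IsAdmissible x u) {m : ℕ} (hm : 2 ≤ m) {y : ℕ → ℝ → ℝ}
    (hy : IsDerivFamily m (fun t => x t (lastIdx hr)) y) : P.IsTrajectory hr x (y 1) := by
  have hc : ∀ i, ContinuousOn (fun t => x t i) (Set.Icc (-1) 1) := fun i => by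
    have := (h.absCont i).continuousOn
    rwa [Set.uIcc_of_le (by norm_num)] at this
  refine ⟨fun i hi => ?_, ?_, hy.cont 1 (by omega), h.init⟩
  · refine isPrimitive_of_absolutelyContinuousOnInterval (h.absCont _)
      (ContinuousOn.intervalIntegrable_Icc (hc _)) ?_
    filter_upwards [h.dynamics] with t ht
    have := ht ⟨i, Nat.lt_of_succ_lt hi⟩
    rwa [BolzaData.rhs, dif_pos hi] at this
  · exact (hy.isPrimitive (by omega)).congr (hy.eq_zeroth (by omega) (hc _))

/-- The control of such an admissible pair agrees almost everywhere with a continuous one. -/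
lemma BolzaData.IsAdmissible.control_ae_eq {P : BolzaData r} {hr : 0 < r} {x : ℝ → Fin r → ℝ}
    {u v : ℝ → ℝ} (h : P.IsAdmissible x u) (hg : ∀ z, P.g z ≠ 0) (ht : P.IsTrajectory hr x v) :
    ∀ᵐ t ∂(volume.restrict (Set.Icc (-1 : ℝ) 1)), u t = P.controlLaw (x t, v t) := by
  have hdyn := h.dynamics
  rw [← Measure.restrict_congr_set Ioo_ae_eq_Icc] at hdyn ⊢
  filter_upwards [hdyn, ae_restrict_mem measurableSet_Ioo] with t h1 h2
  have h3 := h1 (lastIdx hr)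
  have h4 := ht.last.hasDerivAt ht.cont h2
  have h5 := h3.unique h4
  have hlt : ¬ ((lastIdx hr : Fin r) : ℕ) + 1 < r := by simp only [lastIdx]; omega
  rw [BolzaData.rhs, dif_neg hlt] at h5
  unfold BolzaData.controlLaw
  rw [eq_div_iff (hg _), ← h5]
  ring

lemma BolzaData.IsAdmissible.cost_eq {P : BolzaData r} {hr : 0 < r} {x : ℝ → Fin r → ℝ}
    {u v : ℝ → ℝ} (h : P.IsAdmissible x u) (hg : ∀ z, P.g z ≠ 0) (ht : P.IsTrajectory hr x v) :
    P.cost x u = P.cost x fun t => P.controlLaw (x t, v t) := by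
  unfold BolzaData.cost
  congr 1
  refine intervalIntegral.integral_congr_ae ?_
  filter_upwards [(ae_restrict_iff' measurableSet_Icc).1 (h.control_ae_eq hg ht)] with t h1 h2
  rw [Set.uIoc_of_le (by norm_num)] at h2
  rw [h1 (Set.Ioc_subset_Icc_self h2)]

/-- Near an optimal trajectory the cost grows at most quadratically. The cost of the reflected
trajectory is not below the optimal cost either, so that the excess cost is at most the second
difference of the cost. -/
lemma exists_cost_sub_le {P : BolzaData r} {hr : 0 < r} (hg : ∀ z, P.g z ≠ 0)
    (hF : ContDiff ℝ 2 P.F) (hf : ContDiff ℝ 2 P.f) (hgm : ContDiff ℝ 2 P.g)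
    (hE : ContDiff ℝ 2 fun z => P.E (P.initial, z)) {x : ℝ → Fin r → ℝ} {u v : ℝ → ℝ}
    (hopt : P.IsOptimal x u) (hx : P.IsTrajectory hr x v) :
    ∃ K : ℝ, 0 ≤ K ∧ ∀ (z : ℝ → Fin r → ℝ) (w : ℝ → ℝ) (e : ℝ), P.IsTrajectory hr z w → e ≤ 1 →
      (∀ t ∈ Set.Icc (-1 : ℝ) 1, ‖(z t, w t) - (x t, v t)‖ ≤ e) →
      P.cost z (fun t => P.controlLaw (z t, w t)) - P.cost x u ≤ K * e ^ 2 := by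
  have hcl : Continuous P.controlLaw := (contDiff_controlLaw (n := 2) hg hf hgm).continuous
  have hred : ContDiff ℝ 2 P.reducedCost := contDiff_reducedCost (n := 2) hg hF hf hgm
  obtain ⟨R, hR⟩ := isCompact_Icc.exists_bound_of_continuousOn hx.continuousOn_prod
  obtain ⟨K₁, hK₁, h₁⟩ := exists_second_difference_bound hred R
  obtain ⟨K₂, hK₂, h₂⟩ := exists_second_difference_bound hE R
  refine ⟨2 * K₁ + K₂, by positivity, fun z w e hz he hclose => ?_⟩
  have hrefl := hx.reflect hz
  have hmin := hopt.2 _ _ (hrefl.isAdmissible hg hcl)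
  rw [hopt.1.cost_eq hg hx, hrefl.cost_eq, hx.cost_eq] at hmin
  rw [hopt.1.cost_eq hg hx, hz.cost_eq, hx.cost_eq]
  have he0 : 0 ≤ e := (norm_nonneg _).trans (hclose 0 (by simp))
  have i : ∀ {z : ℝ → Fin r → ℝ} {v : ℝ → ℝ}, P.IsTrajectory hr z v →
      IntervalIntegrable (fun t => P.reducedCost (z t, v t)) volume (-1) 1 := fun h =>
    ContinuousOn.intervalIntegrable_Icc (hred.continuous.comp_continuousOn h.continuousOn_prod)
  have hEd : P.E (P.initial, z 1) + P.E (P.initial, fun i => 2 * x 1 i - z 1 i) -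
      2 * P.E (P.initial, x 1) ≤ K₂ * e ^ 2 := by
    have hb : ‖z 1 - x 1‖ ≤ e := (norm_fst_le _).trans (hclose 1 (by simp))
    have := h₂ (x 1) (z 1 - x 1) ((norm_fst_le (x 1, v 1)).trans (hR 1 (by simp))) (hb.trans he)
    rw [add_sub_cancel, show x 1 - (z 1 - x 1) = fun i => 2 * x 1 i - z 1 i by
      funext i; simp only [Pi.sub_apply]; ring] at this
    exact this.trans (by gcongr)
  have hId : (∫ t in (-1 : ℝ)..1, P.reducedCost (z t, w t)) +
      (∫ t in (-1 : ℝ)..1, P.reducedCost (fun i => 2 * x t i - z t i, 2 * v t - w t)) -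
      2 * (∫ t in (-1 : ℝ)..1, P.reducedCost (x t, v t)) ≤ 2 * (K₁ * e ^ 2) := by
    rw [← intervalIntegral.integral_const_mul,
      ← intervalIntegral.integral_add (i hz) (i hrefl),
      ← intervalIntegral.integral_sub ((i hz).add (i hrefl)) ((i hx).const_mul 2)]
    have hle := intervalIntegral.integral_mono_on (a := (-1 : ℝ)) (b := 1) (by norm_num)
      (((i hz).add (i hrefl)).sub ((i hx).const_mul 2))
      (intervalIntegrable_const (c := K₁ * e ^ 2)) (fun t ht => by
        have := h₁ (x t, v t) ((z t, w t) - (x t, v t)) (hR t ht) ((hclose t ht).trans he)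
        rw [add_sub_cancel, show (x t, v t) - ((z t, w t) - (x t, v t)) =
            (fun i => 2 * x t i - z t i, 2 * v t - w t) by
          ext i
          · simp only [Prod.fst_sub, Pi.sub_apply]; ring
          · simp only [Prod.snd_sub]; ring] at this
        have h3 : K₁ * ‖(z t, w t) - (x t, v t)‖ ^ 2 ≤ K₁ * e ^ 2 := by
          gcongr
          exact hclose t ht
        exact this.trans h3)
    refine hle.trans (le_of_eq ?_)
    rw [intervalIntegral.integral_const]
    norm_num
  linarith

/-! ### Polynomial trajectories and their nodal values -/

/-- The trajectory whose first state component is the polynomial `Q`, together with the derivative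
of its last state component. -/
def polyCurve (r : ℕ) (Q : Polynomial ℝ) (t : ℝ) : (Fin r → ℝ) × ℝ :=
  (fun i => (Polynomial.derivative^[(i : ℕ)] Q).eval t, (Polynomial.derivative^[r] Q).eval t)

lemma hasDerivAt_polyCurve (Q : Polynomial ℝ) (t : ℝ) :
    HasDerivAt (polyCurve r Q) (polyCurve r (Polynomial.derivative Q) t) t := by
  have h : ∀ j : ℕ, HasDerivAt (fun t => (Polynomial.derivative^[j] Q).eval t)
      ((Polynomial.derivative^[j] (Polynomial.derivative Q)).eval t) t := fun j => by
    rw [← Function.iterate_succ_apply, Function.iterate_succ_apply']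
    exact Polynomial.hasDerivAt _ _
  exact (hasDerivAt_pi.2 fun i : Fin r => h i).prodMk (h r)

lemma iteratedDeriv_polyCurve (Q : Polynomial ℝ) (j : ℕ) :
    iteratedDeriv j (polyCurve r Q) = polyCurve r (Polynomial.derivative^[j] Q) := by
  induction j with
  | zero => simp
  | succ j ih =>
    rw [iteratedDeriv_succ, ih, Function.iterate_succ_apply']
    exact funext fun t => (hasDerivAt_polyCurve _ t).deriv

lemma contDiff_polyCurve (Q : Polynomial ℝ) (n : ℕ) : ContDiff ℝ n (polyCurve r Q) :=
  have h : ∀ p : Polynomial ℝ, ContDiff ℝ n fun t => p.eval t := fun p => by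
    simpa [Polynomial.aeval_def, Polynomial.eval₂_eq_eval_map] using
      Polynomial.contDiff_aeval (𝕜 := ℝ) p n
  (contDiff_pi.2 fun _ => h _).prodMk (h _)

lemma norm_polyCurve_iterate_le {Q : Polynomial ℝ} {j n : ℕ} {t B : ℝ} (hB : 0 ≤ B)
    (h : ∀ i ≤ n, |(Polynomial.derivative^[i] Q).eval t| ≤ B) (hj : j + r ≤ n) :
    ‖polyCurve r (Polynomial.derivative^[j] Q) t‖ ≤ B := by
  refine max_le ((pi_norm_le_iff_of_nonneg hB).2 fun i => ?_) ?_
  · have := i.2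
    simp only [polyCurve, ← Function.iterate_add_apply]
    exact h _ (by omega)
  · simp only [polyCurve, ← Function.iterate_add_apply]
    exact h _ (by omega)

lemma isTrajectory_polyCurve (P : BolzaData r) (hr : 0 < r) {Q : Polynomial ℝ}
    (h0 : (polyCurve r Q (-1)).1 = P.initial) :
    P.IsTrajectory hr (fun t => (polyCurve r Q t).1) fun t => (polyCurve r Q t).2 where
  chain i hi := by
    simp only [polyCurve, Function.iterate_succ_apply']
    exact isPrimitive_poly _
  last := by
    have e : r = (r - 1) + 1 := by omega
    have := isPrimitive_poly (Polynomial.derivative^[r - 1] Q)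
    rw [← Function.iterate_succ_apply' Polynomial.derivative, Nat.succ_eq_add_one, ← e] at this
    exact this
  cont := (Polynomial.continuous _).continuousOn
  init := h0

/-- A polynomial is bounded on `[-1, 1]`, together with its derivatives, by its initial values and
a bound for its highest derivative considered. -/
lemma abs_iterate_derivative_le {Q : Polynomial ℝ} {s : ℕ} {A B : ℝ} (hA : 0 ≤ A)
    (h0 : ∀ j < s, |(Polynomial.derivative^[j] Q).eval (-1)| ≤ A)
    (h1 : ∀ t ∈ Set.Icc (-1 : ℝ) 1, |(Polynomial.derivative^[s] Q).eval t| ≤ B) :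
    ∀ j ≤ s, ∀ t ∈ Set.Icc (-1 : ℝ) 1,
      |(Polynomial.derivative^[j] Q).eval t| ≤ 3 ^ s * (A + B) := by
  have hB : 0 ≤ B := (abs_nonneg _).trans (h1 0 (by simp))
  have key : ∀ k ≤ s, ∀ t ∈ Set.Icc (-1 : ℝ) 1,
      |(Polynomial.derivative^[s - k] Q).eval t| ≤ 3 ^ k * (A + B) := by
    intro k
    induction k with
    | zero => intro _ t ht; simpa using (h1 t ht).trans (by linarith)
    | succ k ih =>
      intro hk t ht
      have hp := isPrimitive_poly (Polynomial.derivative^[s - (k + 1)] Q)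
      rw [← Function.iterate_succ_apply' Polynomial.derivative, Nat.succ_eq_add_one,
        show s - (k + 1) + 1 = s - k by omega] at hp
      refine (hp.abs_le (ih (by omega)) ht).trans ?_
      have e : A + B ≤ 3 ^ k * (A + B) :=
        le_mul_of_one_le_left (by positivity) (one_le_pow₀ (by norm_num))
      have := h0 (s - (k + 1)) (by omega)
      rw [pow_succ]
      linarith
  intro j hj t ht
  have h := key (s - j) (by omega) t ht
  rw [show s - (s - j) = j by omega] at h
  refine h.trans ?_
  gcongr
  · norm_num
  · omega

/-- `X` and `U` are the values at the nodes of the states and controls along the polynomial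
trajectory given by `Q`. -/
structure BolzaData.IsNodal (P : BolzaData r) {N : ℕ} (Q : Polynomial ℝ)
    (X : Fin (N + 1) → Fin r → ℝ) (U : Fin (N + 1) → ℝ) : Prop where
  degree : Q.natDegree ≤ N
  state : ∀ k, X k = (polyCurve r Q (node N k)).1
  control : ∀ k, U k = P.controlLaw (polyCurve r Q (node N k))

namespace BolzaData.IsNodal

variable {P : BolzaData r} {N : ℕ} {Q : Polynomial ℝ} {X : Fin (N + 1) → Fin r → ℝ}
  {U : Fin (N + 1) → ℝ}

lemma natDegree_iterate (h : P.IsNodal Q X U) (j : ℕ) :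
    (Polynomial.derivative^[j] Q).natDegree ≤ N - j :=
  (Polynomial.natDegree_iterate_derivative _ _).trans (Nat.sub_le_sub_right h.degree _)

lemma interpPoly_eq (hN : 1 ≤ N) (h : P.IsNodal Q X U) (i : Fin r) :
    interpPoly X i = Polynomial.derivative^[(i : ℕ)] Q := by
  symm
  refine Lagrange.eq_interpolate_of_eval_eq _ (node_injective hN).injOn ?_ fun k _ => ?_
  · refine lt_of_le_of_lt Polynomial.degree_le_natDegree ?_
    have := h.natDegree_iterate (i : ℕ)
    rw [Finset.card_univ, Fintype.card_fin]
    exact_mod_cast (by omega : (Polynomial.derivative^[(i : ℕ)] Q).natDegree < N + 1)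
  · rw [h.state k]
    rfl

lemma interpState_eq (hN : 1 ≤ N) (h : P.IsNodal Q X U) (t : ℝ) :
    interpState X t = (polyCurve r Q t).1 := by
  funext i
  rw [interpState, h.interpPoly_eq hN]
  rfl

lemma interpControl_eq (hN : 1 ≤ N) (hr : 0 < r) (h : P.IsNodal Q X U) (t : ℝ) :
    P.interpControl hr X t = P.controlLaw (polyCurve r Q t) := by
  unfold BolzaData.interpControl BolzaData.controlLaw
  rw [h.interpState_eq hN, h.interpPoly_eq hN, ← Function.iterate_succ_apply' Polynomial.derivative]
  have e : Nat.succ (lastIdx hr : Fin r) = r := by simp only [lastIdx]; omega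
  rw [e]
  rfl

lemma pow_mulVec (hN : 1 ≤ N) (h : P.IsNodal Q X U) (i : Fin r) (j : ℕ) :
    (diffMatrix N ^ j).mulVec (fun k => X k i) =
      fun k => (Polynomial.derivative^[j + i] Q).eval (node N k) := by
  have e : (fun k => X k i) = fun k => (Polynomial.derivative^[(i : ℕ)] Q).eval (node N k) :=
    funext fun k => by rw [h.state k]; rfl
  rw [e, diffMatrix_pow_mulVec hN ((h.natDegree_iterate _).trans (Nat.sub_le _ _)),
    ← Function.iterate_add_apply]

lemma spectralCoeff_eq (hN : 1 ≤ N) (hr : 0 < r) (h : P.IsNodal Q X U) {m₁ n : ℕ} (hm₁ : 1 ≤ m₁)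
    (hn : n < N + 2 - r - m₁) :
    spectralCoeff N m₁ (fun k => X k (lastIdx hr)) n =
      legCoeff (fun t => (Polynomial.derivative^[m₁ + (r - 1)] Q).eval t) n := by
  have hd := h.natDegree_iterate (m₁ + (r - 1))
  have hL := natDegree_legendre_le n
  have hq := integral_eq_sum_weight hN
    (p := Polynomial.derivative^[m₁ + (r - 1)] Q * legendre n)
    (Polynomial.natDegree_mul_le.trans (by omega))
  unfold spectralCoeff legCoeff
  simp only [Polynomial.eval_mul] at hq
  rw [hq, h.pow_mulVec hN]
  congr 1
  refine Finset.sum_congr rfl fun k _ => ?_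
  simp only [lastIdx]
  ring

lemma init_eq (hN : 1 ≤ N) (h : P.IsNodal Q X U) : X 0 = (polyCurve r Q (-1)).1 := by
  rw [h.state, node_zero hN]

lemma discreteCost_eq (hN : 1 ≤ N) (h : P.IsNodal Q X U) :
    P.discreteCost X U = ∑ k, P.reducedCost (polyCurve r Q (node N k)) * weight N k +
      P.E ((polyCurve r Q (-1)).1, (polyCurve r Q 1).1) := by
  unfold BolzaData.discreteCost BolzaData.reducedCost
  congr 1
  · exact Finset.sum_congr rfl fun k _ => by rw [h.control, h.state]
  · rw [h.state, h.state, node_zero hN, node_last hN]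

lemma cost_eq (hN : 1 ≤ N) (hr : 0 < r) (h : P.IsNodal Q X U) :
    P.cost (interpState X) (P.interpControl hr X) =
      P.cost (fun t => (polyCurve r Q t).1) fun t => P.controlLaw (polyCurve r Q t) := by
  rw [funext (h.interpState_eq hN), funext (h.interpControl_eq hN hr)]

/-- The feasibility conditions of the discretized problem, in terms of the interpolating
polynomial. -/
lemma isDiscreteFeasible (hN : 1 ≤ N) (hr : 0 < r) (hg : ∀ z, P.g z ≠ 0) (h : P.IsNodal Q X U)
    {b : SearchBounds r} {m₁ : ℕ} (hm₁ : 1 ≤ m₁) (h0 : (polyCurve r Q (-1)).1 = P.initial)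
    (hs : ∀ t ∈ Set.Icc (-1 : ℝ) 1, ∀ i,
      b.stateLow i ≤ (polyCurve r Q t).1 i ∧ (polyCurve r Q t).1 i ≤ b.stateUp i)
    (hc : ∀ t ∈ Set.Icc (-1 : ℝ) 1, b.controlLow ≤ P.controlLaw (polyCurve r Q t) ∧
      P.controlLaw (polyCurve r Q t) ≤ b.controlUp)
    (hd : ∀ j, 1 ≤ j → j < m₁ →
      b.derivLow j ≤ (Polynomial.derivative^[j + (r - 1)] Q).eval (-1) ∧
        (Polynomial.derivative^[j + (r - 1)] Q).eval (-1) ≤ b.derivUp j)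
    (hl : ∑ n ∈ Finset.range (N + 2 - r - m₁),
      |legCoeff (fun t => (Polynomial.derivative^[m₁ + (r - 1)] Q).eval t) n| ≤ b.spectral) :
    P.IsDiscreteFeasible hr b m₁ N X U where
  dynamics k i := by
    have := congrFun (h.pow_mulVec hN i 1) k
    rw [pow_one] at this
    rw [this]
    unfold BolzaData.rhs
    split_ifs with hi
    · rw [h.state k, add_comm]
      rfl
    · have e : 1 + (i : ℕ) = r := by omega
      rw [e, h.control k, h.state k, BolzaData.controlLaw, mul_div_cancel₀ _ (hg _)]
      simp only [polyCurve]
      ring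
  init := by rw [h.init_eq hN, h0]
  state k i := by
    rw [h.state k]
    exact hs _ (node_mem_Icc hN k) i
  control k := by
    rw [h.control k]
    exact hc _ (node_mem_Icc hN k)
  deriv j h1 h2 := by
    rw [h.pow_mulVec hN]
    simp only [node_zero hN, lastIdx]
    exact hd j h1 h2
  spectral := by
    refine le_trans (le_of_eq (Finset.sum_congr rfl fun n hn => ?_)) hl
    rw [h.spectralCoeff_eq hN hr hm₁ (Finset.mem_range.1 hn)]

end BolzaData.IsNodal

/-- Discrete solutions are the nodal values of polynomial trajectories, since the differentiation
matrix is exact on polynomials. -/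
lemma BolzaData.IsDiscreteFeasible.exists_isNodal {P : BolzaData r} {hr : 0 < r} {N m₁ : ℕ}
    (hN : 1 ≤ N) (hg : ∀ z, P.g z ≠ 0) {b : SearchBounds r} {X : Fin (N + 1) → Fin r → ℝ}
    {U : Fin (N + 1) → ℝ} (h : P.IsDiscreteFeasible hr b m₁ N X U) :
    ∃ Q, P.IsNodal Q X U := by
  have hinj := (node_injective hN).injOn (s := ((Finset.univ : Finset (Fin (N + 1))) : Set _))
  have hdeg : ∀ i, (interpPoly X i).degree < (Finset.univ : Finset (Fin (N + 1))).card :=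
    fun i => Lagrange.degree_interpolate_lt _ hinj
  have hnat : ∀ i, (interpPoly X i).natDegree ≤ N := fun i => by
    refine Polynomial.natDegree_le_of_degree_le (Order.le_of_lt_succ ?_)
    have := hdeg i
    rwa [Finset.card_univ, Fintype.card_fin] at this
  have heval : ∀ i k, (interpPoly X i).eval (node N k) = X k i := fun i k =>
    Lagrange.eval_interpolate_at_node _ hinj (Finset.mem_univ k)
  have hder : ∀ i k, (Polynomial.derivative (interpPoly X i)).eval (node N k) =
      P.rhs (X k) (U k) i := fun i k => by
    rw [← h.dynamics k i, ← funext (heval i), diffMatrix_mulVec hN (hnat i)]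
  have hstep : ∀ (i : ℕ) (hi : i + 1 < r),
      Polynomial.derivative (interpPoly X ⟨i, Nat.lt_of_succ_lt hi⟩) = interpPoly X ⟨i + 1, hi⟩ := by
    intro i hi
    refine Polynomial.eq_of_degrees_lt_of_eval_index_eq Finset.univ hinj
      (Polynomial.degree_derivative_le.trans_lt (hdeg _)) (hdeg _) fun k _ => ?_
    rw [hder, heval, BolzaData.rhs, dif_pos hi]
  have hit : ∀ (i : ℕ) (hi : i < r),
      Polynomial.derivative^[i] (interpPoly X ⟨0, hr⟩) = interpPoly X ⟨i, hi⟩ := by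
    intro i
    induction i with
    | zero => intro hi; rfl
    | succ i ih =>
      intro hi
      rw [Function.iterate_succ_apply', ih (by omega), hstep]
  have hst : ∀ k, X k = (polyCurve r (interpPoly X ⟨0, hr⟩) (node N k)).1 := fun k => by
    funext i
    simp only [polyCurve]
    rw [hit i i.2, heval]
  refine ⟨interpPoly X ⟨0, hr⟩, hnat _, hst, fun k => ?_⟩
  have e : (polyCurve r (interpPoly X ⟨0, hr⟩) (node N k)).2 = P.f (X k) + P.g (X k) * U k := by
    have h1 := hder (lastIdx hr) k
    have hlt : ¬ ((lastIdx hr : Fin r) : ℕ) + 1 < r := by simp only [lastIdx]; omega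
    rw [BolzaData.rhs, dif_neg hlt, lastIdx, ← hit _ (Nat.sub_lt hr Nat.one_pos),
      ← Function.iterate_succ_apply' Polynomial.derivative, Nat.succ_eq_add_one,
      Nat.sub_add_cancel hr] at h1
    exact h1
  rw [BolzaData.controlLaw, e, ← hst k, add_sub_cancel_left, mul_div_cancel_left₀ _ (hg _)]

/-! ### Discrete cost and continuous cost -/

/-- The derivatives of the polynomials interpolating discrete solutions are bounded uniformly in
the number of nodes: the spectral constraint bounds the one of the highest order, and the other
constraints bound the initial values. -/
lemma exists_bound_of_isDiscreteFeasible (P : BolzaData r) (hr : 0 < r) (b : SearchBounds r)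
    {m₁ : ℕ} (hm₁ : 1 ≤ m₁) : ∃ B : ℝ, 0 ≤ B ∧ ∀ N : ℕ, 1 ≤ N → m₁ + (r - 1) ≤ N →
      ∀ (Q : Polynomial ℝ) (X : Fin (N + 1) → Fin r → ℝ) (U : Fin (N + 1) → ℝ),
        P.IsNodal Q X U → P.IsDiscreteFeasible hr b m₁ N X U →
          ∀ j ≤ m₁ + (r - 1), ∀ t ∈ Set.Icc (-1 : ℝ) 1,
            |(Polynomial.derivative^[j] Q).eval t| ≤ B := by
  -- `A` bounds the initial values of all derivatives of order less than `m₁ + (r - 1)`.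
  set A : ℝ := ‖P.initial‖ + ∑ j ∈ Finset.range m₁, (|b.derivLow j| + |b.derivUp j|) with hA
  have hsum : ∀ j < m₁, |b.derivLow j| + |b.derivUp j| ≤
      ∑ j ∈ Finset.range m₁, (|b.derivLow j| + |b.derivUp j|) := fun j hj =>
    Finset.single_le_sum (f := fun j => |b.derivLow j| + |b.derivUp j|)
      (fun i _ => by positivity) (Finset.mem_range.2 hj)
  have hS0 : 0 ≤ ∑ j ∈ Finset.range m₁, (|b.derivLow j| + |b.derivUp j|) :=
    Finset.sum_nonneg fun j _ => by positivity
  have hA0 : 0 ≤ A := by positivity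
  refine ⟨3 ^ (m₁ + (r - 1)) * (A + |b.spectral|), by positivity, fun N hN hsN Q X U hQ hX => ?_⟩
  refine abs_iterate_derivative_le hA0 (fun j hj => ?_) fun t ht => ?_
  · by_cases hjr : j < r
    · have h1 : (Polynomial.derivative^[j] Q).eval (-1) = P.initial ⟨j, hjr⟩ := by
        rw [← hX.init, hQ.init_eq hN]
        rfl
      rw [h1]
      have := norm_le_pi_norm P.initial ⟨j, hjr⟩
      rw [Real.norm_eq_abs] at this
      linarith
    · obtain ⟨i, rfl⟩ : ∃ i, j = i + (r - 1) := ⟨j - (r - 1), by omega⟩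
      have hi : i < m₁ := by omega
      have h1 := hX.deriv i (by omega) hi
      rw [hQ.pow_mulVec hN] at h1
      simp only [node_zero hN, lastIdx] at h1
      have h2 := hsum i hi
      refine (abs_le_max_abs_abs h1.1 h1.2).trans (max_le ?_ ?_) <;>
        linarith [abs_nonneg (b.derivLow i), abs_nonneg (b.derivUp i), norm_nonneg P.initial]
  · have h1 := hX.spectral
    rw [Finset.sum_congr rfl fun n hn => by
      rw [hQ.spectralCoeff_eq hN hr hm₁ (Finset.mem_range.1 hn)]] at h1
    rw [eval_eq_sum_legCoeff (hQ.natDegree_iterate _) t]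
    refine (Finset.abs_sum_le_sum_abs _ _).trans (le_trans ?_ (h1.trans (le_abs_self _)))
    rw [show N - (m₁ + (r - 1)) + 1 = N + 2 - r - m₁ by omega]
    refine Finset.sum_le_sum fun n _ => ?_
    rw [abs_mul]
    exact mul_le_of_le_one_right (abs_nonneg _) (abs_eval_legendre_le_one n ht)

/-- For discrete solutions, the discrete cost is close to the cost of the interpolated pair: the
running cost along it has derivatives of order `m₁ - 1` bounded uniformly in `N`. -/
lemma exists_abs_cost_sub_discreteCost_le (P : BolzaData r) (hr : 0 < r) (hg : ∀ z, P.g z ≠ 0)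
    (b : SearchBounds r) {k : ℕ} (hF : ContDiff ℝ k P.F) (hf : ContDiff ℝ k P.f)
    (hgm : ContDiff ℝ k P.g) : ∃ K : ℝ, 0 ≤ K ∧ ∀ N : ℕ, 1 ≤ N → k + r ≤ N →
      ∀ (X : Fin (N + 1) → Fin r → ℝ) (U : Fin (N + 1) → ℝ),
        P.IsDiscreteFeasible hr b (k + 1) N X U →
          |P.cost (interpState X) (P.interpControl hr X) - P.discreteCost X U| ≤
            K / (N : ℝ) ^ k := by
  obtain ⟨B, hB0, hB⟩ := exists_bound_of_isDiscreteFeasible P hr b (m₁ := k + 1) (by omega)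
  obtain ⟨K, hK0, hK⟩ := exists_iteratedDeriv_comp_bound (contDiff_reducedCost hg hF hf hgm) B
  refine ⟨4 * (4 ^ k * K), by positivity, fun N hN hkN X U hX => ?_⟩
  obtain ⟨Q, hQ⟩ := hX.exists_isNodal hN hg
  have hinit : (polyCurve r Q (-1)).1 = P.initial := by rw [← hQ.init_eq hN, hX.init]
  have hbd := hB N hN (by omega) Q X U hQ hX
  have hq := abs_integral_sub_quadrature_le hN (by omega : k ≤ N)
    (f := P.reducedCost ∘ polyCurve r Q)
    ((contDiff_reducedCost hg hF hf hgm).comp (contDiff_polyCurve Q k)) (M := K) fun t ht => by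
      refine hK _ (contDiff_polyCurve Q k) t fun j hj => ?_
      rw [iteratedDeriv_polyCurve]
      exact norm_polyCurve_iterate_le hB0 (fun i hi => hbd i hi t ht) (by omega)
  rw [hQ.cost_eq hN hr, hQ.discreteCost_eq hN, (isTrajectory_polyCurve P hr hinit).cost_eq, hinit,
    add_sub_add_right_eq_sub]
  refine hq.trans (le_of_eq ?_)
  rw [div_pow]
  ring

/-! ### Feasible approximations of the optimal trajectory -/

/-- Iterated primitives of an approximation of the last member of a chain of primitives, with the
same initial values. -/
lemma exists_poly_iterated_primitive : ∀ (s : ℕ) (Y : ℕ → ℝ → ℝ),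
    (∀ j < s, IsPrimitive (Y j) (Y (j + 1))) → ∀ (S : Polynomial ℝ) (e : ℝ),
      (∀ t ∈ Set.Icc (-1 : ℝ) 1, |S.eval t - Y s t| ≤ e) →
        ∃ Q : Polynomial ℝ, Polynomial.derivative^[s] Q = S ∧ Q.natDegree ≤ S.natDegree + s ∧
          (∀ j < s, (Polynomial.derivative^[j] Q).eval (-1) = Y j (-1)) ∧
          ∀ j ≤ s, ∀ t ∈ Set.Icc (-1 : ℝ) 1,
            |(Polynomial.derivative^[j] Q).eval t - Y j t| ≤ 2 ^ s * e := by
  intro s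
  induction s with
  | zero =>
    intro Y _ S e he
    refine ⟨S, rfl, le_rfl, fun j hj => absurd hj (by omega), fun j hj t ht => ?_⟩
    obtain rfl : j = 0 := by omega
    simpa using he t ht
  | succ s ih =>
    intro Y hY S e he
    have he0 : 0 ≤ e := (abs_nonneg _).trans (he 0 (by simp))
    obtain ⟨S', h1, h2, h3⟩ := exists_poly_primitive S (Y s (-1))
    have hS' : ∀ t ∈ Set.Icc (-1 : ℝ) 1, |S'.eval t - Y s t| ≤ 2 * e := fun t ht => by
      have hp := isPrimitive_poly S'
      rw [h1] at hp
      have := (hp.sub (hY s (by omega))).abs_le he ht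
      simpa [h2] using this
    obtain ⟨Q, a1, a2, a3, a4⟩ := ih Y (fun j hj => hY j (by omega)) S' (2 * e) hS'
    have hQ : Polynomial.derivative^[s + 1] Q = S := by
      rw [Function.iterate_succ_apply', a1, h1]
    refine ⟨Q, hQ, by omega, fun j hj => ?_, fun j hj t ht => ?_⟩
    · rcases Nat.lt_succ_iff_lt_or_eq.1 hj with h | rfl
      · exact a3 j h
      · rw [a1, h2]
    · rcases Nat.le_succ_iff.1 hj with h | rfl
      · exact (a4 j h t ht).trans (le_of_eq (by ring))
      · rw [hQ]
        exact (he t ht).trans (le_mul_of_one_le_left he0 (one_le_pow₀ (by norm_num)))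

/-- The derivatives of the first state component along a trajectory `x`, where `y j` is the `j`-th
derivative of the last state component. -/
def stateDeriv (x : ℝ → Fin r → ℝ) (y : ℕ → ℝ → ℝ) (j : ℕ) (t : ℝ) : ℝ :=
  if h : j < r then x t ⟨j, h⟩ else y (j + 1 - r) t

lemma isPrimitive_stateDeriv {P : BolzaData r} {hr : 0 < r} {x : ℝ → Fin r → ℝ} {y : ℕ → ℝ → ℝ}
    {m : ℕ} (hx : P.IsTrajectory hr x (y 1)) (hy : ∀ j < m, IsPrimitive (y j) (y (j + 1))) {j : ℕ}
    (hj : j + 1 < m + r) : IsPrimitive (stateDeriv x y j) (stateDeriv x y (j + 1)) := by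
  unfold stateDeriv
  by_cases h1 : j + 1 < r
  · simp only [dif_pos h1, dif_pos (Nat.lt_of_succ_lt h1)]
    exact hx.chain j h1
  · simp only [dif_neg h1]
    by_cases h2 : j < r
    · simp only [dif_pos h2]
      rw [show j + 1 + 1 - r = 1 by omega]
      have := hx.last
      rwa [show lastIdx hr = ⟨j, h2⟩ by ext; simp only [lastIdx]; omega] at this
    · simp only [dif_neg h2]
      rw [show j + 1 + 1 - r = (j + 1 - r) + 1 by omega]
      exact hy _ (by omega)

lemma norm_polyCurve_sub_le {Q : Polynomial ℝ} {x : ℝ → Fin r → ℝ} {y : ℕ → ℝ → ℝ} {t e : ℝ}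
    (he : 0 ≤ e) (h : ∀ j ≤ r, |(Polynomial.derivative^[j] Q).eval t - stateDeriv x y j t| ≤ e) :
    ‖polyCurve r Q t - (x t, y 1 t)‖ ≤ e := by
  refine max_le ((pi_norm_le_iff_of_nonneg he).2 fun i => ?_) ?_
  · have := h i i.2.le
    rwa [stateDeriv, dif_pos i.2] at this
  · have := h r le_rfl
    rwa [stateDeriv, dif_neg (lt_irrefl r), Nat.add_sub_cancel_left] at this

/-- Curves close to a trajectory in the interior of the search region satisfy the box
constraints. -/
lemma exists_margin {P : BolzaData r} {hr : 0 < r} (hcl : Continuous P.controlLaw)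
    {b : SearchBounds r} {x : ℝ → Fin r → ℝ} {u v : ℝ → ℝ} (hx : P.IsTrajectory hr x v)
    (hu : ∀ᵐ t ∂(volume.restrict (Set.Icc (-1 : ℝ) 1)), u t = P.controlLaw (x t, v t))
    (hs : ∀ t ∈ Set.Icc (-1 : ℝ) 1, ∀ i, b.stateLow i < x t i ∧ x t i < b.stateUp i)
    (hc : ∃ η > 0, ∀ᵐ t ∂(volume.restrict (Set.Icc (-1 : ℝ) 1)),
      b.controlLow + η ≤ u t ∧ u t ≤ b.controlUp - η) :
    ∃ η > 0, ∀ t ∈ Set.Icc (-1 : ℝ) 1, ∀ w : (Fin r → ℝ) × ℝ, ‖w - (x t, v t)‖ < η →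
      (∀ i, b.stateLow i ≤ w.1 i ∧ w.1 i ≤ b.stateUp i) ∧
        b.controlLow ≤ P.controlLaw w ∧ P.controlLaw w ≤ b.controlUp := by
  obtain ⟨η₀, hη₀, hc⟩ := hc
  have hcont : ContinuousOn (fun t => P.controlLaw (x t, v t)) (Set.Icc (-1) 1) :=
    hcl.comp_continuousOn hx.continuousOn_prod
  -- The bounds for `u`, valid almost everywhere, hold everywhere for its continuous representative.
  have hlow : ∀ t ∈ Set.Icc (-1 : ℝ) 1,
      P.controlLaw (x t, v t) = max (b.controlLow + η₀) (P.controlLaw (x t, v t)) := by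
    refine Measure.eqOn_Icc_of_ae_eq volume (by norm_num) ?_ hcont
      (ContinuousOn.sup continuousOn_const hcont)
    filter_upwards [hu, hc] with t h1 h2
    rw [← h1, max_eq_right h2.1]
  have hup : ∀ t ∈ Set.Icc (-1 : ℝ) 1,
      P.controlLaw (x t, v t) = min (b.controlUp - η₀) (P.controlLaw (x t, v t)) := by
    refine Measure.eqOn_Icc_of_ae_eq volume (by norm_num) ?_ hcont
      (ContinuousOn.inf continuousOn_const hcont)
    filter_upwards [hu, hc] with t h1 h2
    rw [← h1, min_eq_right h2.2]
  -- The image of `[-1, 1]` under the trajectory is a compact subset of the open set `O`.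
  set O : Set ((Fin r → ℝ) × ℝ) := {w | (∀ i, b.stateLow i < w.1 i ∧ w.1 i < b.stateUp i) ∧
    b.controlLow < P.controlLaw w ∧ P.controlLaw w < b.controlUp} with hO
  have hopen : IsOpen O := by
    have h1 : ∀ i, Continuous fun w : (Fin r → ℝ) × ℝ => w.1 i := fun i => by fun_prop
    simp only [hO, Set.ofPred_and, Set.ofPred_forall]
    exact (isOpen_iInter_of_finite fun i => (isOpen_lt continuous_const (h1 i)).inter
      (isOpen_lt (h1 i) continuous_const)).inter
      ((isOpen_lt continuous_const hcl).inter (isOpen_lt hcl continuous_const))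
  have hK := isCompact_Icc.image_of_continuousOn hx.continuousOn_prod
  have hsub : (fun t => (x t, v t)) '' Set.Icc (-1) 1 ⊆ O := by
    rintro _ ⟨t, ht, rfl⟩
    refine ⟨hs t ht, ?_, ?_⟩
    · rw [hlow t ht]
      exact lt_of_lt_of_le (by linarith) (le_max_left _ _)
    · rw [hup t ht]
      exact lt_of_le_of_lt (min_le_left _ _) (by linarith)
  obtain ⟨η, hη, hthick⟩ := hK.exists_thickening_subset_open hopen hsub
  refine ⟨η, hη, fun t ht w hw => ?_⟩
  have hw : w ∈ O := hthick (Metric.mem_thickening_iff.2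
    ⟨_, Set.mem_image_of_mem _ ht, by rwa [dist_eq_norm]⟩)
  exact ⟨fun i => ⟨(hw.1 i).1.le, (hw.1 i).2.le⟩, hw.2.1.le, hw.2.2.le⟩

/-- Truncating the Legendre series of the `m₁`-th derivative of the last component of an optimal
trajectory and integrating back gives discrete solutions, whose errors enter the cost only
quadratically. -/
lemma exists_isDiscreteFeasible_cost_sub_le {P : BolzaData r} {hr : 0 < r}
    (hg : ∀ z, P.g z ≠ 0) (hF : ContDiff ℝ 2 P.F) (hf : ContDiff ℝ 2 P.f)
    (hgm : ContDiff ℝ 2 P.g) (hE : ContDiff ℝ 2 fun z => P.E (P.initial, z))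
    {x : ℝ → Fin r → ℝ} {u : ℝ → ℝ} (hopt : P.IsOptimal x u) {m : ℕ} {y : ℕ → ℝ → ℝ}
    (hy : IsDerivFamily m (fun t => x t (lastIdx hr)) y) {b : SearchBounds r} {m₁ : ℕ}
    (hm₁ : 1 ≤ m₁) (hm₁m : m₁ < m) (hb : b.LargeEnough m₁ x u y) :
    ∃ (K : ℝ) (N₀ : ℕ), 0 ≤ K ∧ ∀ N : ℕ, N₀ ≤ N →
      ∃ (X : Fin (N + 1) → Fin r → ℝ) (U : Fin (N + 1) → ℝ),
        P.IsDiscreteFeasible hr b m₁ N X U ∧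
          P.cost (interpState X) (P.interpControl hr X) - P.cost x u ≤
            K / (N : ℝ) ^ (2 * m - 2 * m₁ - 1) := by
  have hx : P.IsTrajectory hr x (y 1) := hopt.1.isTrajectory (by omega) hy
  have hprim : ∀ j < m, IsPrimitive (y j) (y (j + 1)) := fun j hj => hy.isPrimitive hj
  have hcl : Continuous P.controlLaw := (contDiff_controlLaw (n := 2) hg hf hgm).continuous
  obtain ⟨η, hη, hmargin⟩ := exists_margin hcl hx (hopt.1.control_ae_eq hg hx) hb.state hb.control
  obtain ⟨K, hK0, hK⟩ := exists_cost_sub_le hg hF hf hgm hE hopt hx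
  obtain ⟨q, hq1, hqm⟩ : ∃ q, 1 ≤ q ∧ m₁ + q = m := ⟨m - m₁, by omega, by omega⟩
  obtain ⟨C, hC0, hC⟩ := exists_abs_sub_sum_legCoeff_le hprim hy.bv hq1 (by omega : q ≤ m)
  rw [show m - q = m₁ by omega] at hC
  have hbv : BoundedVariationOn (y (m₁ + 1)) (Set.Icc (-1) 1) := by
    rcases (Nat.succ_le_of_lt hm₁m).eq_or_lt with h | h
    · rw [← Nat.succ_eq_add_one, h]
      exact hy.bv
    · have := (hprim _ h).absolutelyContinuousOnInterval.boundedVariationOn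
      rwa [Set.uIcc_of_le (by norm_num)] at this
  set s := m₁ + (r - 1) with hs
  set a : ℝ := q - 1 / 2 with ha
  have ha0 : 0 < a := by
    have : (1 : ℝ) ≤ q := by exact_mod_cast hq1
    rw [ha]; linarith
  set C' : ℝ := 2 ^ s * (C * 2 ^ a) with hC'
  have hC'0 : 0 ≤ C' := by positivity
  have hlim : Filter.Tendsto (fun N : ℕ => C' * (N : ℝ) ^ (-a)) Filter.atTop (nhds 0) := by
    simpa using ((tendsto_rpow_neg_atTop ha0).comp tendsto_natCast_atTop_atTop).const_mul C'
  -- The factor `2 ^ a` in `C'` accounts for the number of terms `M ≥ N / 2` of the truncated series,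
  -- the factor `2 ^ s` for the `s` integrations.
  obtain ⟨N₁, hN₁⟩ := Filter.eventually_atTop.1
    ((hlim.eventually_lt_const hη).and (hlim.eventually_le_const one_pos))
  refine ⟨K * C' ^ 2, max N₁ (2 * s + 2 * q + 2), by positivity, fun N hN => ?_⟩
  obtain ⟨hNη, hN1⟩ := hN₁ N ((le_max_left _ _).trans hN)
  have hNs : 2 * s + 2 * q + 2 ≤ N := (le_max_right _ _).trans hN
  have hNpos : (0 : ℝ) < N := by exact_mod_cast (by omega : 0 < N)
  set M := N + 2 - r - m₁ with hM
  -- `S` has the largest degree for which its iterated primitive `Q` has degree at most `N`.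
  set S : Polynomial ℝ :=
    ∑ n ∈ Finset.range M, Polynomial.C (legCoeff (y m₁) n) * legendre n with hS
  have hSe : ∀ t, S.eval t = ∑ n ∈ Finset.range M, legCoeff (y m₁) n * (legendre n).eval t :=
    fun t => by simp [hS, Polynomial.eval_finsetSum]
  have hSd : S.natDegree ≤ N - s := by
    refine Polynomial.natDegree_sum_le_of_forall_le _ _ fun n hn => ?_
    have := Finset.mem_range.1 hn
    exact (Polynomial.natDegree_C_mul_le _ _).trans ((natDegree_legendre_le n).trans (by omega))
  set e : ℝ := C' * (N : ℝ) ^ (-a) with he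
  have he0 : 0 ≤ e := by positivity
  have herr : ∀ t ∈ Set.Icc (-1 : ℝ) 1, |S.eval t - y m₁ t| ≤ C * (2 ^ a * (N : ℝ) ^ (-a)) := by
    intro t ht
    rw [hSe, abs_sub_comm]
    refine (hC M (by omega) t ht).trans ?_
    gcongr
    have h2 : (N : ℝ) / 2 ≤ M := by
      rw [div_le_iff₀ (by norm_num)]
      exact_mod_cast (by omega : N ≤ M * 2)
    calc (M : ℝ) ^ (-a) ≤ ((N : ℝ) / 2) ^ (-a) :=
          Real.rpow_le_rpow_of_nonpos (by positivity) h2 (by linarith)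
      _ = _ := by
          rw [Real.div_rpow hNpos.le (by norm_num), Real.rpow_neg (by norm_num : (0 : ℝ) ≤ 2),
            div_inv_eq_mul, mul_comm]
  have hYs : stateDeriv x y s = y m₁ := by
    funext t
    rw [stateDeriv, dif_neg (by omega), show s + 1 - r = m₁ by omega]
  obtain ⟨Q, hQ1, hQ2, hQ3, hQ4⟩ := exists_poly_iterated_primitive s (stateDeriv x y)
    (fun j hj => isPrimitive_stateDeriv hx hprim (by omega)) S _ (by rwa [hYs])
  have hQ4 : ∀ j ≤ s, ∀ t ∈ Set.Icc (-1 : ℝ) 1,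
      |(Polynomial.derivative^[j] Q).eval t - stateDeriv x y j t| ≤ e := fun j hj t ht =>
    (hQ4 j hj t ht).trans (le_of_eq (by rw [he, hC']; ring))
  have hclose : ∀ t ∈ Set.Icc (-1 : ℝ) 1, ‖polyCurve r Q t - (x t, y 1 t)‖ ≤ e := fun t ht =>
    norm_polyCurve_sub_le he0 fun j hj => hQ4 j (by omega) t ht
  have hinit : (polyCurve r Q (-1)).1 = P.initial := by
    rw [← hx.init]
    funext i
    have := i.2
    simp only [polyCurve]
    rw [hQ3 _ (by omega), stateDeriv, dif_pos i.2]
  have hnodal : P.IsNodal Q (fun k : Fin (N + 1) => (polyCurve r Q (node N k)).1)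
      fun k => P.controlLaw (polyCurve r Q (node N k)) :=
    ⟨by omega, fun _ => rfl, fun _ => rfl⟩
  have hN' : 1 ≤ N := by omega
  have hmg := fun t ht => hmargin t ht (polyCurve r Q t) ((hclose t ht).trans_lt hNη)
  refine ⟨_, _, hnodal.isDiscreteFeasible hN' hr hg hm₁ hinit (fun t ht => (hmg t ht).1)
    (fun t ht => (hmg t ht).2) (fun j h1 h2 => ?_) ?_, ?_⟩
  · rw [hQ3 _ (by omega), stateDeriv, dif_neg (by omega), show j + (r - 1) + 1 - r = j by omega]
    have := hb.deriv j h1 h2 (-1) (by simp)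
    exact ⟨this.1.le, this.2.le⟩
  · rw [← hs, hQ1, funext hSe, ← hM]
    refine le_trans (le_of_eq (Finset.sum_congr rfl fun n hn => ?_))
      (((hprim m₁ hm₁m).sum_abs_legCoeff_le hbv M).trans hb.spectral.le)
    rw [legCoeff_sum, if_pos (Finset.mem_range.1 hn)]
  · rw [hnodal.cost_eq hN' hr]
    refine (hK _ _ e (isTrajectory_polyCurve P hr hinit) hN1 hclose).trans (le_of_eq ?_)
    have h2 : ((N : ℝ) ^ (-a)) ^ 2 = ((N : ℝ) ^ (2 * m - 2 * m₁ - 1))⁻¹ := by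
      rw [← Real.rpow_natCast, ← Real.rpow_mul hNpos.le, ← Real.rpow_natCast,
        ← Real.rpow_neg hNpos.le]
      congr 1
      rw [show 2 * m - 2 * m₁ - 1 = 2 * q - 1 by omega, Nat.cast_sub (by omega), ha]
      push_cast
      ring
    rw [he, mul_pow, h2, div_eq_mul_inv, mul_assoc]

/-! ### The regularization order and the rate -/

lemma floor_two_mul_div_three (m : ℕ) : ⌊2 * (m : ℝ) / 3⌋ = ((2 * m / 3 : ℕ) : ℤ) := by
  have h := Nat.floor_div_eq_div (K := ℝ) (2 * m) 3
  push_cast at h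
  rw [← h, Int.natCast_floor_eq_floor (by positivity)]

lemma natFloor_two_mul_div_three (m : ℕ) : ⌊2 * (m : ℝ) / 3⌋₊ = 2 * m / 3 := by
  have h := Nat.floor_div_eq_div (K := ℝ) (2 * m) 3
  push_cast at h
  exact h

lemma gam_eq (m : ℕ) : gam m = 2 * (m : ℝ) / 3 - ((2 * m / 3 : ℕ) : ℝ) := by
  rw [gam, Int.fract, floor_two_mul_div_three, Int.cast_natCast]

lemma gam_three_mul (q : ℕ) : gam (3 * q) = 0 := by
  rw [gam_eq, show 2 * (3 * q) / 3 = 2 * q by omega]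
  push_cast
  ring

lemma gam_three_mul_add_one (q : ℕ) : gam (3 * q + 1) = 2 / 3 := by
  rw [gam_eq, show 2 * (3 * q + 1) / 3 = 2 * q by omega]
  push_cast
  ring

lemma gam_three_mul_add_two (q : ℕ) : gam (3 * q + 2) = 1 / 3 := by
  rw [gam_eq, show 2 * (3 * q + 2) / 3 = 2 * q + 1 by omega]
  push_cast
  ring

lemma bestOrder_three_mul (q : ℕ) : bestOrder (3 * q) = 2 * q := by
  rw [bestOrder, gam_three_mul, if_pos (by norm_num), natFloor_two_mul_div_three]
  omega

lemma bestOrder_three_mul_add_one (q : ℕ) : bestOrder (3 * q + 1) = 2 * q + 1 := by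
  rw [bestOrder, gam_three_mul_add_one, if_neg (lt_irrefl _), natFloor_two_mul_div_three]
  omega

lemma bestOrder_three_mul_add_two (q : ℕ) : bestOrder (3 * q + 2) = 2 * q + 1 := by
  rw [bestOrder, gam_three_mul_add_two, if_pos (by norm_num), natFloor_two_mul_div_three]
  omega

lemma eq_three_mul_add (m : ℕ) : ∃ q, m = 3 * q ∨ m = 3 * q + 1 ∨ m = 3 * q + 2 :=
  ⟨m / 3, by omega⟩

lemma two_le_bestOrder {m : ℕ} (hm : 3 ≤ m) : 2 ≤ bestOrder m := by
  obtain ⟨q, rfl | rfl | rfl⟩ := eq_three_mul_add m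
  · rw [bestOrder_three_mul]; omega
  · rw [bestOrder_three_mul_add_one]; omega
  · rw [bestOrder_three_mul_add_two]; omega

lemma bestOrder_le {m : ℕ} (hm : 3 ≤ m) : bestOrder m ≤ m - 1 := by
  obtain ⟨q, rfl | rfl | rfl⟩ := eq_three_mul_add m
  · rw [bestOrder_three_mul]; omega
  · rw [bestOrder_three_mul_add_one]; omega
  · rw [bestOrder_three_mul_add_two]; omega

lemma combinedExponent_le_bestOrder (m k : ℕ) :
    combinedExponent m k ≤ combinedExponent m (bestOrder m) := by
  unfold combinedExponent
  obtain ⟨q, rfl | rfl | rfl⟩ := eq_three_mul_add m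
  · rw [bestOrder_three_mul]; omega
  · rw [bestOrder_three_mul_add_one]; omega
  · rw [bestOrder_three_mul_add_two]; omega

/-- The guaranteed rate is not better than the combined rate; they agree unless `γ = 0`. -/
lemma floor_sub_rateLoss_le (m : ℕ) {ε : ℝ} (hε : 0 < ε) :
    (⌊2 * (m : ℝ) / 3⌋ : ℝ) - rateLoss m ε ≤ combinedExponent m (bestOrder m) := by
  rw [floor_two_mul_div_three, Int.cast_natCast, rateLoss]
  obtain ⟨q, rfl | rfl | rfl⟩ := eq_three_mul_add m
  · have e : combinedExponent (3 * q) (2 * q) = 2 * q - 1 := by unfold combinedExponent; omega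
    rw [bestOrder_three_mul, gam_three_mul, if_pos rfl, e, show 2 * (3 * q) / 3 = 2 * q by omega]
    push_cast
    linarith
  · have e : combinedExponent (3 * q + 1) (2 * q + 1) = 2 * q - 1 := by
      unfold combinedExponent; omega
    rw [bestOrder_three_mul_add_one, gam_three_mul_add_one, if_neg (by norm_num),
      if_neg (by norm_num), e, show 2 * (3 * q + 1) / 3 = 2 * q by omega]
    push_cast
    linarith
  · have e : combinedExponent (3 * q + 2) (2 * q + 1) = 2 * q := by
      unfold combinedExponent; omega
    rw [bestOrder_three_mul_add_two, gam_three_mul_add_two, if_neg (by norm_num),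
      if_pos (by norm_num), e, show 2 * (3 * q + 2) / 3 = 2 * q + 1 by omega]
    push_cast
    linarith

lemma div_pow_le_div_rpow {K ρ : ℝ} {N n : ℕ} (hK : 0 ≤ K) (hN : 1 ≤ N) (h : ρ ≤ n) :
    K / (N : ℝ) ^ n ≤ K / (N : ℝ) ^ ρ := by
  have hN1 : (1 : ℝ) ≤ N := by exact_mod_cast hN
  have h1 : (N : ℝ) ^ ρ ≤ (N : ℝ) ^ n := by
    rw [← Real.rpow_natCast]
    exact Real.rpow_le_rpow_of_exponent_le hN1 h
  gcongr

/-! ### Convergence -/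

/-- The two rates of convergence: truncating the Legendre series costs `N ^ -(2 m - 2 m₁ - 1)`, and
replacing integrals by quadrature costs `N ^ -(m₁ - 1)`. -/
lemma exists_abs_cost_sub_le {P : BolzaData r} {hr : 0 < r} (hg : ∀ z, P.g z ≠ 0) {m : ℕ}
    (hF : ContDiff ℝ m P.F) (hE : ContDiff ℝ m fun z => P.E (P.initial, z))
    (hf : ContDiff ℝ m P.f) (hgm : ContDiff ℝ m P.g) {x : ℝ → Fin r → ℝ} {u : ℝ → ℝ}
    (hopt : P.IsOptimal x u) {y : ℕ → ℝ → ℝ} (hy : IsDerivFamily m (fun t => x t (lastIdx hr)) y)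
    {b : SearchBounds r} {m₁ : ℕ} (hm₁ : 1 ≤ m₁) (hm₁m : m₁ < m) (hb : b.LargeEnough m₁ x u y) :
    ∃ (K₁ K₂ : ℝ) (N₀ : ℕ), 0 ≤ K₁ ∧ 0 ≤ K₂ ∧ 1 ≤ N₀ ∧ ∀ N : ℕ, N₀ ≤ N →
      ∀ (X : Fin (N + 1) → Fin r → ℝ) (U : Fin (N + 1) → ℝ), P.IsDiscreteOptimal hr b m₁ N X U →
        |P.cost x u - P.cost (interpState X) (P.interpControl hr X)| ≤
            K₁ / (N : ℝ) ^ (2 * m - 2 * m₁ - 1) + K₂ / (N : ℝ) ^ (m₁ - 1) ∧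
          |P.cost x u - P.discreteCost X U| ≤
            K₁ / (N : ℝ) ^ (2 * m - 2 * m₁ - 1) + K₂ / (N : ℝ) ^ (m₁ - 1) := by
  have h2m : ((2 : ℕ) : WithTop ℕ∞) ≤ m := by exact_mod_cast (by omega : 2 ≤ m)
  have hkm : ((m₁ - 1 : ℕ) : WithTop ℕ∞) ≤ m := by exact_mod_cast (by omega : m₁ - 1 ≤ m)
  obtain ⟨K₁, N₁, hK₁, h₁⟩ := exists_isDiscreteFeasible_cost_sub_le hg (hF.of_le h2m)
    (hf.of_le h2m) (hgm.of_le h2m) (hE.of_le h2m) hopt hy hm₁ hm₁m hb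
  obtain ⟨K₂, hK₂, h₂⟩ := exists_abs_cost_sub_discreteCost_le P hr hg b (hF.of_le hkm)
    (hf.of_le hkm) (hgm.of_le hkm)
  rw [show m₁ - 1 + 1 = m₁ by omega] at h₂
  refine ⟨K₁, 3 * K₂, max N₁ (m₁ + r), hK₁, by positivity, by omega, fun N hN X U hXU => ?_⟩
  have hN1 : 1 ≤ N := by omega
  obtain ⟨X', U', hX', hcost⟩ := h₁ N (by omega)
  have a1 := abs_le.1 (h₂ N hN1 (by omega) X U hXU.1)
  have a2 := abs_le.1 (h₂ N hN1 (by omega) X' U' hX')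
  have a3 := hXU.2 X' U' hX'
  have a4 : P.cost x u ≤ P.cost (interpState X) (P.interpControl hr X) := by
    obtain ⟨Q, hQ⟩ := hXU.1.exists_isNodal hN1 hg
    rw [hQ.cost_eq hN1 hr]
    refine hopt.2 _ _ ((isTrajectory_polyCurve P hr ?_).isAdmissible hg
      (contDiff_controlLaw (n := m) hg hf hgm).continuous)
    rw [← hQ.init_eq hN1, hXU.1.init]
  have e : 3 * K₂ / (N : ℝ) ^ (m₁ - 1) = 3 * (K₂ / (N : ℝ) ^ (m₁ - 1)) := by ring
  have b1 : 0 ≤ K₁ / (N : ℝ) ^ (2 * m - 2 * m₁ - 1) := by positivity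
  have b2 : 0 ≤ K₂ / (N : ℝ) ^ (m₁ - 1) := by positivity
  rw [e]
  -- The cost of the interpolated pair is not below the optimal cost, by `a4`. It exceeds it at most
  -- by the excess for the approximation `X'` and two quadrature errors, by `a1`, `a3` and `a2`.
  constructor <;> rw [abs_le] <;> constructor <;> linarith [a1.1, a1.2, a2.1, a2.2]

end

end PSControl

theorem mainTheorem2 {r : ℕ} (hr : 0 < r) (P : PSControl.BolzaData r) (m : ℕ) (hm : 3 ≤ m)
    (hFlip : ∃ K, LipschitzWith K P.F) (hElip : ∃ K, LipschitzWith K P.E)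
    (hflip : ∃ K, LipschitzWith K P.f) (hglip : ∃ K, LipschitzWith K P.g)
    (hg : ∀ z, P.g z ≠ 0)
    (hF : ContDiff ℝ (m : ℕ∞) P.F) (hE : ContDiff ℝ (m : ℕ∞) fun z => P.E (P.initial, z))
    (hf : ContDiff ℝ (m : ℕ∞) P.f) (hgm : ContDiff ℝ (m : ℕ∞) P.g)
    (x : ℝ → Fin r → ℝ) (u : ℝ → ℝ) (hopt : P.IsOptimal x u)
    (y : ℕ → ℝ → ℝ)
    (hy : PSControl.IsDerivFamily m (fun t => x t (PSControl.lastIdx hr)) y) :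
    (2 ≤ PSControl.bestOrder m ∧ PSControl.bestOrder m ≤ m - 1 ∧
      ∀ k : ℕ, 1 ≤ k → k ≤ m - 1 →
        PSControl.combinedExponent m k ≤
          PSControl.combinedExponent m (PSControl.bestOrder m)) ∧
    ∀ b : PSControl.SearchBounds r, b.LargeEnough (PSControl.bestOrder m) x u y →
      ∀ ε : ℝ, 0 < ε → ∃ (C : ℝ) (N₀ : ℕ), ∀ N : ℕ, N₀ ≤ N →
        ∀ (X : Fin (N + 1) → Fin r → ℝ) (U : Fin (N + 1) → ℝ),
          P.IsDiscreteOptimal hr b (PSControl.bestOrder m) N X U →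
            |P.cost x u - P.cost (PSControl.interpState X) (P.interpControl hr X)| ≤
                C / (N : ℝ) ^ ((⌊2 * (m : ℝ) / 3⌋ : ℝ) - PSControl.rateLoss m ε) ∧
            |P.cost x u - P.discreteCost X U| ≤
                C / (N : ℝ) ^ ((⌊2 * (m : ℝ) / 3⌋ : ℝ) - PSControl.rateLoss m ε) := by
  have h2 := PSControl.two_le_bestOrder hm
  have h3 := PSControl.bestOrder_le hm
  refine ⟨⟨h2, h3, fun k _ _ => PSControl.combinedExponent_le_bestOrder m k⟩,
    fun b hb ε hε => ?_⟩
  obtain ⟨K₁, K₂, N₀, hK₁, hK₂, hN₀, h⟩ :=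
    PSControl.exists_abs_cost_sub_le hg (by exact_mod_cast hF) (by exact_mod_cast hE)
      (by exact_mod_cast hf) (by exact_mod_cast hgm) hopt hy (by omega) (by omega) hb
  have hρ := PSControl.floor_sub_rateLoss_le m hε
  set m₁ := PSControl.bestOrder m
  have e1 : PSControl.combinedExponent m m₁ ≤ ((2 * m - 2 * m₁ - 1 : ℕ) : ℤ) := by
    unfold PSControl.combinedExponent; omega
  have e2 : PSControl.combinedExponent m m₁ ≤ ((m₁ - 1 : ℕ) : ℤ) := by
    unfold PSControl.combinedExponent; omega
  refine ⟨K₁ + K₂, N₀, fun N hN X U hXU => ?_⟩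
  have b1 := PSControl.div_pow_le_div_rpow (n := 2 * m - 2 * m₁ - 1) hK₁ (hN₀.trans hN)
    (hρ.trans (by exact_mod_cast e1))
  have b2 := PSControl.div_pow_le_div_rpow (n := m₁ - 1) hK₂ (hN₀.trans hN)
    (hρ.trans (by exact_mod_cast e2))
  rw [add_div]
  exact ⟨(h N hN X U hXU).1.trans (add_le_add b1 b2), (h N hN X U hXU).2.trans (add_le_add b1 b2)⟩
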